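/- **Setting.** Let $M_1$ be a smooth compact manifold with boundary, $n=\dim M_1\ge 2$, let $M\subset M_1^{\rm int}$ be a compact domain with smooth boundary, and let $g$ be a Riemannian metric on $M_1$ of class $C^k$, $k\ge2$. Let $H_m$, $m=1,\dots,p$, be smooth embedded hypersurfaces in $M_1^{\rm int}$ with unit normal $\nu$, let $\mathcal H_m$ be a (relatively) open subset of $\{(z,\theta)\in SM_1:\ z\in H_m,\ \theta\notin T_zH_m\}$, and let $l_m^-\le 0\le l_m^+$ be continuous functions on $\mathcal H_m$ such that for every $(z,\theta)\in\mathcal H_m$ the unit speed geodesic $\gamma_{z,\theta}$ with $\gamma_{z,\theta}(0)=z$, $\dot\gamma_{z,\theta}(0)=\theta$ is defined on $[l_m^-(z,\theta),l_m^+(z,\theta)]$, stays in $M_1^{\rm int}$, and has its endpoints in $M_1^{\rm int}\setminus M$. (Absence of conjugate points is not needed.) Put $d\mu=|\langle\nu(z),\theta\rangle|\,dS_z\,d\theta$ on $\mathcal H_m$. Let $\alpha_m\in C_0^\infty(\mathcal H_m)$ (real or complex valued). Let $L^2(M)$, $L^2(M_1)$ be the spaces of square integrable (real or complex valued) symmetric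 2-tensor fields with the inner product $(f,h)=\int f_{ij}\bar h^{ij}\,d\mathrm{vol}_g$; fields on $M$ are extended by $0$ to $M_1$. For $(z,\theta)\in\mathcal H_m$ let $$If(z,\theta)=\int_{l_m^-(z,\theta)}^{l_m^+(z,\theta)} f_{ij}(\gamma_{z,\theta}(t))\,\dot\gamma^i_{z,\theta}(t)\,\dot\gamma^j_{z,\theta}(t)\,dt,\qquad I_{\alpha_m}f=\alpha_m\,If,\qquad I_\alpha=\{I_{\alpha_m}\},\qquad N_\alpha=\sum_m I_{\alpha_m}^*I_{\alpha_m},$$ the adjoints being taken with respect to $L^2(\mathcal H_m,d\mu)$ and $L^2(M)$ (respectively $L^2(M_1)$, when $N_\alpha$ is regarded as a map into $L^2(M_1)$). A linear map $T$ on $L^2(M)$ is called *s-injective* if $f\in L^2(M)$ and $Tf=0$ imply $f=dv$ in $M$ for some 1-form $v\in H^1_0(M)$, where $[dv]_{ij}=\frac12(\nabla_iv_j+\nabla_jv_i)$. For $A_m\subset\mathcal H_m$, the transform $I$ restricted to the geodesics issued from the sets $A_m$ vanishes on $f$ if, for every $m$, $If(z,\theta)=0$ for almost every $(z,\theta)\in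 A_m$. **Lemma 2.2.** $I_\alpha$ is well defined and bounded from $L^2(M_1)$ to $\bigoplus_m L^2(\mathcal H_m,d\mu)$: there is a constant $C$ such that for all $f\in L^2(M_1)$ and all $m$, the integral $If(z,\theta)$ converges absolutely for $\mu$-almost every $(z,\theta)\in\operatorname{supp}\alpha_m$, and $\|I_{\alpha_m}f\|^2_{L^2(\mathcal H_m,d\mu)}\le C\|f\|^2_{L^2(M_1)}$. Consider the statements (a) $I_\alpha$ is s-injective on $L^2(M)$; (b) $N_\alpha:L^2(M)\to L^2(M)$ is s-injective; (c) $N_\alpha:L^2(M)\to L^2(M_1)$ is s-injective; (d) $I$ restricted to the geodesics issued from the sets $(\operatorname{supp}\alpha_m)^{\rm int}$ is s-injective on $L^2(M)$; (d$'$) $I$ restricted to the geodesics issued from the sets $\{\alpha_m\ne0\}$ is s-injective on $L^2(M)$. If, for every $m$, $\alpha_m\neq0$ almost everywhere in $(\operatorname{supp}\alpha_m)^{\rm int}$ (the interior of the support relative to $\mathcal H_m$), then (a), (b), (c), (d) are equivalent. Without this assumption, (a), (b), (c), (d$'$) are equivalent, and (a) implies (d). -/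

import Mathlib

open Set Filter Topology MeasureTheory Manifold
open scoped ContDiff NNReal

noncomputable section

namespace GeodesicXRay

section Geometry

variable {n : ℕ} {H : Type*} [TopologicalSpace H]
  {I : ModelWithCorners ℝ (EuclideanSpace ℝ (Fin n)) H}
  {N : Type*} [TopologicalSpace N] [ChartedSpace H N] [IsManifold I ∞ N]

/-- Tangent bundles carry their Borel sets. -/
instance instMeasurableSpaceTangentBundle : MeasurableSpace (TangentBundle I N) := borel _

instance instBorelSpaceTangentBundle : BorelSpace (TangentBundle I N) := ⟨rfl⟩

/-- `M` is a compact domain with smooth boundary (a compact embedded submanifold with boundary, of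
codimension `0`) contained in the interior of the manifold `N`: near each boundary point it is
`{ρ ≥ 0}` for a smooth `ρ` with non-vanishing differential. -/
structure IsRegularDomain (I : ModelWithCorners ℝ (EuclideanSpace ℝ (Fin n)) H)
    (M : Set N) : Prop where
  isCompact : IsCompact M
  subset_interior : M ⊆ I.interior N
  smooth_boundary : ∀ p ∈ frontier M, ∃ U : Set N, IsOpen U ∧ p ∈ U ∧ ∃ ρ : N → ℝ,
    ContMDiffOn I 𝓘(ℝ, ℝ) ∞ ρ U ∧ mfderiv I 𝓘(ℝ, ℝ) ρ p ≠ 0 ∧ ∀ x ∈ U, (x ∈ M ↔ 0 ≤ ρ x)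

/-- `ι : S → N` is a smooth embedding with image in the interior of `N`. -/
structure IsInteriorEmbedding {d : ℕ} {S : Type*} [TopologicalSpace S]
    [ChartedSpace (EuclideanSpace ℝ (Fin d)) S]
    (I : ModelWithCorners ℝ (EuclideanSpace ℝ (Fin n)) H) (ι : S → N) : Prop where
  contMDiff : ContMDiff (𝓡 d) I ∞ ι
  isEmbedding : IsEmbedding ι
  injective_mfderiv : ∀ z, Function.Injective (mfderiv (𝓡 d) I ι z)
  mem_interior : ∀ z, ι z ∈ I.interior N

/-- The space of `C²` Riemannian metrics on `N`. -/
abbrev Metric (I : ModelWithCorners ℝ (EuclideanSpace ℝ (Fin n)) H) (N : Type*)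
    [TopologicalSpace N] [ChartedSpace H N] [IsManifold I ∞ N] :=
  Bundle.ContMDiffRiemannianMetric I 2 (EuclideanSpace ℝ (Fin n))
    (fun x : N => TangentSpace I x)

variable (I) in
/-- The vector at `x` whose components in the chart centred at `q` are `v`
(meaningful when `x` lies in the domain of that chart). -/
def vecAt (q x : N) (v : EuclideanSpace ℝ (Fin n)) : TangentSpace I x :=
  (trivializationAt (EuclideanSpace ℝ (Fin n)) (TangentSpace I : N → Type _) q).symmL ℝ x v

variable (I) in
/-- The coordinate vector field `∂ᵢ` of the chart centred at `q`. -/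
def frame (q x : N) (i : Fin n) : TangentSpace I x :=
  vecAt I q x (EuclideanSpace.single i (1 : ℝ))

/-- The Gram matrix of a family of tangent vectors at `x`. -/
def gram (g : Metric I N) (x : N) {k : ℕ} (w : Fin k → TangentSpace I x) :
    Matrix (Fin k) (Fin k) ℝ :=
  Matrix.of fun i j => g.inner x (w i) (w j)

/-- The Gram matrix of the basis `frame I x x` of `T_x N`. -/
def gramAt (g : Metric I N) (x : N) : Matrix (Fin n) (Fin n) ℝ :=
  gram g x (frame I x x)

/-! ### Volume measures -/

/-- The Riemannian volume measure on `S` of the pull-back of `g` under an immersion `ι : S → N`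
(for `ι = id`, the Riemannian volume of `N`). In the chart of `S` centred at `s` it is
`√det (g(dι ∂ᵢ, dι ∂ⱼ)) dy`; the supremum over `s` glues these (mutually compatible) measures. -/
def volumeOf (g : Metric I N) {k : ℕ} {H' : Type*} [TopologicalSpace H']
    (J : ModelWithCorners ℝ (EuclideanSpace ℝ (Fin k)) H') {S : Type*} [TopologicalSpace S]
    [ChartedSpace H' S] [IsManifold J ∞ S] [MeasurableSpace S] (ι : S → N) : Measure S :=
  ⨆ s : S, (((volume : Measure (EuclideanSpace ℝ (Fin k))).restrict
      (extChartAt J s).target).withDensity fun y =>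
        ENNReal.ofReal (√ (gram g (ι ((extChartAt J s).symm y)) fun i =>
          mfderiv J I ι ((extChartAt J s).symm y)
            (frame J s ((extChartAt J s).symm y) i)).det)).map (extChartAt J s).symm

/-- The Riemannian volume of `N`. -/
def vol [MeasurableSpace N] (g : Metric I N) : Measure N := volumeOf g I (id : N → N)

/-- The measure `dθ` on the unit sphere `S_x N ⊆ T_x N` of the Euclidean space `(T_x N, g_x)`:
`dθ(B) = n · vol {rθ : 0 < r < 1, θ ∈ B}`. As a vector space `T_x N` is `ℝⁿ`, with the coordinates
given by `frame I x x`. -/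
def sphereMeasure (g : Metric I N) (x : N) : Measure (EuclideanSpace ℝ (Fin n)) :=
  (n : ENNReal) • ((ENNReal.ofReal (√ (gramAt g x).det)) •
    (volume : Measure (EuclideanSpace ℝ (Fin n))).restrict
      {v | 0 < g.inner x (vecAt I x x v) (vecAt I x x v) ∧
        g.inner x (vecAt I x x v) (vecAt I x x v) < 1}).map
    fun v => (√ (g.inner x (vecAt I x x v) (vecAt I x x v)))⁻¹ • v

/-- `ν` is a field of unit vectors normal to the hypersurface `ι : S → N`. -/
def IsUnitNormal {d : ℕ} {S : Type*} [TopologicalSpace S]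
    [ChartedSpace (EuclideanSpace ℝ (Fin d)) S] (g : Metric I N) (ι : S → N)
    (ν : ∀ z : S, TangentSpace I (ι z)) : Prop :=
  ∀ z, g.inner (ι z) (ν z) (ν z) = 1 ∧
    ∀ w : TangentSpace (𝓡 d) z, g.inner (ι z) (ν z) (mfderiv (𝓡 d) I ι z w) = 0

/-- The measure `|⟨ν(z), θ⟩| dS_z dθ` on the unit sphere bundle over the hypersurface `ι : S → N`,
viewed as a measure on the tangent bundle of `N`. -/
def fluxMeasure {d : ℕ} {S : Type*} [TopologicalSpace S]
    [ChartedSpace (EuclideanSpace ℝ (Fin d)) S] [IsManifold (𝓡 d) ∞ S] [MeasurableSpace S]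
    (g : Metric I N) (ι : S → N) (ν : ∀ z : S, TangentSpace I (ι z)) :
    Measure (TangentBundle I N) :=
  (volumeOf g (𝓡 d) ι).bind fun z =>
    ((sphereMeasure g (ι z)).withDensity fun v =>
      ENNReal.ofReal |g.inner (ι z) (ν z) (vecAt I (ι z) (ι z) v)|).map
      fun v => (⟨ι z, vecAt I (ι z) (ι z) v⟩ : TangentBundle I N)

/-! ### Geodesics -/

/-- `g(u, w)` in the chart centred at `q`, at the point with coordinates `y`. -/
def metricCoord (g : Metric I N) (q : N) (y u w : EuclideanSpace ℝ (Fin n)) : ℝ :=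
  g.inner ((extChartAt I q).symm y) (vecAt I q ((extChartAt I q).symm y) u)
    (vecAt I q ((extChartAt I q).symm y) w)

/-- The vector with components `Γᵏᵢⱼ uⁱ wʲ` in the chart centred at `q`, at the point with
coordinates `y`, where `Γᵏᵢⱼ = ½ gᵏˡ (∂ᵢ gⱼₗ + ∂ⱼ gᵢₗ - ∂ₗ gᵢⱼ)`. -/
def christoffel (g : Metric I N) (q : N) (y u w : EuclideanSpace ℝ (Fin n)) :
    EuclideanSpace ℝ (Fin n) :=
  WithLp.toLp 2 fun k => (1 / 2 : ℝ) * ∑ l : Fin n,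
    (gram g ((extChartAt I q).symm y) (frame I q ((extChartAt I q).symm y)))⁻¹ k l *
      (fderiv ℝ (fun y' => metricCoord g q y' w (EuclideanSpace.single l 1)) y u +
        fderiv ℝ (fun y' => metricCoord g q y' u (EuclideanSpace.single l 1)) y w -
        fderiv ℝ (fun y' => metricCoord g q y' u w) y (EuclideanSpace.single l 1))

/-- `β = (γ, γ̇)` is the lift to the tangent bundle of a geodesic `γ : [a, b] → N` with values in the
interior of `N`: in every chart, `ẋ = w` and `ẇᵏ = -Γᵏᵢⱼ(x) wⁱ wʲ`. -/
structure IsGeodesicLift (g : Metric I N) (β : ℝ → TangentBundle I N) (a b : ℝ) : Prop where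
  continuousOn : ContinuousOn β (Icc a b)
  mem_interior : ∀ t ∈ Icc a b, (β t).proj ∈ I.interior N
  hasDeriv_base : ∀ q : N, ∀ t ∈ Icc a b, (β t).proj ∈ (chartAt H q).source →
    HasDerivWithinAt (fun s => extChartAt I q (β s).proj)
      ((trivializationAt (EuclideanSpace ℝ (Fin n)) (TangentSpace I : N → Type _) q) (β t)).2
      (Icc a b) t
  hasDeriv_fiber : ∀ q : N, ∀ t ∈ Icc a b, (β t).proj ∈ (chartAt H q).source →
    HasDerivWithinAt
      (fun s => ((trivializationAt (EuclideanSpace ℝ (Fin n))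
        (TangentSpace I : N → Type _) q) (β s)).2)
      (-christoffel g q (extChartAt I q (β t).proj)
        ((trivializationAt (EuclideanSpace ℝ (Fin n)) (TangentSpace I : N → Type _) q) (β t)).2
        ((trivializationAt (EuclideanSpace ℝ (Fin n)) (TangentSpace I : N → Type _) q) (β t)).2)
      (Icc a b) t

/-- The set of `(z, θ)` in the unit sphere bundle of `N` with `z` in the hypersurface `ι(S)` and `θ`
not tangent to it. -/
def transversalVectors {d : ℕ} {S : Type*} [TopologicalSpace S]
    [ChartedSpace (EuclideanSpace ℝ (Fin d)) S] (g : Metric I N) (ι : S → N) :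
    Set (TangentBundle I N) :=
  {p | ∃ (z : S) (θ : TangentSpace I (ι z)), p = ⟨ι z, θ⟩ ∧ g.inner (ι z) θ θ = 1 ∧
    θ ∉ range (mfderiv (𝓡 d) I ι z)}

/-- The data of a family `Γ(ℋ)` of geodesics: an open set `ℋ` of unit vectors at points of the
hypersurface `ι(S)` and transversal to it, continuous functions `l⁻ ≤ 0 ≤ l⁺` on `ℋ`, and for each
`p = (z, θ) ∈ ℋ` the (lifted) geodesic `t ↦ (γ_{z,θ}(t), γ̇_{z,θ}(t))`, `l⁻(p) ≤ t ≤ l⁺(p)`, with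
initial value `(z, θ)` at `t = 0`, whose endpoints lie outside `M`. -/
structure IsGeodesicFamily {d : ℕ} {S : Type*} [TopologicalSpace S]
    [ChartedSpace (EuclideanSpace ℝ (Fin d)) S] (g : Metric I N) (M : Set N) (ι : S → N)
    (ℋ : Set (TangentBundle I N)) (lm lp : TangentBundle I N → ℝ)
    (γ : TangentBundle I N → ℝ → TangentBundle I N) : Prop where
  isOpen : ∃ U : Set (TangentBundle I N), IsOpen U ∧ ℋ = U ∩ transversalVectors (d := d) g ι
  continuousOn_lm : ContinuousOn lm ℋ
  continuousOn_lp : ContinuousOn lp ℋ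
  lm_nonpos : ∀ p ∈ ℋ, lm p ≤ 0
  lp_nonneg : ∀ p ∈ ℋ, 0 ≤ lp p
  initial : ∀ p ∈ ℋ, γ p 0 = p
  geodesic : ∀ p ∈ ℋ, IsGeodesicLift g (γ p) (lm p) (lp p)
  left_notMem : ∀ p ∈ ℋ, (γ p (lm p)).proj ∉ M
  right_notMem : ∀ p ∈ ℋ, (γ p (lp p)).proj ∉ M

/-! ### Tensor fields -/

/-- Covariant `2`-tensor fields with values in `𝕜 = ℝ` or `ℂ` (no regularity). -/
abbrev TensorField (I : ModelWithCorners ℝ (EuclideanSpace ℝ (Fin n)) H) (N : Type*)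
    [TopologicalSpace N] [ChartedSpace H N] (𝕜 : Type*) [RCLike 𝕜] :=
  ∀ x : N, TangentSpace I x →ₗ[ℝ] TangentSpace I x →ₗ[ℝ] 𝕜

/-- `1`-forms with values in `𝕜 = ℝ` or `ℂ` (no regularity). -/
abbrev OneForm (I : ModelWithCorners ℝ (EuclideanSpace ℝ (Fin n)) H) (N : Type*)
    [TopologicalSpace N] [ChartedSpace H N] (𝕜 : Type*) [RCLike 𝕜] :=
  ∀ x : N, TangentSpace I x →ₗ[ℝ] 𝕜

variable {𝕜 : Type*} [RCLike 𝕜]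

/-- A `2`-tensor field is measurable if its components in all charts are. -/
def TensorMeasurable [MeasurableSpace N] (f : TensorField I N 𝕜) : Prop :=
  ∀ (q : N) (i j : Fin n),
    Measurable fun x : (chartAt H q).source => f x (frame I q x i) (frame I q x j)

/-- A `1`-form is measurable if its components in all charts are. -/
def FormMeasurable [MeasurableSpace N] (v : OneForm I N 𝕜) : Prop :=
  ∀ (q : N) (i : Fin n), Measurable fun x : (chartAt H q).source => v x (frame I q x i)

/-- The pointwise product `⟨f, h̄⟩ = gⁱᵏ gʲˡ f_{ij} h̄_{kl}` of `2`-tensors at `x`, given as (bilinear)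
functions of two tangent vectors. -/
def tensorInner (g : Metric I N) (x : N) (f h : TangentSpace I x → TangentSpace I x → 𝕜) : 𝕜 :=
  ∑ i, ∑ j, ∑ k, ∑ l, ((((gramAt g x)⁻¹ i k * (gramAt g x)⁻¹ j l : ℝ)) : 𝕜) *
    f (frame I x x i) (frame I x x j) * star (h (frame I x x k) (frame I x x l))

/-- The squared norm `|f|²` of a `2`-tensor at `x`. -/
def tensorNormSq (g : Metric I N) (x : N) (f : TangentSpace I x → TangentSpace I x → 𝕜) : ℝ :=
  RCLike.re (tensorInner g x f f)

/-- The squared norm `|v|² = gⁱʲ vᵢ v̄ⱼ` of a covector at `x`. -/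
def formNormSq (g : Metric I N) (x : N) (v : TangentSpace I x → 𝕜) : ℝ :=
  RCLike.re (∑ i, ∑ j, (((gramAt g x)⁻¹ i j : ℝ) : 𝕜) *
    v (frame I x x i) * star (v (frame I x x j)))

/-- `f ∈ L²(A)`: a measurable symmetric `2`-tensor field, extended as `0` outside `A`, with finite
`L²` norm. Fields are identified when they agree almost everywhere. -/
structure MemL2 [MeasurableSpace N] (g : Metric I N) (A : Set N) (f : TensorField I N 𝕜) :
    Prop where
  measurable : TensorMeasurable f
  symm : ∀ x u w, f x u w = f x w u
  eq_zero : ∀ x ∉ A, f x = 0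
  finite : ∫⁻ x, ENNReal.ofReal (tensorNormSq g x fun u w => f x u w) ∂(vol g) < ⊤

/-- The inner product `(f, h) = ∫ ⟨f, h̄⟩ dvol`. -/
def l2Inner [MeasurableSpace N] (g : Metric I N) (f h : TensorField I N 𝕜) : 𝕜 :=
  ∫ x, tensorInner g x (fun u w => f x u w) (fun u w => h x u w) ∂(vol g)

/-! ### Potential tensor fields -/

/-- A smooth `1`-form with compact support in the interior of `M`. -/
structure IsTestForm (M : Set N) (v : OneForm I N 𝕜) : Prop where
  contMDiff : ContMDiff I.tangent 𝓘(ℝ, 𝕜) ∞ (fun p : TangentBundle I N => v p.proj p.snd)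
  support : ∃ K : Set N, IsCompact K ∧ K ⊆ interior M ∧ ∀ x ∉ K, v x = 0

/-- The covariant derivative `(∇ᵤ v)(w) = uⁱ wʲ (∂ᵢ vⱼ - Γᵏᵢⱼ vₖ)` of a `1`-form at `x`, computed in
the chart centred at `x` (for `x` in the interior of `N`). -/
def covDeriv (g : Metric I N) (v : OneForm I N 𝕜) (x : N) (u w : TangentSpace I x) : 𝕜 :=
  fderiv ℝ (fun y : EuclideanSpace ℝ (Fin n) =>
      v ((extChartAt I x).symm y) (vecAt I x ((extChartAt I x).symm y) (coord x w)))
    (extChartAt I x x) (coord x u) -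
  v x (vecAt I x x (christoffel g x (extChartAt I x x) (coord x u) (coord x w)))
where
  /-- The components of a vector at `x` in the chart centred at `x`. -/
  coord (x : N) (u : TangentSpace I x) : EuclideanSpace ℝ (Fin n) :=
    (trivializationAt (EuclideanSpace ℝ (Fin n)) (TangentSpace I : N → Type _) x).continuousLinearMapAt
      ℝ x u

/-- `v ∈ H¹₀(M)` and `∇v = T`: the pair `(v, T)` is the limit in `L²(M)` of pairs `(vⱼ, ∇vⱼ)` with
`vⱼ` smooth and compactly supported in the interior of `M`; that is, `vⱼ → v` in `H¹(M)`. -/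
def IsH10WithGradient [MeasurableSpace N] (g : Metric I N) (M : Set N) (v : OneForm I N 𝕜)
    (T : TensorField I N 𝕜) : Prop :=
  FormMeasurable v ∧ TensorMeasurable T ∧ ∃ vs : ℕ → OneForm I N 𝕜,
    (∀ j, IsTestForm M (vs j)) ∧
    Tendsto (fun j => ∫⁻ x in M, ENNReal.ofReal (formNormSq g x fun u => vs j x u - v x u) ∂(vol g))
      atTop (𝓝 0) ∧
    Tendsto (fun j => ∫⁻ x in M, ENNReal.ofReal
      (tensorNormSq g x fun u w => covDeriv g (vs j) x u w - T x u w) ∂(vol g)) atTop (𝓝 0)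

/-- `f = dv` in `M` for some `v ∈ H¹₀(M)`, where `[dv]_{ij} = ½ (∇ᵢ vⱼ + ∇ⱼ vᵢ)`. -/
def IsPotential [MeasurableSpace N] (g : Metric I N) (M : Set N) (f : TensorField I N 𝕜) : Prop :=
  ∃ (v : OneForm I N 𝕜) (T : TensorField I N 𝕜), IsH10WithGradient g M v T ∧
    ∀ᵐ x ∂((vol g).restrict M), ∀ u w, f x u w = (1 / 2 : 𝕜) * (T x u w + T x w u)

/-! ### The X-ray transform and the normal operator -/

/-- `⟨f(γ(t)), γ̇(t)²⟩` along a lifted curve `β = (γ, γ̇)`. -/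
def integrand (f : TensorField I N 𝕜) (β : ℝ → TangentBundle I N) (t : ℝ) : 𝕜 :=
  f (β t).proj (β t).snd (β t).snd

/-- A hypersurface `H` in the interior of `N` (given by an embedding `ι : S → N`), a family `Γ(ℋ)` of
geodesics issued from `H`, and a weight `α ∈ C₀^∞(ℋ)`. Functions on `ℋ` are given by functions on
the tangent bundle, whose values outside `ℋ` are irrelevant. -/
structure WeightedFamily (g : Metric I N) (M : Set N) (d : ℕ) (𝕜 : Type*) [RCLike 𝕜] where
  S : Type*
  [topologicalSpace : TopologicalSpace S]
  [chartedSpace : ChartedSpace (EuclideanSpace ℝ (Fin d)) S]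
  [isManifold : IsManifold (𝓡 d) ∞ S]
  [measurableSpace : MeasurableSpace S]
  [borelSpace : BorelSpace S]
  ι : S → N
  isInteriorEmbedding : IsInteriorEmbedding (d := d) I ι
  /-- A unit normal (its sign plays no role). -/
  ν : ∀ z : S, TangentSpace I (ι z)
  isUnitNormal : IsUnitNormal (d := d) g ι ν
  ℋ : Set (TangentBundle I N)
  lm : TangentBundle I N → ℝ
  lp : TangentBundle I N → ℝ
  γ : TangentBundle I N → ℝ → TangentBundle I N
  isGeodesicFamily : IsGeodesicFamily (d := d) g M ι ℋ lm lp γ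
  α : TangentBundle I N → 𝕜
  contMDiffOn_α : ContMDiffOn I.tangent 𝓘(ℝ, 𝕜) ∞ α ℋ
  hasCompactSupport_α : HasCompactSupport (fun p : ℋ => α p)

namespace WeightedFamily

variable {g : Metric I N} {M : Set N} {d : ℕ}

attribute [instance] topologicalSpace chartedSpace isManifold measurableSpace borelSpace

/-- The measure `dμ = |⟨ν(z), θ⟩| dS_z dθ` on `ℋ`. -/
def μ (F : WeightedFamily g M d 𝕜) : Measure (TangentBundle I N) :=
  (fluxMeasure (d := d) g F.ι F.ν).restrict F.ℋ

/-- The X-ray transform `(If)(z, θ) = ∫_{l⁻}^{l⁺} ⟨f(γ_{z,θ}), γ̇_{z,θ}²⟩ dt`. -/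
def xray (F : WeightedFamily g M d 𝕜) (f : TensorField I N 𝕜) (p : TangentBundle I N) : 𝕜 :=
  ∫ t in (F.lm p)..(F.lp p), integrand f (F.γ p) t

/-- The weighted transform `I_α f = α · If`. -/
def weightedXray (F : WeightedFamily g M d 𝕜) (f : TensorField I N 𝕜) (p : TangentBundle I N) : 𝕜 :=
  F.α p * F.xray f p

/-- The support of `α` (a closed subset of `ℋ`). -/
def support (F : WeightedFamily g M d 𝕜) : Set (TangentBundle I N) :=
  Subtype.val '' tsupport (fun p : F.ℋ => F.α p)

/-- The interior (in `ℋ`) of the support of `α`. -/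
def supportInterior (F : WeightedFamily g M d 𝕜) : Set (TangentBundle I N) :=
  Subtype.val '' interior (tsupport (fun p : F.ℋ => F.α p))

/-- The set of points of `ℋ` where `α ≠ 0`. -/
def nonzeroSet (F : WeightedFamily g M d 𝕜) : Set (TangentBundle I N) :=
  {p ∈ F.ℋ | F.α p ≠ 0}

end WeightedFamily

variable {g : Metric I N} {M : Set N} {d : ℕ} {κ : Type*} [Fintype κ] [MeasurableSpace N]

/-- A transform of tensor fields is s-injective on `L²(M)` if every `f ∈ L²(M)` for which it
vanishes (`Vanishes f`) is potential: `f = dv` with `v ∈ H¹₀(M)`. -/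
def SInjective (g : Metric I N) (M : Set N) (Vanishes : TensorField I N 𝕜 → Prop) : Prop :=
  ∀ f : TensorField I N 𝕜, MemL2 g M f → Vanishes f → IsPotential g M f

/-- `I_α f = 0`, where `I_α = {I_{αₘ}}` maps to `⨁ₘ L²(ℋₘ, dμ)`. -/
def WeightedXrayVanishes (F : κ → WeightedFamily g M d 𝕜) (f : TensorField I N 𝕜) : Prop :=
  ∀ m, ∀ᵐ p ∂(F m).μ, (F m).weightedXray f p = 0

/-- `If = 0` on the geodesics issued from the points of `A m ⊆ ℋₘ`, for all `m`. -/
def XrayVanishesOn (F : κ → WeightedFamily g M d 𝕜) (A : κ → Set (TangentBundle I N))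
    (f : TensorField I N 𝕜) : Prop :=
  ∀ m, ∀ᵐ p ∂(F m).μ, p ∈ A m → (F m).xray f p = 0

/-- `h = N_α f`, where `N_α = ∑ₘ I_{αₘ}^* I_{αₘ}` is regarded as an operator into `L²(A)`:
`h ∈ L²(A)` and `(h, φ)_{L²(A)} = ∑ₘ (I_{αₘ} f, I_{αₘ} φ)_{L²(ℋₘ, dμ)}` for all `φ ∈ L²(A)`. -/
def IsNormalImage (F : κ → WeightedFamily g M d 𝕜) (A : Set N) (f h : TensorField I N 𝕜) : Prop :=
  MemL2 g A h ∧ ∀ φ : TensorField I N 𝕜, MemL2 g A φ →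
    l2Inner g h φ = ∑ m, ∫ p, (F m).weightedXray f p * star ((F m).weightedXray φ p) ∂(F m).μ

/-- `N_α f = 0` in `L²(A)`. -/
def NormalVanishes (F : κ → WeightedFamily g M d 𝕜) (A : Set N) (f : TensorField I N 𝕜) : Prop :=
  ∃ h : TensorField I N 𝕜, IsNormalImage F A f h ∧ ∀ᵐ x ∂(vol g), h x = 0

end Geometry

end GeodesicXRay

end

open Set Filter Topology MeasureTheory Manifold
open scoped ContDiff NNReal

set_option linter.unusedSectionVars false

noncomputable section

/-! Once `I_α` is known to be bounded, the equivalences are soft. Testing `N_α f` against `f` itself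
gives `(N_α f, f) = ∑ ‖I_{αₘ} f‖²`, so `N_α f = 0` exactly when `I_α f = 0`, whichever space `L²(A)`
receives `N_α f`, as long as it contains `f` (`normalVanishes_iff`). The product `α · If` vanishes
almost everywhere exactly when `If` does on `{α ≠ 0}` (`weightedXrayVanishes_iff`), and this set is
open in `ℋ`, hence contained in the interior of the support.

The work lies in boundedness. The support of `α` is compact, so the lengths and speeds of the
geodesics involved are bounded. Cauchy–Schwarz in time and `|f(w, w)| ≤ |f| |w|²` then reduce the
claim to an `L¹` estimate for nonnegative functions of position: the integral of `φ(γ_p(t))` over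
time and flux measure is at most `C ∫ φ dvol` (`IsGeodesicFamily.exists_lintegral_le`). By
compactness a local estimate suffices (`IsGeodesicFamily.exists_local_lintegral_le`).

Locally, the map from initial data and time to the end position and velocity should be a change of
variables, because the geodesics cross the hypersurface transversally. Instead of a Jacobian, a
Lipschitz bound for the inverse is used: a map `f` with `dist x y ≤ K dist (f x) (f y)` between
spaces of equal dimension cannot compress Lebesgue measure by more than a constant factor
(`exists_setLIntegral_comp_le`, by Hausdorff measure). For short times this bound comes from the
injectivity of `(a, δ) ↦ D a - δ v₀`, where `D` is the derivative of a parametrisation of the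
hypersurface (`IsFlowBox.dist_initial_le_aux`). For longer times Grönwall's inequality carries the
end of the geodesic back to a short time (`IsGeodesicLift.isFlowLipschitz`,
`exists_dist_initial_le`). The geodesic field of a `C²` metric is `C¹`, hence locally Lipschitz,
which is all that is needed.

Unit vectors are replaced by a thin shell of vectors, so that Lebesgue measure can be used
throughout. The geodesic with initial velocity `ρθ` at time `t/ρ` is at `γ_θ(t)` with velocity `ρ
γ̇_θ(t)`. The source then has dimension `d + n + 1`, equal to the dimension `2n` of the tangent
bundle. The flux weight is used only through `|⟨ν, θ⟩| ≤ 1`: constants may depend on the compact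
set, which stays away from tangential directions. Negative times are treated as positive ones after
a change of sign `ε = -1` of the velocity. -/

namespace GeodesicXRay

/-! ### Coordinates on the tangent bundle over interior points -/

section Coordinates

variable {n : ℕ} {H : Type*} [TopologicalSpace H]
  {I : ModelWithCorners ℝ (EuclideanSpace ℝ (Fin n)) H}
  {N : Type*} [TopologicalSpace N] [ChartedSpace H N] [IsManifold I ∞ N]

variable (I) in
/-- The interior points of the domain of the chart centred at `q`. -/
def baseDomain (q : N) : Set N := (chartAt H q).source ∩ I.interior N

variable (I) in
/-- The tangent vectors at interior points of the domain of the chart centred at `q`. -/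
def coordDomain (q : N) : Set (TangentBundle I N) := {p | p.proj ∈ baseDomain I q}

variable (I) in
/-- Position and velocity components of a tangent vector in the chart centred at `q`. -/
def coords (q : N) (p : TangentBundle I N) :
    EuclideanSpace ℝ (Fin n) × EuclideanSpace ℝ (Fin n) :=
  (extChartAt I q p.proj,
    ((trivializationAt (EuclideanSpace ℝ (Fin n)) (TangentSpace I : N → Type _) q) p).2)

variable (I) in
/-- The interior of the target of the chart centred at `q`. -/
def coordTarget (q : N) : Set (EuclideanSpace ℝ (Fin n)) := interior (extChartAt I q).target

variable (I) in
/-- The tangent vector with given position and velocity components. -/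
def coordsSymm (q : N) (a : EuclideanSpace ℝ (Fin n) × EuclideanSpace ℝ (Fin n)) :
    TangentBundle I N :=
  ⟨(extChartAt I q).symm a.1, vecAt I q ((extChartAt I q).symm a.1) a.2⟩

lemma isOpen_baseDomain (q : N) : IsOpen (baseDomain I q) :=
  (chartAt H q).open_source.inter (ModelWithCorners.isOpen_interior (n := ∞) (by simp))

lemma isOpen_coordDomain (q : N) : IsOpen (coordDomain I q) :=
  (isOpen_baseDomain q).preimage (FiberBundle.continuous_proj _ _)

lemma isOpen_coordTarget (q : N) : IsOpen (coordTarget I q) := isOpen_interior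

lemma mem_baseDomain_self {q : N} (hq : q ∈ I.interior N) : q ∈ baseDomain I q :=
  ⟨mem_chart_source H q, hq⟩

lemma extChartAt_mem_coordTarget {q x : N} (hx : x ∈ baseDomain I q) :
    extChartAt I q x ∈ coordTarget I q :=
  (ModelWithCorners.isInteriorPoint_iff_of_mem_atlas (n := ∞) (by simp)
    (chart_mem_atlas H q) hx.1).1 hx.2

lemma extChartAt_symm_mem_baseDomain {q : N} {y : EuclideanSpace ℝ (Fin n)}
    (hy : y ∈ coordTarget I q) : (extChartAt I q).symm y ∈ baseDomain I q := by
  have hy' : y ∈ (extChartAt I q).target := interior_subset hy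
  have hs : (extChartAt I q).symm y ∈ (chartAt H q).source := by
    rw [← extChartAt_source I]; exact (extChartAt I q).map_target hy'
  refine ⟨hs, (ModelWithCorners.isInteriorPoint_iff_of_mem_atlas (n := ∞) (by simp)
    (chart_mem_atlas H q) hs).2 ?_⟩
  change extChartAt I q ((extChartAt I q).symm y) ∈ interior (extChartAt I q).target
  rw [(extChartAt I q).right_inv hy']
  exact hy

lemma coords_mem {q : N} {p : TangentBundle I N} (hp : p ∈ coordDomain I q) :
    coords I q p ∈ coordTarget I q ×ˢ univ :=
  ⟨extChartAt_mem_coordTarget hp, mem_univ _⟩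

lemma coordsSymm_mem {q : N} {a : EuclideanSpace ℝ (Fin n) × EuclideanSpace ℝ (Fin n)}
    (ha : a.1 ∈ coordTarget I q) : coordsSymm I q a ∈ coordDomain I q :=
  extChartAt_symm_mem_baseDomain ha

lemma coords_mk_vecAt {q x : N} (hx : x ∈ (chartAt H q).source) (v : EuclideanSpace ℝ (Fin n)) :
    coords I q ⟨x, vecAt I q x v⟩ = (extChartAt I q x, v) := by
  have hb : x ∈ (trivializationAt (EuclideanSpace ℝ (Fin n))
      (TangentSpace I : N → Type _) q).baseSet := by
    rwa [TangentBundle.trivializationAt_baseSet]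
  unfold coords vecAt
  refine Prod.ext rfl ?_
  have := (trivializationAt (EuclideanSpace ℝ (Fin n))
      (TangentSpace I : N → Type _) q).continuousLinearMapAt_symmL (R := ℝ) hb v
  rw [Bundle.Trivialization.continuousLinearMapAt_apply,
    Bundle.Trivialization.coe_linearMapAt_of_mem _ hb] at this
  exact this

lemma vecAt_coords {q x : N} (hx : x ∈ (chartAt H q).source) (w : TangentSpace I x) :
    vecAt I q x (coords I q ⟨x, w⟩).2 = w := by
  have hb : x ∈ (trivializationAt (EuclideanSpace ℝ (Fin n))
      (TangentSpace I : N → Type _) q).baseSet := by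
    rwa [TangentBundle.trivializationAt_baseSet]
  have := (trivializationAt (EuclideanSpace ℝ (Fin n))
      (TangentSpace I : N → Type _) q).symmL_continuousLinearMapAt (R := ℝ) hb w
  rw [Bundle.Trivialization.continuousLinearMapAt_apply,
    Bundle.Trivialization.coe_linearMapAt_of_mem _ hb] at this
  exact this

lemma coords_coordsSymm {q : N} {a : EuclideanSpace ℝ (Fin n) × EuclideanSpace ℝ (Fin n)}
    (ha : a.1 ∈ coordTarget I q) : coords I q (coordsSymm I q a) = a := by
  unfold coordsSymm
  rw [coords_mk_vecAt (extChartAt_symm_mem_baseDomain ha).1,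
    (extChartAt I q).right_inv (interior_subset ha)]

lemma coordsSymm_coords {q : N} {p : TangentBundle I N} (hp : p ∈ coordDomain I q) :
    coordsSymm I q (coords I q p) = p := by
  have h1 : (extChartAt I q).symm (extChartAt I q p.proj) = p.proj :=
    (extChartAt I q).left_inv (by rw [extChartAt_source]; exact hp.1)
  have h2 := vecAt_coords hp.1 p.snd
  unfold coordsSymm
  rcases p with ⟨x, w⟩
  simp only [coords] at h1 h2 ⊢
  rw [h1, h2]

/-- The pair of position and velocity components is a chart of the manifold `TangentBundle I N`.
Continuity and smoothness of `coords` and `coordsSymm` are inherited from the general theory through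
this identity. -/
lemma coords_eq_extChartAt (q : N) (w : TangentSpace I q) :
    coords I q = extChartAt I.tangent (⟨q, w⟩ : TangentBundle I N) := by
  ext1 p
  rw [FiberBundle.extChartAt]
  rfl

lemma coordsSymm_eq_extChartAt_symm (q : N) (w : TangentSpace I q)
    {a : EuclideanSpace ℝ (Fin n) × EuclideanSpace ℝ (Fin n)} (ha : a.1 ∈ coordTarget I q) :
    coordsSymm I q a = (extChartAt I.tangent (⟨q, w⟩ : TangentBundle I N)).symm a := by
  have hs := coordsSymm_mem ha
  have hx : coordsSymm I q a ∈ (extChartAt I.tangent (⟨q, w⟩ : TangentBundle I N)).source := by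
    rw [extChartAt_source, TangentBundle.mem_chart_source_iff]; exact hs.1
  have := (extChartAt I.tangent (⟨q, w⟩ : TangentBundle I N)).left_inv hx
  rw [← coords_eq_extChartAt, coords_coordsSymm ha] at this
  exact this.symm

lemma continuousOn_coords (q : N) : ContinuousOn (coords I q) (coordDomain I q) := by
  rw [coords_eq_extChartAt q 0]
  refine (continuousOn_extChartAt (I := I.tangent) (⟨q, 0⟩ : TangentBundle I N)).mono ?_
  intro p hp
  rw [extChartAt_source, TangentBundle.mem_chart_source_iff]; exact hp.1

lemma continuousOn_coordsSymm (q : N) :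
    ContinuousOn (coordsSymm I q) (coordTarget I q ×ˢ univ) := by
  have : EqOn (coordsSymm I q) (extChartAt I.tangent (⟨q, 0⟩ : TangentBundle I N)).symm
      (coordTarget I q ×ˢ univ) := fun a ha => coordsSymm_eq_extChartAt_symm q 0 ha.1
  refine ContinuousOn.congr ?_ this
  refine (continuousOn_extChartAt_symm (I := I.tangent) (⟨q, 0⟩ : TangentBundle I N)).mono ?_
  intro a ha
  have hx : coordsSymm I q a ∈ (extChartAt I.tangent (⟨q, 0⟩ : TangentBundle I N)).source := by
    rw [extChartAt_source, TangentBundle.mem_chart_source_iff]; exact (coordsSymm_mem ha.1).1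
  have := (extChartAt I.tangent (⟨q, 0⟩ : TangentBundle I N)).map_source hx
  rwa [← coords_eq_extChartAt, coords_coordsSymm ha.1] at this

lemma isOpen_coordTarget_prod (q : N) : IsOpen (coordTarget I q ×ˢ univ :
    Set (EuclideanSpace ℝ (Fin n) × EuclideanSpace ℝ (Fin n))) :=
  (isOpen_coordTarget q).prod isOpen_univ

lemma continuousAt_coords {q : N} {p : TangentBundle I N} (hp : p ∈ coordDomain I q) :
    ContinuousAt (coords I q) p :=
  (continuousOn_coords q).continuousAt ((isOpen_coordDomain q).mem_nhds hp)

lemma continuousAt_coordsSymm {q : N} {a : EuclideanSpace ℝ (Fin n) × EuclideanSpace ℝ (Fin n)}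
    (ha : a.1 ∈ coordTarget I q) : ContinuousAt (coordsSymm I q) a :=
  (continuousOn_coordsSymm q).continuousAt
    ((isOpen_coordTarget_prod q).mem_nhds ⟨ha, mem_univ _⟩)

/-- Neighbourhoods of a tangent vector contain the vectors with nearby components. -/
lemma exists_ball_of_mem_nhds {q : N} {p : TangentBundle I N} (hp : p ∈ coordDomain I q)
    {V : Set (TangentBundle I N)} (hV : V ∈ 𝓝 p) :
    ∃ r > 0, ∀ p' ∈ coordDomain I q, dist (coords I q p') (coords I q p) < r → p' ∈ V := by
  have h := (continuousAt_coordsSymm (coords_mem hp).1)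
  rw [ContinuousAt, coordsSymm_coords hp] at h
  obtain ⟨r, hr, h⟩ := Metric.mem_nhds_iff.1 (h hV)
  refine ⟨r, hr, fun p' hp' hd => ?_⟩
  have := h (Metric.mem_ball.2 hd)
  rwa [mem_preimage, coordsSymm_coords hp'] at this

lemma tendsto_of_tendsto_coords {α : Type*} {l : Filter α} {q : N} {p : TangentBundle I N}
    (hp : p ∈ coordDomain I q) {f : α → TangentBundle I N} (hf : ∀ᶠ a in l, f a ∈ coordDomain I q)
    (h : Tendsto (fun a => coords I q (f a)) l (𝓝 (coords I q p))) : Tendsto f l (𝓝 p) := by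
  intro V hV
  obtain ⟨r, hr, hV⟩ := exists_ball_of_mem_nhds hp hV
  have hb := h (Metric.ball_mem_nhds _ hr)
  rw [mem_map] at hb ⊢
  filter_upwards [hf, hb] with a h1 h2
  exact hV _ h1 h2

/-- Transition maps of the tangent bundle are smooth within the range of the model with corners.
Over interior points this range is a neighbourhood, so the regularity is genuine. -/
lemma contDiffAt_coords_coordsSymm {q q' : N}
    {a : EuclideanSpace ℝ (Fin n) × EuclideanSpace ℝ (Fin n)} (ha : a.1 ∈ coordTarget I q)
    (ha' : coordsSymm I q a ∈ coordDomain I q') :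
    ContDiffAt ℝ 1 (fun b => coords I q' (coordsSymm I q b)) a := by
  have h0 := coordsSymm_eq_extChartAt_symm q 0 ha
  have hmem : a ∈ ((extChartAt I.tangent (⟨q, 0⟩ : TangentBundle I N)).symm ≫
      extChartAt I.tangent (⟨q', 0⟩ : TangentBundle I N)).source := by
    rw [PartialEquiv.trans_source, PartialEquiv.symm_source]
    constructor
    · have hx : coordsSymm I q a ∈ (extChartAt I.tangent (⟨q, 0⟩ : TangentBundle I N)).source := by
        rw [extChartAt_source, TangentBundle.mem_chart_source_iff]; exact (coordsSymm_mem ha).1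
      have := (extChartAt I.tangent (⟨q, 0⟩ : TangentBundle I N)).map_source hx
      rwa [← coords_eq_extChartAt, coords_coordsSymm ha] at this
    · rw [mem_preimage, ← h0, extChartAt_source, TangentBundle.mem_chart_source_iff]
      exact ha'.1
  have h := contDiffWithinAt_ext_coord_change (I := I.tangent) (n := 1)
    (⟨q', 0⟩ : TangentBundle I N) (⟨q, 0⟩ : TangentBundle I N) hmem
  have hr : range I.tangent ∈ 𝓝 a := by
    refine mem_of_superset ((isOpen_coordTarget_prod q).mem_nhds ⟨ha, mem_univ _⟩) ?_
    rintro ⟨y, w⟩ hy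
    have : y ∈ range I := extChartAt_target_subset_range q (interior_subset hy.1)
    obtain ⟨x, rfl⟩ := this
    exact ⟨(x, w), rfl⟩
  refine (h.contDiffAt hr).congr_of_eventuallyEq ?_
  filter_upwards [(isOpen_coordTarget_prod q).mem_nhds ⟨ha, mem_univ _⟩] with b hb
  rw [coords_eq_extChartAt q' 0, coordsSymm_eq_extChartAt_symm q 0 hb.1]
  rfl

/-- Changes of charts are locally Lipschitz. -/
lemma exists_coords_lipschitz {q q' : N} {p : TangentBundle I N} (hp : p ∈ coordDomain I q)
    (hp' : p ∈ coordDomain I q') :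
    ∃ K : ℝ≥0, ∃ V ∈ 𝓝 p, V ⊆ coordDomain I q ∩ coordDomain I q' ∧ ∀ p₁ ∈ V, ∀ p₂ ∈ V,
      dist (coords I q' p₁) (coords I q' p₂) ≤ K * dist (coords I q p₁) (coords I q p₂) := by
  have h := contDiffAt_coords_coordsSymm (q' := q') (coords_mem hp).1
    (by rwa [coordsSymm_coords hp])
  obtain ⟨K, t, ht, hK⟩ := h.exists_lipschitzOnWith
  refine ⟨K, coords I q ⁻¹' t ∩ (coordDomain I q ∩ coordDomain I q'),
    inter_mem (continuousAt_coords hp ht) (inter_mem ((isOpen_coordDomain q).mem_nhds hp)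
      ((isOpen_coordDomain q').mem_nhds hp')), inter_subset_right, fun p₁ h₁ p₂ h₂ => ?_⟩
  have := hK.dist_le_mul _ h₁.1 _ h₂.1
  simpa only [coordsSymm_coords h₁.2.1, coordsSymm_coords h₂.2.1] using this

/-- Scalar multiplication in the fibres of the tangent bundle. -/
def scaleVec (r : ℝ) (p : TangentBundle I N) : TangentBundle I N := ⟨p.proj, r • p.snd⟩

lemma coords_scaleVec {q : N} (r : ℝ) {p : TangentBundle I N}
    (hp : p.proj ∈ (chartAt H q).source) :
    coords I q (scaleVec r p) = ((coords I q p).1, r • (coords I q p).2) := by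
  have hb : p.proj ∈ (trivializationAt (EuclideanSpace ℝ (Fin n))
      (TangentSpace I : N → Type _) q).baseSet := by
    rwa [TangentBundle.trivializationAt_baseSet]
  refine Prod.ext rfl ?_
  exact ((trivializationAt (EuclideanSpace ℝ (Fin n))
      (TangentSpace I : N → Type _) q).linear ℝ hb).map_smul r p.snd

lemma vecAt_smul (q x : N) (r : ℝ) (v : EuclideanSpace ℝ (Fin n)) :
    vecAt I q x (r • v) = r • vecAt I q x v := map_smul _ _ _

lemma vecAt_eq_sum (q x : N) (v : EuclideanSpace ℝ (Fin n)) :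
    vecAt I q x v = ∑ i, v i • frame I q x i := by
  unfold frame
  simp only [← vecAt_smul]
  unfold vecAt
  rw [← map_sum]
  congr 1
  ext j
  simp [Finset.sum_apply, Pi.single_apply]

lemma scaleVec_scaleVec (r s : ℝ) (p : TangentBundle I N) :
    scaleVec r (scaleVec s p) = scaleVec (r * s) p := by
  exact congrArg (Bundle.TotalSpace.mk p.proj) (smul_smul r s p.snd)

lemma scaleVec_one (p : TangentBundle I N) : scaleVec 1 p = p := by
  simp [scaleVec]

end Coordinates

/-! ### The geodesic vector field and its homogeneity -/

section Spray

variable {n : ℕ} {H : Type*} [TopologicalSpace H]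
  {I : ModelWithCorners ℝ (EuclideanSpace ℝ (Fin n)) H}
  {N : Type*} [TopologicalSpace N] [ChartedSpace H N] [IsManifold I ∞ N]
  (g : Metric I N)

lemma contMDiffOn_coordsSymm_const (q : N) (u : EuclideanSpace ℝ (Fin n)) :
    ContMDiffOn 𝓘(ℝ, EuclideanSpace ℝ (Fin n)) I.tangent 2
      (fun y => coordsSymm I q (y, u)) (coordTarget I q) := by
  have h1 := contMDiffOn_extChartAt_symm (I := I.tangent) (n := 2) (⟨q, 0⟩ : TangentBundle I N)
  have h2 : ContMDiffOn 𝓘(ℝ, EuclideanSpace ℝ (Fin n))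
      𝓘(ℝ, EuclideanSpace ℝ (Fin n) × EuclideanSpace ℝ (Fin n)) 2
      (fun y => (y, u)) (coordTarget I q) :=
    (contDiff_id.prodMk contDiff_const).contMDiff.contMDiffOn
  refine (h1.comp h2 fun y hy => ?_).congr fun y hy => coordsSymm_eq_extChartAt_symm q 0 hy
  have hx : coordsSymm I q (y, u) ∈
      (extChartAt I.tangent (⟨q, 0⟩ : TangentBundle I N)).source := by
    rw [extChartAt_source, TangentBundle.mem_chart_source_iff]
    exact (coordsSymm_mem (a := (y, u)) hy).1
  have := (extChartAt I.tangent (⟨q, 0⟩ : TangentBundle I N)).map_source hx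
  rwa [← coords_eq_extChartAt, coords_coordsSymm (a := (y, u)) hy] at this

lemma contDiffOn_metricCoord (q : N) (u w : EuclideanSpace ℝ (Fin n)) :
    ContDiffOn ℝ 2 (fun y => metricCoord g q y u w) (coordTarget I q) := by
  rw [← contMDiffOn_iff_contDiffOn]
  intro y hy
  have hb : ContMDiffWithinAt 𝓘(ℝ, EuclideanSpace ℝ (Fin n)) I 2 (extChartAt I q).symm
      (coordTarget I q) y :=
    ((contMDiffOn_extChartAt_symm (n := 2) q).mono interior_subset) y hy
  have hu := contMDiffOn_coordsSymm_const q u y hy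
  have hw := contMDiffOn_coordsSymm_const q w y hy
  have : ContMDiffWithinAt 𝓘(ℝ, EuclideanSpace ℝ (Fin n)) (I.prod 𝓘(ℝ)) 2
      (fun m ↦ Bundle.TotalSpace.mk' ℝ (E := Bundle.Trivial N ℝ) ((extChartAt I q).symm m)
        (metricCoord g q m u w)) (coordTarget I q) y := by
    apply ContMDiffWithinAt.clm_bundle_apply₂ (F₁ := EuclideanSpace ℝ (Fin n))
      (F₂ := EuclideanSpace ℝ (Fin n))
    · exact ContMDiffAt.comp_contMDiffWithinAt y g.contMDiff.contMDiffAt hb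
    · exact hu
    · exact hw
  simp only [Bundle.contMDiffWithinAt_totalSpace] at this
  exact this.2

/-- The components of the metric in the chart centred at `q`. -/
def metricMatrix (q : N) (y : EuclideanSpace ℝ (Fin n)) : Matrix (Fin n) (Fin n) ℝ :=
  gram g ((extChartAt I q).symm y) (frame I q ((extChartAt I q).symm y))

lemma inner_vecAt (q x : N) (u w : EuclideanSpace ℝ (Fin n)) :
    g.inner x (vecAt I q x u) (vecAt I q x w) =
      ∑ i, ∑ j, u i * w j * gram g x (frame I q x) i j := by
  rw [vecAt_eq_sum q x u, vecAt_eq_sum q x w]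
  simp only [map_sum, map_smul, gram, Matrix.of_apply]
  rw [Finset.sum_comm]
  refine Finset.sum_congr rfl fun j _ => ?_
  rw [sum_apply, Finset.smul_sum]
  refine Finset.sum_congr rfl fun i _ => ?_
  rw [smul_apply, smul_eq_mul, smul_eq_mul]
  ring

lemma metricCoord_eq_sum (q : N) (y u w : EuclideanSpace ℝ (Fin n)) :
    metricCoord g q y u w = ∑ i, ∑ j, u i * w j * metricMatrix g q y i j :=
  inner_vecAt g q _ u w

lemma contDiffOn_metricMatrix (q : N) (i j : Fin n) :
    ContDiffOn ℝ 2 (fun y => metricMatrix g q y i j) (coordTarget I q) :=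
  contDiffOn_metricCoord g q _ _

lemma vecAt_injective {q x : N} (hx : x ∈ (chartAt H q).source) :
    Function.Injective (vecAt I q x) := fun v w h => by
  have h1 := coords_mk_vecAt (I := I) hx v
  rw [h, coords_mk_vecAt hx w] at h1
  exact (Prod.ext_iff.1 h1).2.symm

lemma posDef_gram_frame {q x : N} (hx : x ∈ (chartAt H q).source) :
    (gram g x (frame I q x)).PosDef := by
  refine Matrix.PosDef.of_dotProduct_mulVec_pos ?_ fun v hv => ?_
  · ext i j
    simp [gram, g.symm x]
  · have h := inner_vecAt g q x (WithLp.toLp 2 v) (WithLp.toLp 2 v)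
    have hne : vecAt I q x (WithLp.toLp 2 v) ≠ 0 := by
      intro h0
      have h1 : vecAt I q x (0 : EuclideanSpace ℝ (Fin n)) = 0 := map_zero _
      have := vecAt_injective hx (h0.trans h1.symm)
      exact hv (by simpa using congrArg (WithLp.ofLp) this)
    have hp := g.pos x _ hne
    rw [h] at hp
    refine hp.trans_eq (Eq.symm ?_)
    simp only [dotProduct, Matrix.mulVec, Finset.mul_sum, star_trivial]
    refine Finset.sum_congr rfl fun i _ => Finset.sum_congr rfl fun j _ => by ring

lemma posDef_metricMatrix (q : N) {y : EuclideanSpace ℝ (Fin n)} (hy : y ∈ coordTarget I q) :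
    (metricMatrix g q y).PosDef :=
  posDef_gram_frame g (extChartAt_symm_mem_baseDomain hy).1

lemma contDiffOn_det {E : Type*} [NormedAddCommGroup E] [NormedSpace ℝ E] {k : ℕ}
    {A : E → Matrix (Fin k) (Fin k) ℝ} {s : Set E} {m : WithTop ℕ∞}
    (hA : ∀ i j, ContDiffOn ℝ m (fun y => A y i j) s) :
    ContDiffOn ℝ m (fun y => (A y).det) s := by
  refine ContDiffOn.congr (f := fun y => ∑ σ : Equiv.Perm (Fin k),
    (Equiv.Perm.sign σ : ℝ) * ∏ i, A y (σ i) i) ?_ fun y _ => Matrix.det_apply' _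
  refine ContDiffOn.sum fun σ _ => ?_
  refine contDiffOn_const.mul ?_
  exact contDiffOn_prod fun i _ => hA _ _

lemma contDiffOn_matrix_inv {E : Type*} [NormedAddCommGroup E] [NormedSpace ℝ E] {k : ℕ}
    {A : E → Matrix (Fin k) (Fin k) ℝ} {s : Set E} {m : WithTop ℕ∞}
    (hA : ∀ i j, ContDiffOn ℝ m (fun y => A y i j) s) (hdet : ∀ y ∈ s, (A y).det ≠ 0)
    (i j : Fin k) : ContDiffOn ℝ m (fun y => (A y)⁻¹ i j) s := by
  simp only [Matrix.inv_def, Ring.inverse_eq_inv', Matrix.smul_apply, smul_eq_mul,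
    Matrix.adjugate_apply]
  refine ((contDiffOn_det hA).inv hdet).mul (contDiffOn_det fun i' j' => ?_)
  by_cases h : i' = j
  · subst h; simp [contDiffOn_const]
  · simpa [Matrix.updateRow_ne h] using hA i' j'

/-- The geodesic vector field in the chart centred at `q`. -/
def spray (q : N) (a : EuclideanSpace ℝ (Fin n) × EuclideanSpace ℝ (Fin n)) :
    EuclideanSpace ℝ (Fin n) × EuclideanSpace ℝ (Fin n) :=
  (a.2, -christoffel g q a.1 a.2 a.2)

/-- Bilinearity takes the vectors `u` and `w` out of the derivative, which then acts only on the
metric components. Both the joint regularity of the Christoffel term in position and velocity and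
its homogeneity are read off from this form. -/
lemma fderiv_metricCoord (q : N) {y : EuclideanSpace ℝ (Fin n)} (hy : y ∈ coordTarget I q)
    (u w v : EuclideanSpace ℝ (Fin n)) :
    fderiv ℝ (fun y' => metricCoord g q y' u w) y v =
      ∑ i, ∑ j, u i * w j * fderiv ℝ (fun y' => metricMatrix g q y' i j) y v := by
  have hd : ∀ i j, DifferentiableAt ℝ (fun y' => metricMatrix g q y' i j) y := fun i j =>
    ((contDiffOn_metricMatrix g q i j).contDiffAt
      ((isOpen_coordTarget q).mem_nhds hy)).differentiableAt (by simp)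
  simp only [metricCoord_eq_sum]
  rw [fderiv_fun_sum (fun i _ => DifferentiableAt.fun_sum fun j _ => (hd i j).const_mul _),
    sum_apply]
  refine Finset.sum_congr rfl fun i _ => ?_
  rw [fderiv_fun_sum (fun j _ => (hd i j).const_mul _), sum_apply]
  refine Finset.sum_congr rfl fun j _ => ?_
  rw [fderiv_const_mul (hd i j)]
  rfl

/-- One derivative of the metric is lost, so a `C²` metric gives a `C¹` field; this is where the
regularity of `g` is spent. -/
lemma contDiffOn_christoffel (q : N) :
    ContDiffOn ℝ 1 (fun a : EuclideanSpace ℝ (Fin n) × EuclideanSpace ℝ (Fin n) =>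
      christoffel g q a.1 a.2 a.2) (coordTarget I q ×ˢ univ) := by
  have hG : ∀ i j, ContDiffOn ℝ 1
      (fun a : EuclideanSpace ℝ (Fin n) × EuclideanSpace ℝ (Fin n) =>
        (metricMatrix g q a.1)⁻¹ i j) (coordTarget I q ×ˢ univ) := by
    intro i j
    refine (contDiffOn_matrix_inv (fun i j => (contDiffOn_metricMatrix g q i j).of_le (by norm_num))
      (fun y hy => (posDef_metricMatrix g q hy).det_pos.ne') i j).comp contDiffOn_fst ?_
    exact fun a ha => ha.1
  have hF : ∀ i j, ContDiffOn ℝ 1 (fderiv ℝ (fun y' => metricMatrix g q y' i j))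
      (coordTarget I q) := fun i j =>
    ((contDiffOn_metricMatrix g q i j)).fderiv_of_isOpen (isOpen_coordTarget q) (by norm_num)
  have hD : ∀ {u v w : EuclideanSpace ℝ (Fin n) × EuclideanSpace ℝ (Fin n) →
      EuclideanSpace ℝ (Fin n)}, ContDiff ℝ 1 u → ContDiff ℝ 1 w → ContDiff ℝ 1 v →
      ContDiffOn ℝ 1 (fun a => fderiv ℝ (fun y' => metricCoord g q y' (u a) (w a)) a.1 (v a))
        (coordTarget I q ×ˢ univ) := by
    intro u v w hu hw hv
    refine ContDiffOn.congr (f := fun a => ∑ i, ∑ j, u a i * w a j *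
      fderiv ℝ (fun y' => metricMatrix g q y' i j) a.1 (v a)) ?_
      fun a ha => fderiv_metricCoord g q ha.1 _ _ _
    refine ContDiffOn.sum fun i _ => ContDiffOn.sum fun j _ => ?_
    refine ContDiffOn.mul ?_ ?_
    · have h1 : ContDiff ℝ 1 fun a => u a i := by fun_prop
      have h2 : ContDiff ℝ 1 fun a => w a j := by fun_prop
      exact (h1.mul h2).contDiffOn
    · exact ((hF i j).comp contDiffOn_fst fun a ha => ha.1).clm_apply hv.contDiffOn
  have hk : ∀ k, ContDiffOn ℝ 1
      (fun a : EuclideanSpace ℝ (Fin n) × EuclideanSpace ℝ (Fin n) =>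
        christoffel g q a.1 a.2 a.2 k) (coordTarget I q ×ˢ univ) := by
    intro k
    unfold christoffel
    simp only
    refine contDiffOn_const.mul (ContDiffOn.sum fun l _ => (hG k l).mul ?_)
    exact ((hD contDiff_snd contDiff_const contDiff_snd).add
      (hD contDiff_snd contDiff_const contDiff_snd)).sub
      (hD contDiff_snd contDiff_snd contDiff_const)
  rw [contDiffOn_piLp]
  exact hk

lemma contDiffOn_spray (q : N) : ContDiffOn ℝ 1 (spray g q) (coordTarget I q ×ˢ univ) :=
  contDiffOn_snd.prodMk (contDiffOn_christoffel g q).neg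

lemma christoffel_smul (q : N) {y : EuclideanSpace ℝ (Fin n)} (hy : y ∈ coordTarget I q)
    (u : EuclideanSpace ℝ (Fin n)) (r : ℝ) :
    christoffel g q y (r • u) (r • u) = (r * r) • christoffel g q y u u := by
  ext k
  unfold christoffel
  simp only [fderiv_metricCoord g q hy, PiLp.smul_apply, smul_eq_mul, map_smul]
  rw [mul_left_comm (r * r)]
  congr 1
  rw [Finset.mul_sum]
  refine Finset.sum_congr rfl fun l _ => ?_
  rw [mul_left_comm (r * r)]
  congr 1
  rw [mul_sub, mul_add]
  simp only [Finset.mul_sum]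
  congr 1
  · congr 1 <;> exact Finset.sum_congr rfl fun i _ => Finset.sum_congr rfl fun j _ => by ring
  · exact Finset.sum_congr rfl fun i _ => Finset.sum_congr rfl fun j _ => by ring

variable {g}

/-- Derivative of the chart representation of a lifted geodesic. -/
lemma IsGeodesicLift.hasDerivWithinAt {β : ℝ → TangentBundle I N} {a b : ℝ}
    (h : IsGeodesicLift g β a b) (q : N) {t : ℝ} (ht : t ∈ Icc a b)
    (hq : (β t).proj ∈ (chartAt H q).source) :
    HasDerivWithinAt (fun s => coords I q (β s)) (spray g q (coords I q (β t))) (Icc a b) t :=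
  (h.hasDeriv_base q t ht hq).prodMk (h.hasDeriv_fiber q t ht hq)

lemma IsGeodesicLift.mono {β : ℝ → TangentBundle I N} {a b a' b' : ℝ}
    (h : IsGeodesicLift g β a b) (ha : a ≤ a') (hb : b' ≤ b) : IsGeodesicLift g β a' b' where
  continuousOn := h.continuousOn.mono (Icc_subset_Icc ha hb)
  mem_interior t ht := h.mem_interior t (Icc_subset_Icc ha hb ht)
  hasDeriv_base q t ht hq :=
    (h.hasDeriv_base q t (Icc_subset_Icc ha hb ht) hq).mono (Icc_subset_Icc ha hb)
  hasDeriv_fiber q t ht hq :=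
    (h.hasDeriv_fiber q t (Icc_subset_Icc ha hb ht) hq).mono (Icc_subset_Icc ha hb)

lemma isGeodesicLift_of_hasDerivWithinAt {β : ℝ → TangentBundle I N} {a b : ℝ}
    (hc : ContinuousOn β (Icc a b)) (hi : ∀ t ∈ Icc a b, (β t).proj ∈ I.interior N)
    (hd : ∀ q : N, ∀ t ∈ Icc a b, (β t).proj ∈ (chartAt H q).source →
      HasDerivWithinAt (fun s => coords I q (β s)) (spray g q (coords I q (β t))) (Icc a b) t) :
    IsGeodesicLift g β a b where
  continuousOn := hc
  mem_interior := hi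
  hasDeriv_base q t ht hq := ((ContinuousLinearMap.fst ℝ (EuclideanSpace ℝ (Fin n))
    (EuclideanSpace ℝ (Fin n))).hasFDerivAt.comp_hasDerivWithinAt t (hd q t ht hq))
  hasDeriv_fiber q t ht hq := ((ContinuousLinearMap.snd ℝ (EuclideanSpace ℝ (Fin n))
    (EuclideanSpace ℝ (Fin n))).hasFDerivAt.comp_hasDerivWithinAt t (hd q t ht hq))

lemma continuous_scaleVec (r : ℝ) : ContinuousOn (scaleVec r : TangentBundle I N → _)
    {p | p.proj ∈ I.interior N} := by
  intro p hp
  refine ContinuousAt.continuousWithinAt ?_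
  have hp' : p ∈ coordDomain I p.proj := mem_baseDomain_self hp
  refine tendsto_of_tendsto_coords (q := p.proj) (p := scaleVec r p) hp'
    (((isOpen_coordDomain p.proj).mem_nhds hp')) ?_
  have h := continuousAt_coords hp'
  rw [coords_scaleVec r hp'.1]
  have h2 : Tendsto (fun a => ((coords I p.proj a).1, r • (coords I p.proj a).2)) (𝓝 p)
      (𝓝 ((coords I p.proj p).1, r • (coords I p.proj p).2)) :=
    (continuous_fst.prodMk (continuous_snd.const_smul r)).continuousAt.tendsto.comp h
  refine h2.congr' ?_
  filter_upwards [(isOpen_coordDomain p.proj).mem_nhds hp'] with a ha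
  rw [coords_scaleVec r ha.1]

/-- Affine reparametrisations of geodesics are geodesics. -/
lemma IsGeodesicLift.scale {β : ℝ → TangentBundle I N} {a b a' b' r c : ℝ}
    (h : IsGeodesicLift g β a b) (hr : ∀ t ∈ Icc a' b', r * t + c ∈ Icc a b) :
    IsGeodesicLift g (fun t => scaleVec r (β (r * t + c))) a' b' := by
  have hm : MapsTo (fun t => r * t + c) (Icc a' b') (Icc a b) := hr
  have hcont : ContinuousOn (fun t => β (r * t + c)) (Icc a' b') :=
    h.continuousOn.comp (by fun_prop) hm
  refine isGeodesicLift_of_hasDerivWithinAt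
    ((continuous_scaleVec r).comp hcont fun t ht => h.mem_interior _ (hr t ht))
    (fun t ht => h.mem_interior _ (hr t ht)) fun q t ht hq => ?_
  have hq' : (β (r * t + c)).proj ∈ (chartAt H q).source := hq
  have hdom : β (r * t + c) ∈ coordDomain I q := ⟨hq', h.mem_interior _ (hr t ht)⟩
  have h1 := h.hasDerivWithinAt q (hr t ht) hq'
  have h2 : HasDerivWithinAt (fun t => r * t + c) r (Icc a' b') t := by
    simpa using ((hasDerivAt_id t).const_mul r).add_const c |>.hasDerivWithinAt
  have h3 := h1.scomp t h2 hm
  have h4 : HasDerivWithinAt (fun t => ((coords I q (β (r * t + c))).1,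
      r • (coords I q (β (r * t + c))).2))
      (r • (coords I q (β (r * t + c))).2,
        r • (r • (spray g q (coords I q (β (r * t + c)))).2)) (Icc a' b') t := by
    have ha := (ContinuousLinearMap.fst ℝ (EuclideanSpace ℝ (Fin n))
      (EuclideanSpace ℝ (Fin n))).hasFDerivAt.comp_hasDerivWithinAt t h3
    have hb := (ContinuousLinearMap.snd ℝ (EuclideanSpace ℝ (Fin n))
      (EuclideanSpace ℝ (Fin n))).hasFDerivAt.comp_hasDerivWithinAt t h3
    exact ha.prodMk (hb.const_smul r)
  -- The acceleration picks up `r²`, once from the velocity and once from time; the quadratic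
  -- dependence of the Christoffel term on the velocity matches it.
  have hv : spray g q (coords I q (scaleVec r (β (r * t + c)))) =
      (r • (coords I q (β (r * t + c))).2,
        r • (r • (spray g q (coords I q (β (r * t + c)))).2)) := by
    rw [coords_scaleVec r hq']
    unfold spray
    simp only
    rw [christoffel_smul g q (coords_mem hdom).1, smul_neg, smul_neg, smul_smul]
  rw [hv]
  refine h4.congr_of_eventuallyEq ?_ (coords_scaleVec r hq')
  have : ∀ᶠ s in 𝓝[Icc a' b'] t, β (r * s + c) ∈ coordDomain I q :=
    (hcont t ht) ((isOpen_coordDomain q).mem_nhds hdom)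
  filter_upwards [this] with s hs
  exact coords_scaleVec r hs.1

end Spray

/-! ### Grönwall estimates for autonomous equations -/

section Gronwall

variable {E : Type*} [NormedAddCommGroup E] [NormedSpace ℝ E]

lemma dist_le_exp_of_hasDerivWithinAt_forward {X : E → E} {L : ℝ≥0} {B : Set E}
    (hX : LipschitzOnWith L X B)
    {f f' : ℝ → E} {a b : ℝ} (hf : ∀ t ∈ Icc a b, HasDerivWithinAt f (X (f t)) (Icc a b) t)
    (hf' : ∀ t ∈ Icc a b, HasDerivWithinAt f' (X (f' t)) (Icc a b) t)
    (hB : ∀ t ∈ Icc a b, f t ∈ B) (hB' : ∀ t ∈ Icc a b, f' t ∈ B) {t : ℝ} (ht : t ∈ Icc a b) :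
    dist (f t) (f' t) ≤ dist (f a) (f' a) * Real.exp (L * (t - a)) := by
  have key : ∀ {h : ℝ → E}, (∀ t ∈ Icc a b, HasDerivWithinAt h (X (h t)) (Icc a b) t) →
      ∀ t ∈ Ico a b, HasDerivWithinAt h (X (h t)) (Ici t) t := fun hh t ht =>
    (hh t (Ico_subset_Icc_self ht)).mono_of_mem_nhdsWithin (Icc_mem_nhdsGE_of_mem ht)
  exact dist_le_of_trajectories_ODE_of_mem (v := fun _ => X) (s := fun _ => B) (fun _ _ => hX)
    (fun t ht => (hf t ht).continuousWithinAt) (key hf)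
    (fun t ht => hB t (Ico_subset_Icc_self ht))
    (fun t ht => (hf' t ht).continuousWithinAt) (key hf')
    (fun t ht => hB' t (Ico_subset_Icc_self ht)) le_rfl t ht

lemma hasDerivWithinAt_comp_neg {f : ℝ → E} {a b t : ℝ} {v : E}
    (hf : HasDerivWithinAt f v (Icc a b) (-t)) :
    HasDerivWithinAt (fun t => f (-t)) (-v) (Icc (-b) (-a)) t := by
  have h2 : HasDerivWithinAt (fun t : ℝ => -t) (-1) (Icc (-b) (-a)) t :=
    (hasDerivAt_neg t).hasDerivWithinAt
  have := hf.scomp t h2 (t' := Icc a b) fun x hx => ⟨by linarith [hx.2], by linarith [hx.1]⟩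
  simpa [Function.comp_def] using this

/-- Solutions of an autonomous Lipschitz differential equation depend on their value at any time in
a Lipschitz way. -/
lemma dist_le_exp_of_hasDerivWithinAt {X : E → E} {L : ℝ≥0} {B : Set E}
    (hX : LipschitzOnWith L X B)
    {f f' : ℝ → E} {a b : ℝ} (hf : ∀ t ∈ Icc a b, HasDerivWithinAt f (X (f t)) (Icc a b) t)
    (hf' : ∀ t ∈ Icc a b, HasDerivWithinAt f' (X (f' t)) (Icc a b) t)
    (hB : ∀ t ∈ Icc a b, f t ∈ B) (hB' : ∀ t ∈ Icc a b, f' t ∈ B) {s t : ℝ} (hs : s ∈ Icc a b)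
    (ht : t ∈ Icc a b) :
    dist (f t) (f' t) ≤ dist (f s) (f' s) * Real.exp (L * |t - s|) := by
  rcases le_total s t with hst | hst
  · have hsub : Icc s b ⊆ Icc a b := Icc_subset_Icc_left hs.1
    rw [abs_of_nonneg (sub_nonneg.2 hst)]
    exact dist_le_exp_of_hasDerivWithinAt_forward hX (a := s) (b := b)
      (fun x hx => (hf x (hsub hx)).mono hsub) (fun x hx => (hf' x (hsub hx)).mono hsub)
      (fun x hx => hB x (hsub hx)) (fun x hx => hB' x (hsub hx)) ⟨hst, ht.2⟩
  · have hsub : Icc a s ⊆ Icc a b := Icc_subset_Icc_right hs.2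
    have hneg : ∀ {x}, x ∈ Icc (-s) (-a) → -x ∈ Icc a s := fun hx =>
      ⟨by linarith [hx.2], by linarith [hx.1]⟩
    -- Backward times: reversed solutions solve the equation of the opposite field, which has the
    -- same Lipschitz constant.
    have hX' : LipschitzOnWith L (fun x => -X x) B := by
      intro x hx y hy
      simpa using hX hx hy
    have := dist_le_exp_of_hasDerivWithinAt_forward hX' (a := -s) (b := -a) (t := -t)
      (f := fun t => f (-t)) (f' := fun t => f' (-t))
      (fun x hx => hasDerivWithinAt_comp_neg ((hf _ (hsub (hneg hx))).mono hsub))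
      (fun x hx => hasDerivWithinAt_comp_neg ((hf' _ (hsub (hneg hx))).mono hsub))
      (fun x hx => hB _ (hsub (hneg hx))) (fun x hx => hB' _ (hsub (hneg hx)))
      ⟨by linarith, by linarith [ht.1]⟩
    rw [abs_of_nonpos (sub_nonpos.2 hst)]
    simpa [sub_eq_add_neg, add_comm] using this

end Gronwall

/-! ### Flow boxes and Lipschitz dependence of geodesics -/

section FlowBox

variable {n : ℕ} {H : Type*} [TopologicalSpace H]
  {I : ModelWithCorners ℝ (EuclideanSpace ℝ (Fin n)) H}
  {N : Type*} [TopologicalSpace N] [ChartedSpace H N] [IsManifold I ∞ N]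

/-- A curve in the tangent bundle which, in the chart, moves with bounded speed as long as it is in
a ball cannot leave this ball quickly. -/
lemma mem_coordDomain_of_short_forward [T2Space N] {q : N}
    {c₀ : EuclideanSpace ℝ (Fin n) × EuclideanSpace ℝ (Fin n)} {R K : ℝ} (hK : 0 ≤ K)
    (hR : Metric.closedBall c₀ R ⊆ coordTarget I q ×ˢ univ)
    {β : ℝ → TangentBundle I N} {a b : ℝ} (hc : ContinuousOn β (Icc a b))
    {D : ℝ → EuclideanSpace ℝ (Fin n) × EuclideanSpace ℝ (Fin n)}
    (hD : ∀ t ∈ Icc a b, β t ∈ coordDomain I q →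
      HasDerivWithinAt (fun s => coords I q (β s)) (D t) (Icc a b) t)
    (hDK : ∀ t ∈ Icc a b, β t ∈ coordDomain I q → coords I q (β t) ∈ Metric.closedBall c₀ R →
      ‖D t‖ ≤ K)
    (ha : β a ∈ coordDomain I q) (had : dist (coords I q (β a)) c₀ < R / 2)
    (hlen : K * (b - a) < R / 2) {t : ℝ} (ht : t ∈ Icc a b) :
    β t ∈ coordDomain I q ∧ dist (coords I q (β t)) (coords I q (β a)) ≤ K * (t - a) := by
  set S : Set ℝ := {t | β t ∈ coordDomain I q ∧
    dist (coords I q (β t)) (coords I q (β a)) ≤ K * (t - a)} with hS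
  have hin : ∀ t ∈ Icc a b, t ∈ S → dist (coords I q (β t)) c₀ < R := by
    intro t ht hts
    have h1 : K * (t - a) ≤ K * (b - a) := by gcongr; exact ht.2
    have := dist_triangle (coords I q (β t)) (coords I q (β a)) c₀
    linarith [hts.2]
  -- The positions belonging to the ball form a compact set, closed since `N` is Hausdorff, inside
  -- the chart domain. Hence a limit of good times cannot leave the domain, and the set of good
  -- times is closed.
  set Kx : Set N := (fun a => (extChartAt I q).symm a.1) '' Metric.closedBall c₀ R with hKx
  have hKxc : IsClosed Kx := by
    refine IsCompact.isClosed ((isCompact_closedBall c₀ R).image_of_continuousOn ?_)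
    refine (continuousOn_extChartAt_symm q).comp continuousOn_fst fun a ha => ?_
    exact interior_subset (hR ha).1
  have hKxs : ∀ x ∈ Kx, x ∈ baseDomain I q := by
    rintro x ⟨a, ha, rfl⟩
    exact extChartAt_symm_mem_baseDomain (hR ha).1
  have hmemK : ∀ t ∈ Icc a b, t ∈ S → (β t).proj ∈ Kx := by
    intro t ht hts
    refine ⟨coords I q (β t), (Metric.mem_closedBall.2 (hin t ht hts).le), ?_⟩
    exact (extChartAt I q).left_inv (by rw [extChartAt_source]; exact hts.1.1)
  have hclosed : IsClosed (S ∩ Icc a b) := by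
    set C : Set ℝ := Icc a b ∩ β ⁻¹' {p | p.proj ∈ Kx} with hC
    have hCc : IsClosed C := hc.preimage_isClosed_of_isClosed isClosed_Icc
      (hKxc.preimage (FiberBundle.continuous_proj _ _))
    have hcc : ContinuousOn (fun t => coords I q (β t)) C :=
      (continuousOn_coords q).comp (hc.mono inter_subset_left) fun t ht => hKxs _ ht.2
    have : S ∩ Icc a b =
        {t ∈ C | dist (coords I q (β t)) (coords I q (β a)) ≤ K * (t - a)} := by
      ext t
      constructor
      · rintro ⟨h1, h2⟩
        exact ⟨⟨h2, hmemK t h2 h1⟩, h1.2⟩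
      · rintro ⟨⟨h1, h2⟩, h3⟩
        exact ⟨⟨hKxs _ h2, h3⟩, h1⟩
    rw [this]
    exact hCc.isClosed_le (continuous_dist.comp_continuousOn (hcc.prodMk continuousOn_const)) (by fun_prop)
  -- Continuous induction: the set of good times is closed, contains `a`, and can always be extended
  -- a little to the right, by the mean value inequality.
  refine (hclosed.Icc_subset_of_forall_mem_nhdsWithin ⟨ha, by simp⟩ ?_) ht
  rintro x ⟨hxS, hx⟩
  have hx' : x ∈ Icc a b := Ico_subset_Icc_self hx
  have hcont : ContinuousWithinAt (fun t => coords I q (β t)) (Icc a b) x :=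
    (hD x hx' hxS.1).continuousWithinAt
  have hev : ∀ᶠ t in 𝓝[Icc a b] x, β t ∈ coordDomain I q ∧ dist (coords I q (β t)) c₀ < R :=
    Filter.Eventually.and ((hc x hx') ((isOpen_coordDomain q).mem_nhds hxS.1))
      (hcont (Metric.isOpen_ball.mem_nhds (Metric.mem_ball.2 (hin x hx' hxS))))
  obtain ⟨δ, hδ, hev⟩ := Metric.mem_nhdsWithin_iff.1 hev
  have hmem : Ioo x (min b (x + δ)) ∈ 𝓝[>] x :=
    Ioo_mem_nhdsGT (lt_min hx.2 (by linarith))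
  filter_upwards [hmem] with t ht
  have htb : t < b := ht.2.trans_le (min_le_left _ _)
  have htδ : t < x + δ := ht.2.trans_le (min_le_right _ _)
  have hsub : Icc x t ⊆ Icc a b := Icc_subset_Icc hx.1 htb.le
  have hball : ∀ τ ∈ Icc x t, β τ ∈ coordDomain I q ∧ dist (coords I q (β τ)) c₀ < R := by
    intro τ hτ
    refine hev ⟨?_, hsub hτ⟩
    rw [Metric.mem_ball, Real.dist_eq, abs_of_nonneg (by linarith [hτ.1])]
    linarith [hτ.2]
  have hmv := (convex_Icc x t).norm_image_sub_le_of_norm_hasDerivWithin_le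
    (f := fun s => coords I q (β s)) (f' := D) (C := K)
    (fun τ hτ => (hD τ (hsub hτ) (hball τ hτ).1).mono hsub)
    (fun τ hτ => hDK τ (hsub hτ) (hball τ hτ).1 (Metric.mem_closedBall.2 (hball τ hτ).2.le))
    (left_mem_Icc.2 ht.1.le) (right_mem_Icc.2 ht.1.le)
  rw [← dist_eq_norm, Real.norm_of_nonneg (by linarith [ht.1])] at hmv
  refine ⟨(hball t (right_mem_Icc.2 ht.1.le)).1, ?_⟩
  have := dist_triangle (coords I q (β t)) (coords I q (β x)) (coords I q (β a))
  have h2 := hxS.2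
  calc _ ≤ _ := this
    _ ≤ K * (t - x) + K * (x - a) := add_le_add hmv h2
    _ = K * (t - a) := by ring

variable (g : Metric I N)

/-- A ball in the chart centred at `q` on which the geodesic vector field is Lipschitz and
bounded. -/
structure IsFlowBox (q : N) (c₀ : EuclideanSpace ℝ (Fin n) × EuclideanSpace ℝ (Fin n))
    (R : ℝ) (L : ℝ≥0) (K : ℝ) : Prop where
  pos : 0 < R
  bound_pos : 0 < K
  subset : Metric.closedBall c₀ R ⊆ coordTarget I q ×ˢ univ
  lipschitz : LipschitzOnWith L (spray g q) (Metric.closedBall c₀ R)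
  bound : ∀ a ∈ Metric.closedBall c₀ R, ‖spray g q a‖ ≤ K

/-- A `C¹` field is Lipschitz near `c₀`, which bounds it by `‖X c₀‖ + L R` on the ball. The extra
`1` makes the bound positive, so that one can divide by it. -/
lemma exists_isFlowBox {q : N} {c₀ : EuclideanSpace ℝ (Fin n) × EuclideanSpace ℝ (Fin n)}
    (hc : c₀.1 ∈ coordTarget I q) : ∃ R L K, IsFlowBox g q c₀ R L K := by
  have hn : (coordTarget I q ×ˢ univ) ∈ 𝓝 c₀ :=
    (isOpen_coordTarget_prod q).mem_nhds ⟨hc, mem_univ _⟩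
  have hX := (contDiffOn_spray g q).contDiffAt hn
  obtain ⟨L, t, ht, hL⟩ := hX.exists_lipschitzOnWith
  obtain ⟨R, hR, hRs⟩ := Metric.nhds_basis_closedBall.mem_iff.1 (inter_mem hn ht)
  refine ⟨R, L, ‖spray g q c₀‖ + L * R + 1, hR, by positivity, fun a ha => (hRs ha).1,
    hL.mono fun a ha => (hRs ha).2, fun a ha => ?_⟩
  have h1 := hL.dist_le_mul a (hRs ha).2 c₀ (hRs (Metric.mem_closedBall_self hR.le)).2
  have h2 : (L : ℝ) * dist a c₀ ≤ L * R := by gcongr; exact ha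
  have h3 := norm_le_norm_add_norm_sub' (spray g q a) (spray g q c₀)
  rw [dist_eq_norm] at h1
  linarith

variable {g} {q : N} {c₀ : EuclideanSpace ℝ (Fin n) × EuclideanSpace ℝ (Fin n)}
    {R K : ℝ} {L : ℝ≥0}

/-- Backward times are reduced to `mem_coordDomain_of_short_forward` by reversing the curve, which
keeps the bound on the speed. -/
lemma IsFlowBox.mem_of_short [T2Space N] (hB : IsFlowBox g q c₀ R L K)
    {β : ℝ → TangentBundle I N} {a b s t : ℝ} (hβ : IsGeodesicLift g β a b)
    (hs : s ∈ Icc a b) (hsq : β s ∈ coordDomain I q) (hsd : dist (coords I q (β s)) c₀ < R / 2)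
    (ht : t ∈ Icc a b) (hst : K * |t - s| < R / 2) :
    β t ∈ coordDomain I q ∧ dist (coords I q (β t)) (coords I q (β s)) ≤ K * |t - s| := by
  rcases le_total s t with hle | hle
  · have hsub : Icc s t ⊆ Icc a b := Icc_subset_Icc hs.1 ht.2
    rw [abs_of_nonneg (sub_nonneg.2 hle)] at hst ⊢
    exact mem_coordDomain_of_short_forward hB.bound_pos.le hB.subset (hβ.continuousOn.mono hsub)
      (D := fun t => spray g q (coords I q (β t)))
      (fun τ hτ h => (hβ.hasDerivWithinAt q (hsub hτ) h.1).mono hsub)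
      (fun τ _ _ h => hB.bound _ h) hsq hsd hst (right_mem_Icc.2 hle)
  · have hsub : Icc t s ⊆ Icc a b := Icc_subset_Icc ht.1 hs.2
    have hneg : ∀ {x}, x ∈ Icc (-s) (-t) → -x ∈ Icc t s := fun hx =>
      ⟨by linarith [hx.2], by linarith [hx.1]⟩
    rw [abs_of_nonpos (sub_nonpos.2 hle)] at hst ⊢
    have := mem_coordDomain_of_short_forward hB.bound_pos.le hB.subset (a := -s) (b := -t)
      (β := fun t => β (-t))
      ((hβ.continuousOn.mono hsub).comp (by fun_prop) fun x hx => hneg hx)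
      (D := fun t => -spray g q (coords I q (β (-t))))
      (fun τ hτ h => hasDerivWithinAt_comp_neg (f := fun t => coords I q (β t))
        ((hβ.hasDerivWithinAt q (hsub (hneg hτ)) h.1).mono hsub))
      (fun τ _ _ h => by rw [norm_neg]; exact hB.bound _ h) (by simpa using hsq)
      (by simpa using hsd) (by linarith) (right_mem_Icc.2 (by linarith))
    simp only [neg_neg] at this
    rwa [neg_sub, show s - t = -t - -s by ring]

lemma IsFlowBox.mem_closedBall [T2Space N] (hB : IsFlowBox g q c₀ R L K)
    {β : ℝ → TangentBundle I N} {a b s t : ℝ} (hβ : IsGeodesicLift g β a b)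
    (hs : s ∈ Icc a b) (hsq : β s ∈ coordDomain I q) (hsd : dist (coords I q (β s)) c₀ < R / 2)
    (ht : t ∈ Icc a b) (hst : K * |t - s| < R / 2) :
    β t ∈ coordDomain I q ∧ coords I q (β t) ∈ Metric.closedBall c₀ R := by
  obtain ⟨h1, h2⟩ := hB.mem_of_short hβ hs hsq hsd ht hst
  refine ⟨h1, Metric.mem_closedBall.2 ?_⟩
  have := dist_triangle (coords I q (β t)) (coords I q (β s)) c₀
  linarith

lemma IsFlowBox.dist_le [T2Space N] (hB : IsFlowBox g q c₀ R L K)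
    {β β' : ℝ → TangentBundle I N} {s t : ℝ}
    (hβ : IsGeodesicLift g β (min s t) (max s t)) (hβ' : IsGeodesicLift g β' (min s t) (max s t))
    (hsq : β s ∈ coordDomain I q) (hsd : dist (coords I q (β s)) c₀ < R / 2)
    (hsq' : β' s ∈ coordDomain I q) (hsd' : dist (coords I q (β' s)) c₀ < R / 2)
    (hst : K * |t - s| < R / 2) :
    dist (coords I q (β t)) (coords I q (β' t)) ≤
      dist (coords I q (β s)) (coords I q (β' s)) * Real.exp (L * |t - s|) := by
  have hs : s ∈ Icc (min s t) (max s t) := ⟨min_le_left _ _, le_max_left _ _⟩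
  have ht : t ∈ Icc (min s t) (max s t) := ⟨min_le_right _ _, le_max_right _ _⟩
  have habs : ∀ τ ∈ Icc (min s t) (max s t), K * |τ - s| < R / 2 := by
    intro τ hτ
    refine lt_of_le_of_lt ?_ hst
    have := hB.bound_pos
    gcongr 1
    exact abs_sub_left_of_mem_uIcc hτ
  have h1 := fun τ hτ => hB.mem_closedBall hβ hs hsq hsd hτ (habs τ hτ)
  have h2 := fun τ hτ => hB.mem_closedBall hβ' hs hsq' hsd' hτ (habs τ hτ)
  exact dist_le_exp_of_hasDerivWithinAt hB.lipschitz
    (fun τ hτ => hβ.hasDerivWithinAt q hτ (h1 τ hτ).1.1)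
    (fun τ hτ => hβ'.hasDerivWithinAt q hτ (h2 τ hτ).1.1)
    (fun τ hτ => (h1 τ hτ).2) (fun τ hτ => (h2 τ hτ).2) hs ht

/-- The geodesics which at time `s` are close to `P` are at time `t` close to `Q`, and depend there
on their values at time `s` in a Lipschitz way. -/
def IsFlowLipschitz (g : Metric I N) (P Q : TangentBundle I N) (s t : ℝ) : Prop :=
  ∀ q q', P ∈ coordDomain I q → Q ∈ coordDomain I q' → ∀ W ∈ 𝓝 Q, ∃ K : ℝ≥0, ∃ V ∈ 𝓝 P,
    ∀ β β', IsGeodesicLift g β (min s t) (max s t) → IsGeodesicLift g β' (min s t) (max s t) →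
      β s ∈ V → β' s ∈ V → β t ∈ W ∧
        dist (coords I q' (β t)) (coords I q' (β' t)) ≤
          K * dist (coords I q (β s)) (coords I q (β' s))

/-- The neighbourhoods are chosen backwards from `W`, and the constants multiply. The estimate for
the first leg is used twice, with the curves exchanged, because it only locates the end of the first
curve. -/
lemma IsFlowLipschitz.trans {P Q S : TangentBundle I N} {s t u : ℝ}
    (hQ : Q.proj ∈ I.interior N)
    (ht : t ∈ Icc (min s u) (max s u)) (h₁ : IsFlowLipschitz g P Q s t)
    (h₂ : IsFlowLipschitz g Q S t u) : IsFlowLipschitz g P S s u := by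
  intro q q' hP hS W hW
  obtain ⟨K₂, V₂, hV₂, h₂⟩ := h₂ Q.proj q' (mem_baseDomain_self hQ) hS W hW
  obtain ⟨K₁, V₁, hV₁, h₁⟩ := h₁ q Q.proj hP (mem_baseDomain_self hQ) V₂ hV₂
  refine ⟨K₂ * K₁, V₁, hV₁, fun β β' hβ hβ' hs hs' => ?_⟩
  have e1 : min s u ≤ min s t := le_min (min_le_left _ _) ht.1
  have e2 : max s t ≤ max s u := max_le (le_max_left _ _) ht.2
  have e3 : min s u ≤ min t u := le_min ht.1 (min_le_right _ _)
  have e4 : max t u ≤ max s u := max_le ht.2 (le_max_right _ _)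
  obtain ⟨a1, a2⟩ := h₁ β β' (hβ.mono e1 e2) (hβ'.mono e1 e2) hs hs'
  obtain ⟨b1, b2⟩ := h₁ β' β (hβ'.mono e1 e2) (hβ.mono e1 e2) hs' hs
  obtain ⟨c1, c2⟩ := h₂ β β' (hβ.mono e3 e4) (hβ'.mono e3 e4) a1 b1
  refine ⟨c1, c2.trans ?_⟩
  calc (K₂ : ℝ) * _ ≤ K₂ * (K₁ * dist (coords I q (β s)) (coords I q (β' s))) := by gcongr
    _ = _ := by push_cast; ring

/-- Inside one flow box Grönwall's inequality gives the factor `exp (L |t - s|)`. Changes of charts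
are locally Lipschitz, so the estimate passes to any charts at the two ends. -/
lemma IsGeodesicLift.isFlowLipschitz_local [T2Space N] {β₀ : ℝ → TangentBundle I N} {a b t₀ : ℝ}
    (hβ₀ : IsGeodesicLift g β₀ a b) (ht₀ : t₀ ∈ Icc a b) :
    ∃ ε > 0, ∀ s ∈ Icc a b, ∀ t ∈ Icc a b, |s - t₀| < ε → |t - t₀| < ε →
      IsFlowLipschitz g (β₀ s) (β₀ t) s t := by
  set q₁ := (β₀ t₀).proj
  have hq₁ : β₀ t₀ ∈ coordDomain I q₁ := mem_baseDomain_self (hβ₀.mem_interior t₀ ht₀)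
  obtain ⟨R, L, K, hB⟩ := exists_isFlowBox g (coords_mem hq₁).1
  have hcont : ContinuousWithinAt (fun t => coords I q₁ (β₀ t)) (Icc a b) t₀ :=
    (hβ₀.hasDerivWithinAt q₁ ht₀ hq₁.1).continuousWithinAt
  have hev : ∀ᶠ t in 𝓝[Icc a b] t₀, β₀ t ∈ coordDomain I q₁ ∧
      dist (coords I q₁ (β₀ t)) (coords I q₁ (β₀ t₀)) < R / 2 :=
    Filter.Eventually.and ((hβ₀.continuousOn t₀ ht₀) ((isOpen_coordDomain q₁).mem_nhds hq₁))
      (hcont (Metric.ball_mem_nhds _ (half_pos hB.pos)))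
  obtain ⟨δ, hδ, hev⟩ := Metric.mem_nhdsWithin_iff.1 hev
  have hRK : 0 < R / (8 * K) := div_pos hB.pos (mul_pos (by norm_num) hB.bound_pos)
  -- Two times within `R / (8 K)` of `t₀` differ by less than `R / (4 K)`, too little for a curve of
  -- speed at most `K` starting in the half ball to leave the box.
  refine ⟨min δ (R / (8 * K)), lt_min hδ hRK, fun s hs t ht hsε htε => ?_⟩
  intro q q' hP hQ W hW
  have hs1 := hev ⟨by simpa [Real.dist_eq] using hsε.trans_le (min_le_left _ _), hs⟩
  have ht1 := hev ⟨by simpa [Real.dist_eq] using htε.trans_le (min_le_left _ _), ht⟩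
  have hst : K * |t - s| < R / 2 := by
    have h1 : |t - s| ≤ |t - t₀| + |s - t₀| := by
      rw [abs_sub_comm s t₀]; exact abs_sub_le t t₀ s
    have h2 : |t - s| < 2 * (R / (8 * K)) := by
      linarith [hsε.trans_le (min_le_right _ _), htε.trans_le (min_le_right _ _)]
    calc K * |t - s| < K * (2 * (R / (8 * K))) := by gcongr; exact hB.bound_pos
      _ = R / 4 := by have := hB.bound_pos.ne'; field_simp; ring
      _ < R / 2 := by linarith [hB.pos]
  obtain ⟨K₁, V₁, hV₁, hV₁s, hK₁⟩ := exists_coords_lipschitz hP hs1.1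
  obtain ⟨K₂, V₂, hV₂, hV₂s, hK₂⟩ := exists_coords_lipschitz ht1.1 hQ
  obtain ⟨r, hr, hW'⟩ := exists_ball_of_mem_nhds ht1.1 (inter_mem hW hV₂)
  set C : ℝ := Real.exp (L * |t - s|)
  have hCpos : 0 < C := Real.exp_pos _
  -- The radius `r / C` anticipates the Grönwall factor `C`, so that the end points stay within `r`
  -- of `β₀ t`.
  have hVs : V₁ ∩ {p ∈ coordDomain I q₁ | dist (coords I q₁ p) (coords I q₁ (β₀ t₀)) < R / 2 ∧
      dist (coords I q₁ p) (coords I q₁ (β₀ s)) < r / C} ∈ 𝓝 (β₀ s) := by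
    have hc := continuousAt_coords hs1.1
    refine inter_mem hV₁ (inter_mem ((isOpen_coordDomain q₁).mem_nhds hs1.1) (inter_mem ?_ ?_))
    · exact hc (Metric.isOpen_ball.mem_nhds (Metric.mem_ball.2 hs1.2))
    · exact hc (Metric.ball_mem_nhds _ (div_pos hr hCpos))
  refine ⟨K₂ * C.toNNReal * K₁, _, hVs, fun β β' hβ hβ' h h' => ?_⟩
  have hmin : a ≤ min s t := le_min hs.1 ht.1
  have hmax : max s t ≤ b := max_le hs.2 ht.2
  have hmem : ∀ {β}, IsGeodesicLift g β (min s t) (max s t) →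
      β s ∈ V₁ ∩ {p ∈ coordDomain I q₁ | dist (coords I q₁ p) (coords I q₁ (β₀ t₀)) < R / 2 ∧
      dist (coords I q₁ p) (coords I q₁ (β₀ s)) < r / C} → β t ∈ W ∩ V₂ := by
    intro β hβ h
    have hd := hB.dist_le hβ (hβ₀.mono hmin hmax) h.2.1 h.2.2.1 hs1.1 hs1.2 hst
    refine hW' _ (hB.mem_closedBall hβ ⟨min_le_left _ _, le_max_left _ _⟩ h.2.1 h.2.2.1
      ⟨min_le_right _ _, le_max_right _ _⟩ hst).1 (hd.trans_lt ?_)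
    have := h.2.2.2
    calc _ < r / C * C := by gcongr
      _ = r := by field_simp
  refine ⟨(hmem hβ h).1, ?_⟩
  have hd := hB.dist_le hβ hβ' h.2.1 h.2.2.1 h'.2.1 h'.2.2.1 hst
  have h2 := hK₂ _ (hmem hβ h).2 _ (hmem hβ' h').2
  have h1 := hK₁ _ h.1 _ h'.1
  calc _ ≤ _ := h2
    _ ≤ K₂ * ((K₁ * dist (coords I q (β s)) (coords I q (β' s))) * C) := by
        gcongr
        exact hd.trans (by gcongr)
    _ = _ := by push_cast; rw [Real.coe_toNNReal C hCpos.le]; ring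

/-- The geodesic flow is locally Lipschitz, in both time directions. -/
lemma IsGeodesicLift.isFlowLipschitz [T2Space N] {β₀ : ℝ → TangentBundle I N} {a b : ℝ}
    (hβ₀ : IsGeodesicLift g β₀ a b) (hab : a ≤ b) :
    IsFlowLipschitz g (β₀ a) (β₀ b) a b ∧ IsFlowLipschitz g (β₀ b) (β₀ a) b a := by
  choose! ε hε hloc using fun t₀ (ht₀ : t₀ ∈ Icc a b) => hβ₀.isFlowLipschitz_local ht₀
  -- Compactness of `[a, b]` gives a finite subdivision each of whose steps lies in one of the local
  -- intervals; the sequence of times equals `b` from the index `m` on.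
  obtain ⟨t, ht0, htm, ⟨m, hm⟩, htc⟩ := exists_monotone_Icc_subset_open_cover_Icc hab
    (c := fun i : Icc a b => {x : Icc a b | |(x : ℝ) - i| < ε i})
    (fun i => isOpen_lt (by fun_prop) continuous_const)
    (fun x _ => mem_iUnion.2 ⟨x, by simpa using hε x x.2⟩)
  have hstep : ∀ k, IsFlowLipschitz g (β₀ (t k)) (β₀ (t (k + 1))) (t k) (t (k + 1)) ∧
      IsFlowLipschitz g (β₀ (t (k + 1))) (β₀ (t k)) (t (k + 1)) (t k) := by
    intro k
    obtain ⟨i, hi⟩ := htc k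
    have hk : t k ≤ t (k + 1) := htm (Nat.le_succ k)
    exact ⟨hloc i i.2 _ (t k).2 _ (t (k + 1)).2 (hi (left_mem_Icc.2 hk)) (hi (right_mem_Icc.2 hk)),
      hloc i i.2 _ (t (k + 1)).2 _ (t k).2 (hi (right_mem_Icc.2 hk)) (hi (left_mem_Icc.2 hk))⟩
  have hall : ∀ k, IsFlowLipschitz g (β₀ (t 0)) (β₀ (t k)) (t 0) (t k) ∧
      IsFlowLipschitz g (β₀ (t k)) (β₀ (t 0)) (t k) (t 0) := by
    intro k
    induction k with
    | zero =>
      have h0 : |(t 0 : ℝ) - (t 0 : ℝ)| < ε (t 0) := by simpa using hε _ (t 0).2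
      exact ⟨hloc _ (t 0).2 _ (t 0).2 _ (t 0).2 h0 h0, hloc _ (t 0).2 _ (t 0).2 _ (t 0).2 h0 h0⟩
    | succ k ih =>
      have h0k : (t 0 : ℝ) ≤ t k := htm (Nat.zero_le k)
      have hk : (t k : ℝ) ≤ t (k + 1) := htm (Nat.le_succ k)
      have hi := hβ₀.mem_interior _ (t k).2
      exact ⟨ih.1.trans hi ⟨(min_le_left _ _).trans h0k, hk.trans (le_max_right _ _)⟩ (hstep k).1,
        (hstep k).2.trans hi ⟨(min_le_right _ _).trans h0k, hk.trans (le_max_left _ _)⟩ ih.2⟩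
  have := hall m
  rwa [ht0, hm m le_rfl] at this

end FlowBox

/-! ### Recovering initial data and time from the end of a transversal geodesic -/

section Transversality

variable {n : ℕ} {H : Type*} [TopologicalSpace H]
  {I : ModelWithCorners ℝ (EuclideanSpace ℝ (Fin n)) H}
  {N : Type*} [TopologicalSpace N] [ChartedSpace H N] [IsManifold I ∞ N]
  {g : Metric I N} {q : N} {c₀ : EuclideanSpace ℝ (Fin n) × EuclideanSpace ℝ (Fin n)}
  {R K : ℝ} {L : ℝ≥0} {d : ℕ}

lemma IsGeodesicLift.shift {β : ℝ → TangentBundle I N} {a b a' b' c : ℝ}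
    (h : IsGeodesicLift g β a b) (ha : a ≤ a' + c) (hb : b' + c ≤ b) :
    IsGeodesicLift g (fun t => β (t + c)) a' b' := by
  have := h.scale (a' := a') (b' := b') (r := 1) (c := c)
    fun t ht => ⟨by linarith [ht.1], by linarith [ht.2]⟩
  simpa only [one_mul, scaleVec_one] using this

/-- First order expansion of a geodesic in a flow box. -/
lemma IsFlowBox.norm_sub_le [T2Space N] (hB : IsFlowBox g q c₀ R L K)
    {β : ℝ → TangentBundle I N} {b : ℝ} (hβ : IsGeodesicLift g β 0 b) (hb : 0 ≤ b)
    (h0 : β 0 ∈ coordDomain I q) (hd : dist (coords I q (β 0)) c₀ < R / 2) (hst : K * b < R / 2) :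
    ‖coords I q (β b) - coords I q (β 0) - b • spray g q (coords I q (β 0))‖ ≤ L * K * b * b := by
  have hmem : ∀ t ∈ Icc 0 b, K * |t - 0| < R / 2 := by
    intro t ht
    rw [sub_zero, abs_of_nonneg ht.1]
    refine lt_of_le_of_lt ?_ hst
    have := hB.bound_pos
    gcongr
    exact ht.2
  have h0b : (0 : ℝ) ∈ Icc 0 b := ⟨le_rfl, hb⟩
  have h1 := fun t ht => hB.mem_closedBall hβ h0b h0 hd ht (hmem t ht)
  have h2 := fun t ht => hB.mem_of_short hβ h0b h0 hd ht (hmem t ht)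
  have hc0 : coords I q (β 0) ∈ Metric.closedBall c₀ R := (h1 0 h0b).2
  have := (convex_Icc 0 b).norm_image_sub_le_of_norm_hasDerivWithin_le
    (f := fun t => coords I q (β t) - t • spray g q (coords I q (β 0)))
    (f' := fun t => spray g q (coords I q (β t)) - spray g q (coords I q (β 0)))
    (C := L * K * b) (x := 0) (y := b)
    (fun t ht => by
      have e1 := hβ.hasDerivWithinAt q ht (h1 t ht).1.1
      have e2 : HasDerivWithinAt (fun t : ℝ => t • spray g q (coords I q (β 0)))
          (spray g q (coords I q (β 0))) (Icc 0 b) t := by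
        simpa using ((hasDerivAt_id t).smul_const (spray g q (coords I q (β 0)))).hasDerivWithinAt
      exact e1.sub e2)
    (fun t ht => by
      have e1 := hB.lipschitz.dist_le_mul _ (h1 t ht).2 _ hc0
      rw [dist_eq_norm] at e1
      refine e1.trans ?_
      have e2 := (h2 t ht).2
      rw [sub_zero, abs_of_nonneg ht.1] at e2
      have e3 : K * t ≤ K * b := by have := hB.bound_pos; gcongr; exact ht.2
      calc (L : ℝ) * _ ≤ L * (K * b) := by gcongr; exact e2.trans e3
        _ = _ := by ring)
    h0b ⟨hb, le_rfl⟩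
  rw [sub_zero, Real.norm_of_nonneg hb] at this
  refine le_of_eq_of_le (congrArg norm ?_) this
  rw [zero_smul, sub_zero]
  abel

/-- Short geodesics issued transversally from a hypersurface `{ψ u}` determine their initial
data in a Lipschitz way (one of the two orderings of the times). -/
lemma IsFlowBox.dist_initial_le_aux [T2Space N] (hB : IsFlowBox g q c₀ R L K)
    {ψ : EuclideanSpace ℝ (Fin d) → EuclideanSpace ℝ (Fin n)}
    {D : EuclideanSpace ℝ (Fin d) →L[ℝ] EuclideanSpace ℝ (Fin n)}
    {u₀ : EuclideanSpace ℝ (Fin d)} (hψ : HasStrictFDerivAt ψ D u₀) (hψ₀ : ψ u₀ = c₀.1)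
    (hT : ∀ a : EuclideanSpace ℝ (Fin d), ∀ δ : ℝ, D a = δ • c₀.2 → a = 0 ∧ δ = 0) :
    ∃ η > 0, K * η < R / 4 ∧ ∃ r > 0, ∃ C : ℝ≥0, ∀ u u' v v', dist u u₀ < r → dist u' u₀ < r →
      dist v c₀.2 < r → dist v' c₀.2 < r → ∀ h h', 0 ≤ h → h ≤ h' → h' ≤ η → ∀ β β',
      IsGeodesicLift g β 0 h → IsGeodesicLift g β' 0 h' → β 0 ∈ coordDomain I q →
      β' 0 ∈ coordDomain I q → coords I q (β 0) = (ψ u, v) → coords I q (β' 0) = (ψ u', v') →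
      dist (u, v, h) (u', v', h') ≤ C * dist (coords I q (β h)) (coords I q (β' h')) := by
  -- Linearisation of the difference between a point of the hypersurface and a point reached after
  -- time `δ` with velocity near `c₀.2`. Its injectivity is transversality, and in finite dimension
  -- gives a lower bound with constant `k`.
  set T : EuclideanSpace ℝ (Fin d) × ℝ →L[ℝ] EuclideanSpace ℝ (Fin n) :=
    D.comp (ContinuousLinearMap.fst ℝ _ _) -
      (ContinuousLinearMap.snd ℝ (EuclideanSpace ℝ (Fin d)) ℝ).smulRight c₀.2 with hTdef
  have hTapp : ∀ a δ, T (a, δ) = D a - δ • c₀.2 := fun a δ => rfl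
  have hTinj : Function.Injective T := by
    refine (injective_iff_map_eq_zero T).2 ?_
    rintro ⟨a, δ⟩ h
    rw [hTapp, sub_eq_zero] at h
    obtain ⟨rfl, rfl⟩ := hT a δ h
    rfl
  obtain ⟨k, hk, hTanti⟩ := T.toLinearMap.exists_antilipschitzWith
    (LinearMap.ker_eq_bot.2 hTinj)
  have hTlow : ∀ a δ, ‖(a, δ)‖ ≤ k * ‖T (a, δ)‖ := fun a δ => by
    have := hTanti.le_mul_dist (a, δ) 0
    simpa using this
  have hkpos : (0 : ℝ) < k := hk
  -- Chosen so that, after multiplication by `k`, the nonlinearity of `ψ` costs a quarter of the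
  -- norm to be estimated.
  set κ : ℝ≥0 := (4 * k)⁻¹ with hκ
  have hκpos : 0 < κ := by positivity
  obtain ⟨s, hs, hψs⟩ := hψ.approximates_deriv_on_nhds (c := κ) (Or.inr hκpos)
  obtain ⟨r₁, hr₁, hψs'⟩ := Metric.mem_nhds_iff.1 hs
  obtain ⟨r₂, hr₂, hψc⟩ := Metric.continuousAt_iff.1 hψ.continuousAt (R / 4)
    (by linarith [hB.pos])
  have hKpos := hB.bound_pos
  have hRpos := hB.pos
  -- The first bound keeps the curves inside the flow box; the second makes the Taylor remainder `L
  -- K δ²` at most `δ / (8 k)`.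
  set η : ℝ := min (R / (8 * K)) (1 / (8 * k * (L * K + 1))) with hη
  have hηpos : 0 < η := by positivity
  have hηR : K * η < R / 4 := by
    calc K * η ≤ K * (R / (8 * K)) := by gcongr; exact min_le_left _ _
      _ = R / 8 := by field_simp
      _ < R / 4 := by linarith
  have hηk : L * K * η ≤ 1 / (8 * k) := by
    have h1 : η * (L * K + 1) ≤ 1 / (8 * k * (L * K + 1)) * (L * K + 1) := by
      gcongr; exact min_le_right _ _
    have h2 : 1 / (8 * k * (L * K + 1)) * (L * K + 1) = 1 / (8 * (k : ℝ)) := by field_simp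
    nlinarith
  -- The bound `1 / (8 k)` makes the replacement of `v'` by `c₀.2` cost at most `δ / (8 k)`; with
  -- the Taylor remainder this amounts to `δ / (4 k)`.
  set r : ℝ := min (min r₁ r₂) (min (R / 4) (1 / (8 * k))) with hr
  have hrpos : 0 < r := by positivity
  set C : ℝ := (1 + 2 * k + 2 * k * K) * Real.exp (L * η) with hC
  have hCpos : 0 < C := by positivity
  refine ⟨η, hηpos, hηR, r, hrpos, C.toNNReal, ?_⟩
  intro u u' v v' hu hu' hv hv' h h' hh0 hhh hh' β β' hβ hβ' h0 h0' hc hc'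
  have hrr₁ : r ≤ r₁ := (min_le_left _ _).trans (min_le_left _ _)
  have hrr₂ : r ≤ r₂ := (min_le_left _ _).trans (min_le_right _ _)
  have hrR : r ≤ R / 4 := (min_le_right _ _).trans (min_le_left _ _)
  have hrk : r ≤ 1 / (8 * k) := (min_le_right _ _).trans (min_le_right _ _)
  have hdc : ∀ {u v}, dist u u₀ < r → dist v c₀.2 < r → dist (ψ u, v) c₀ < R / 4 := by
    intro u v hu hv
    rw [Prod.dist_eq]
    refine max_lt ?_ (hv.trans_le hrR)
    rw [← hψ₀]
    exact hψc (hu.trans_le hrr₂)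
  have hd : dist (coords I q (β 0)) c₀ < R / 4 := by rw [hc]; exact hdc hu hv
  have hd' : dist (coords I q (β' 0)) c₀ < R / 4 := by rw [hc']; exact hdc hu' hv'
  set δ := h' - h with hδ
  have hδ0 : 0 ≤ δ := sub_nonneg.2 hhh
  have hδη : δ ≤ η := by linarith
  have hKle : ∀ {x}, x ≤ η → K * x < R / 4 := fun hx =>
    lt_of_le_of_lt (by gcongr) hηR
  -- compare the two curves at the initial time of the first one
  have hβ'' : IsGeodesicLift g (fun t => β' (t + δ)) 0 h :=
    hβ'.shift (by linarith) (by linarith)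
  have hmh := hB.mem_of_short hβ ⟨le_rfl, hh0⟩ h0 (by linarith) (t := h) ⟨hh0, le_rfl⟩
    (by rw [sub_zero, abs_of_nonneg hh0]; linarith [hKle (x := h) (by linarith)])
  have hmh' := hB.mem_of_short hβ' ⟨le_rfl, hh0.trans hhh⟩ h0' (by linarith) (t := h')
    ⟨hh0.trans hhh, le_rfl⟩
    (by rw [sub_zero, abs_of_nonneg (hh0.trans hhh)]; linarith [hKle (x := h') (by linarith)])
  have hmδ := hB.mem_of_short hβ' ⟨le_rfl, hh0.trans hhh⟩ h0' (by linarith) (t := δ)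
    ⟨hδ0, by linarith⟩
    (by rw [sub_zero, abs_of_nonneg hδ0]; linarith [hKle hδη])
  rw [sub_zero, abs_of_nonneg hh0] at hmh
  rw [sub_zero, abs_of_nonneg (hh0.trans hhh)] at hmh'
  rw [sub_zero, abs_of_nonneg hδ0] at hmδ
  -- After the shift by `δ` both curves end at time `h`. Grönwall's inequality, run backwards from
  -- there, compares `β 0` with `β' δ`.
  have hcomp := hB.dist_le (β := β) (β' := fun t => β' (t + δ)) (s := h) (t := 0)
    (by rwa [min_eq_right hh0, max_eq_left hh0]) (by rwa [min_eq_right hh0, max_eq_left hh0])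
    hmh.1 (by
      have := dist_triangle (coords I q (β h)) (coords I q (β 0)) c₀
      linarith [hmh.2, hKle (x := h) (by linarith)])
    (by rw [show h + δ = h' by ring]; exact hmh'.1) (by
      rw [show h + δ = h' by ring]
      have := dist_triangle (coords I q (β' h')) (coords I q (β' 0)) c₀
      linarith [hmh'.2, hKle (x := h') (by linarith)])
    (by rw [zero_sub, abs_neg, abs_of_nonneg hh0]; linarith [hKle (x := h) (by linarith)])
  simp only [zero_add, show h + δ = h' by ring, zero_sub, abs_neg, abs_of_nonneg hh0] at hcomp
  set Δ := dist (coords I q (β 0)) (coords I q (β' δ)) with hΔ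
  have hexp : Δ ≤ dist (coords I q (β h)) (coords I q (β' h')) * Real.exp (L * η) := by
    refine hcomp.trans ?_
    gcongr
    linarith
  have hexpand := hB.norm_sub_le (hβ'.mono le_rfl (show δ ≤ h' by linarith)) hδ0 h0' (by linarith)
    (by linarith [hKle hδη])
  have hδδ : L * K * δ * δ ≤ 1 / (8 * k) * δ := by
    gcongr
    exact (by gcongr : L * K * δ ≤ L * K * η).trans hηk
  -- position components
  have hpos1 : ‖(coords I q (β' δ)).1 - ψ u' - δ • v'‖ ≤ 1 / (8 * k) * δ := by
    refine le_trans ?_ (hexpand.trans hδδ)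
    have := norm_fst_le (coords I q (β' δ) - coords I q (β' 0) -
      δ • spray g q (coords I q (β' 0)))
    rw [hc'] at this ⊢
    exact this
  have hpos2 : ‖ψ u - (coords I q (β' δ)).1‖ ≤ Δ := by
    rw [hΔ, hc, dist_eq_norm]
    exact norm_fst_le ((ψ u, v) - coords I q (β' δ))
  have happrox : ‖ψ u - ψ u' - D (u - u')‖ ≤ κ * ‖u - u'‖ :=
    hψs _ (hψs' (Metric.mem_ball.2 (hu.trans_le hrr₁))) _
      (hψs' (Metric.mem_ball.2 (hu'.trans_le hrr₁)))
  have hv'' : ‖δ • (v' - c₀.2)‖ ≤ 1 / (8 * k) * δ := by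
    rw [norm_smul, Real.norm_of_nonneg hδ0, mul_comm, ← dist_eq_norm]
    gcongr
    exact hv'.le.trans hrk
  have hTn : ‖T (u - u', δ)‖ ≤ Δ + κ * ‖u - u'‖ + 1 / (4 * k) * δ := by
    have e : T (u - u', δ) = (ψ u - (coords I q (β' δ)).1) +
        ((coords I q (β' δ)).1 - ψ u' - δ • v') + δ • (v' - c₀.2) -
        (ψ u - ψ u' - D (u - u')) := by
      rw [hTapp, smul_sub]; abel
    rw [e]
    have e1 := _root_.norm_sub_le ((ψ u - (coords I q (β' δ)).1) +
        ((coords I q (β' δ)).1 - ψ u' - δ • v') + δ • (v' - c₀.2)) (ψ u - ψ u' - D (u - u'))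
    have e2 := norm_add₃_le (a := ψ u - (coords I q (β' δ)).1)
        (b := (coords I q (β' δ)).1 - ψ u' - δ • v') (c := δ • (v' - c₀.2))
    have e3 : 1 / (4 * k) * δ = 1 / (8 * k) * δ + 1 / (8 * k) * δ := by field_simp; ring
    linarith
  have hm := hTlow (u - u') δ
  have hn1 : ‖u - u'‖ ≤ ‖(u - u', δ)‖ := norm_fst_le (u - u', δ)
  have hn2 : δ ≤ ‖(u - u', δ)‖ := by
    have := norm_snd_le (u - u', δ)
    rwa [Real.norm_of_nonneg hδ0] at this
  -- The two error terms contribute `k κ = 1/4` and `k / (4 k) = 1/4`, so half of the norm is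
  -- absorbed on the left.
  have hm2 : ‖(u - u', δ)‖ ≤ 2 * k * Δ := by
    have e1 : (k : ℝ) * ‖T (u - u', δ)‖ ≤
        k * (Δ + κ * ‖(u - u', δ)‖ + 1 / (4 * k) * ‖(u - u', δ)‖) := by
      gcongr
      refine hTn.trans ?_
      gcongr
    have e2 : (k : ℝ) * (Δ + κ * ‖(u - u', δ)‖ + 1 / (4 * k) * ‖(u - u', δ)‖) =
        k * Δ + ‖(u - u', δ)‖ / 2 := by
      rw [hκ]; push_cast; field_simp; ring
    linarith
  have hvv : ‖v - v'‖ ≤ Δ + K * δ := by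
    have e1 : ‖v - (coords I q (β' δ)).2‖ ≤ Δ := by
      rw [hΔ, hc, dist_eq_norm]
      exact norm_snd_le ((ψ u, v) - coords I q (β' δ))
    have e2 : ‖(coords I q (β' δ)).2 - v'‖ ≤ K * δ := by
      refine le_trans ?_ hmδ.2
      rw [hc', dist_eq_norm]
      exact norm_snd_le (coords I q (β' δ) - (ψ u', v'))
    have := norm_sub_le_norm_sub_add_norm_sub v (coords I q (β' δ)).2 v'
    linarith
  have hΔ0 : 0 ≤ Δ := dist_nonneg
  have hKδ : K * δ ≤ K * (2 * k * Δ) := by gcongr; exact hn2.trans hm2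
  have hfin : dist (u, v, h) (u', v', h') ≤ (1 + 2 * k + 2 * k * K) * Δ := by
    have p1 : 0 ≤ 2 * k * Δ := by positivity
    have p2 : 0 ≤ 2 * k * K * Δ := by positivity
    rw [Prod.dist_eq, Prod.dist_eq]
    refine max_le ?_ (max_le ?_ ?_)
    · rw [dist_eq_norm]; linarith
    · rw [dist_eq_norm]; linarith
    · rw [Real.dist_eq, abs_sub_comm, abs_of_nonneg hδ0]; linarith
  rw [Real.coe_toNNReal _ hCpos.le]
  calc _ ≤ _ := hfin
    _ ≤ (1 + 2 * k + 2 * k * K) *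
        (dist (coords I q (β h)) (coords I q (β' h')) * Real.exp (L * η)) := by gcongr
    _ = _ := by rw [hC]; ring

lemma IsFlowBox.dist_initial_le [T2Space N] (hB : IsFlowBox g q c₀ R L K)
    {ψ : EuclideanSpace ℝ (Fin d) → EuclideanSpace ℝ (Fin n)}
    {D : EuclideanSpace ℝ (Fin d) →L[ℝ] EuclideanSpace ℝ (Fin n)}
    {u₀ : EuclideanSpace ℝ (Fin d)} (hψ : HasStrictFDerivAt ψ D u₀) (hψ₀ : ψ u₀ = c₀.1)
    (hT : ∀ a : EuclideanSpace ℝ (Fin d), ∀ δ : ℝ, D a = δ • c₀.2 → a = 0 ∧ δ = 0) :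
    ∃ η > 0, K * η < R / 4 ∧ ∃ r > 0, ∃ C : ℝ≥0, ∀ u u' v v', dist u u₀ < r → dist u' u₀ < r →
      dist v c₀.2 < r → dist v' c₀.2 < r → ∀ h h', 0 ≤ h → 0 ≤ h' → h ≤ η → h' ≤ η → ∀ β β',
      IsGeodesicLift g β 0 h → IsGeodesicLift g β' 0 h' → β 0 ∈ coordDomain I q →
      β' 0 ∈ coordDomain I q → coords I q (β 0) = (ψ u, v) → coords I q (β' 0) = (ψ u', v') →
      dist (u, v, h) (u', v', h') ≤ C * dist (coords I q (β h)) (coords I q (β' h')) := by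
  obtain ⟨η, hη, hKη, r, hr, C, hC⟩ := hB.dist_initial_le_aux hψ hψ₀ hT
  refine ⟨η, hη, hKη, r, hr, C, ?_⟩
  intro u u' v v' hu hu' hv hv' h h' hh0 hh0' hhη hhη' β β' hβ hβ' h0 h0' hc hc'
  rcases le_total h h' with hle | hle
  · exact hC u u' v v' hu hu' hv hv' h h' hh0 hle hhη' β β' hβ hβ' h0 h0' hc hc'
  · have := hC u' u v' v hu' hu hv' hv h' h hh0' hle hhη β' β hβ' hβ h0' h0 hc' hc
    rwa [dist_comm, dist_comm (coords I q (β' h'))] at this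

/-- Geodesics issued transversally from a hypersurface `{ψ u}`: initial position, initial velocity
and time depend in a Lipschitz way on the end position and velocity. -/
theorem exists_dist_initial_le [T2Space N] {β₀ : ℝ → TangentBundle I N} {s₀ : ℝ}
    (hs₀ : 0 ≤ s₀) (hβ₀ : IsGeodesicLift g β₀ 0 s₀) {q₀ q₁ : N}
    (hq₀ : β₀ 0 ∈ coordDomain I q₀) (hq₁ : β₀ s₀ ∈ coordDomain I q₁)
    {ψ : EuclideanSpace ℝ (Fin d) → EuclideanSpace ℝ (Fin n)}
    {D : EuclideanSpace ℝ (Fin d) →L[ℝ] EuclideanSpace ℝ (Fin n)}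
    {u₀ : EuclideanSpace ℝ (Fin d)} (hψ : HasStrictFDerivAt ψ D u₀)
    (hψ₀ : ψ u₀ = (coords I q₀ (β₀ 0)).1)
    (hT : ∀ a : EuclideanSpace ℝ (Fin d), ∀ δ : ℝ, D a = δ • (coords I q₀ (β₀ 0)).2 →
      a = 0 ∧ δ = 0) {W : Set (TangentBundle I N)} (hW : W ∈ 𝓝 (β₀ s₀)) :
    ∃ r > 0, ∃ C : ℝ≥0, ∀ u u' v v' s s', dist u u₀ < r → dist u' u₀ < r →
      dist v (coords I q₀ (β₀ 0)).2 < r → dist v' (coords I q₀ (β₀ 0)).2 < r →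
      0 ≤ s → 0 ≤ s' → dist s s₀ < r → dist s' s₀ < r → ∀ β β',
      IsGeodesicLift g β 0 s → IsGeodesicLift g β' 0 s' → β 0 ∈ coordDomain I q₀ →
      β' 0 ∈ coordDomain I q₀ → coords I q₀ (β 0) = (ψ u, v) → coords I q₀ (β' 0) = (ψ u', v') →
      β s ∈ W ∧
      dist (u, v, s) (u', v', s') ≤ C * dist (coords I q₁ (β s)) (coords I q₁ (β' s')) := by
  obtain ⟨R, L, K, hB⟩ := exists_isFlowBox g (coords_mem hq₀).1
  obtain ⟨η, hη, hKη, r₁, hr₁, C₁, hC₁⟩ := hB.dist_initial_le hψ hψ₀ hT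
  have hKpos := hB.bound_pos
  have hRpos := hB.pos
  -- The geodesic is cut at `τ`. The first piece is short enough for `IsFlowBox.dist_initial_le`,
  -- with room left for the end time `s` to vary; the rest, of fixed duration `s₀ - τ`, is handled
  -- by the Lipschitz flow.
  set τ := min (η / 2) s₀ with hτ
  have hτ0 : 0 ≤ τ := le_min (by positivity) hs₀
  have hτs : τ ≤ s₀ := min_le_right _ _
  have hτη : τ ≤ η / 2 := min_le_left _ _
  -- The cut of a curve with end time `s` is at `τ + s - s₀`, which must not be negative. If `s₀ =
  -- 0`, then `τ = 0` and `0 ≤ s` gives this; otherwise `s` has to be close to `s₀`.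
  obtain ⟨ρ, hρ, hρτ⟩ : ∃ ρ > 0, ∀ s, 0 ≤ s → dist s s₀ < ρ → 0 ≤ τ + s - s₀ := by
    rcases hs₀.eq_or_lt with h | h
    · exact ⟨1, one_pos, fun s hs _ => by linarith⟩
    · refine ⟨τ, lt_min (by positivity) h, fun s _ hs => ?_⟩
      rw [Real.dist_eq, abs_lt] at hs
      linarith [hs.1]
  have hKle : ∀ {x}, x ≤ η → K * x < R / 4 := fun hx => lt_of_le_of_lt (by gcongr) hKη
  have hdc₀ : dist (coords I q₀ (β₀ 0)) (coords I q₀ (β₀ 0)) < R / 2 := by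
    rw [dist_self]; linarith
  have hβ₀τ := hB.mem_of_short hβ₀ ⟨le_rfl, hs₀⟩ hq₀ hdc₀ (t := τ) ⟨hτ0, hτs⟩
    (by rw [sub_zero, abs_of_nonneg hτ0]; linarith [hKle (x := τ) (by linarith)])
  obtain ⟨hfwd, hbwd⟩ := (hβ₀.mono hτ0 le_rfl).isFlowLipschitz hτs
  -- The backward flow provides the estimate that is wanted, but for curves ending in `V₂`. The
  -- forward flow is needed only to place the ends in `W ∩ V₂`.
  obtain ⟨C₂, V₂, hV₂, hC₂⟩ := hbwd q₁ q₀ hq₁ hβ₀τ.1 univ univ_mem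
  obtain ⟨C₃, V₁, hV₁, hC₃⟩ := hfwd q₀ q₁ hβ₀τ.1 hq₁ (W ∩ V₂) (inter_mem hW hV₂)
  obtain ⟨r₂, hr₂, hV₁'⟩ := exists_ball_of_mem_nhds hβ₀τ.1 hV₁
  set B : ℝ := Real.exp (L * η)
  have hBpos : 0 < B := Real.exp_pos _
  obtain ⟨r₃, hr₃, hψc⟩ := Metric.continuousAt_iff.1 hψ.continuousAt
    (min (R / 4) (r₂ / (4 * B))) (by positivity)
  set r : ℝ := min (min r₁ (min (R / 4) (r₂ / (4 * B)))) (min r₃ (min ρ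
    (min (η / 2) (r₂ / (8 * K))))) with hr
  have hrpos : 0 < r := by positivity
  refine ⟨r, hrpos, C₁ * C₂, ?_⟩
  intro u u' v v' s s' hu hu' hv hv' hs hs' hsd hsd' β β' hβ hβ' h0 h0' hc hc'
  have a1 : r ≤ r₁ := (min_le_left _ _).trans (min_le_left _ _)
  have a2 : r ≤ min (R / 4) (r₂ / (4 * B)) := (min_le_left _ _).trans (min_le_right _ _)
  have a3 : r ≤ r₃ := (min_le_right _ _).trans (min_le_left _ _)
  have a4 : r ≤ ρ := (min_le_right _ _).trans ((min_le_right _ _).trans (min_le_left _ _))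
  have a5 : r ≤ η / 2 := (min_le_right _ _).trans
    ((min_le_right _ _).trans ((min_le_right _ _).trans (min_le_left _ _)))
  have a6 : r ≤ r₂ / (8 * K) := (min_le_right _ _).trans
    ((min_le_right _ _).trans ((min_le_right _ _).trans (min_le_right _ _)))
  have key : ∀ {u v s β}, dist u u₀ < r → dist v (coords I q₀ (β₀ 0)).2 < r → 0 ≤ s →
      dist s s₀ < r → IsGeodesicLift g β 0 s → β 0 ∈ coordDomain I q₀ →
      coords I q₀ (β 0) = (ψ u, v) → 0 ≤ τ + s - s₀ ∧ τ + s - s₀ ≤ η ∧ τ + s - s₀ ≤ s ∧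
      β (τ + s - s₀) ∈ V₁ := by
    intro u v s β hu hv hs hsd hβ h0 hc
    have hsabs := hsd
    rw [Real.dist_eq] at hsabs
    have hh0 : 0 ≤ τ + s - s₀ := hρτ s hs (hsd.trans_le a4)
    have hhη : τ + s - s₀ ≤ η := by linarith [(abs_lt.1 (hsabs.trans_le a5)).2]
    have hhs : τ + s - s₀ ≤ s := by linarith
    refine ⟨hh0, hhη, hhs, ?_⟩
    have hdc : dist (coords I q₀ (β 0)) (coords I q₀ (β₀ 0)) < min (R / 4) (r₂ / (4 * B)) := by
      rw [hc, Prod.dist_eq]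
      refine max_lt ?_ (hv.trans_le a2)
      rw [← hψ₀]
      exact hψc (hu.trans_le a3)
    have hdR := hdc.trans_le (min_le_left _ _)
    have hdB := hdc.trans_le (min_le_right _ _)
    set h := τ + s - s₀
    -- Either of `h` and `τ` may be the larger. The curve is compared with `β₀` at the smaller of
    -- the two times; from there to `h`, respectively `τ`, each moves by at most `r₂ / 8`.
    set m := min h τ
    have hm0 : 0 ≤ m := le_min hh0 hτ0
    have hmh : m ≤ h := min_le_left _ _
    have hmτ : m ≤ τ := min_le_right _ _
    have hcm := hB.dist_le (β := β) (β' := β₀) (s := 0) (t := m)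
      (hβ.mono (by rw [min_eq_left hm0]) (by rw [max_eq_right hm0]; linarith))
      (hβ₀.mono (by rw [min_eq_left hm0]) (by rw [max_eq_right hm0]; linarith))
      h0 (by linarith) hq₀ hdc₀
      (by rw [sub_zero, abs_of_nonneg hm0]; linarith [hKle (x := m) (by linarith)])
    have hmem : ∀ x, 0 ≤ x → x ≤ s → x ≤ η → β x ∈ coordDomain I q₀ ∧
        dist (coords I q₀ (β x)) (coords I q₀ (β₀ 0)) < R / 2 := by
      intro x hx hxs hxη
      have := hB.mem_of_short hβ ⟨le_rfl, hs⟩ h0 (by linarith) (t := x) ⟨hx, hxs⟩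
        (by rw [sub_zero, abs_of_nonneg hx]; linarith [hKle hxη])
      rw [sub_zero, abs_of_nonneg hx] at this
      have h2 := dist_triangle (coords I q₀ (β x)) (coords I q₀ (β 0)) (coords I q₀ (β₀ 0))
      exact ⟨this.1, by linarith [this.2, hKle hxη]⟩
    have hhm := hB.mem_of_short hβ (s := m) (t := h) ⟨hm0, by linarith⟩
      (hmem m hm0 (by linarith) (by linarith)).1
      (hmem m hm0 (by linarith) (by linarith)).2 ⟨hh0, hhs⟩
      (by rw [abs_of_nonneg (by linarith)]; linarith [hKle (x := h - m) (by linarith)])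
    have hβ₀m := hB.mem_of_short hβ₀ (s := 0) (t := m) ⟨le_rfl, hs₀⟩ hq₀ hdc₀
      ⟨hm0, by linarith⟩
      (by rw [sub_zero, abs_of_nonneg hm0]; linarith [hKle (x := m) (by linarith)])
    have hτm := hB.mem_of_short hβ₀ (s := m) (t := τ) ⟨hm0, by linarith⟩ hβ₀m.1
      (by
        have := hβ₀m.2
        rw [sub_zero, abs_of_nonneg hm0] at this
        linarith [hKle (x := m) (by linarith)])
      ⟨hτ0, hτs⟩
      (by rw [abs_of_nonneg (by linarith)]; linarith [hKle (x := τ - m) (by linarith)])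
    refine hV₁' _ hhm.1 ?_
    have e1 : |h - m| ≤ r₂ / (8 * K) := by
      rw [abs_of_nonneg (by linarith)]
      rcases le_total h τ with hle | hle
      · rw [show m = h from min_eq_left hle, sub_self]; positivity
      · rw [show m = τ from min_eq_right hle]
        have := (abs_lt.1 (hsabs.trans_le a6)).2
        simp only [h]; linarith
    have e2 : |τ - m| ≤ r₂ / (8 * K) := by
      rw [abs_of_nonneg (by linarith)]
      rcases le_total h τ with hle | hle
      · rw [show m = h from min_eq_left hle]
        have := (abs_lt.1 (hsabs.trans_le a6)).1
        simp only [h]; linarith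
      · rw [show m = τ from min_eq_right hle, sub_self]; positivity
    have e3 : K * (r₂ / (8 * K)) = r₂ / 8 := by field_simp
    have e4 : K * |h - m| ≤ r₂ / 8 := e3 ▸ (by gcongr)
    have e5 : K * |τ - m| ≤ r₂ / 8 := e3 ▸ (by gcongr)
    have e6 : dist (coords I q₀ (β m)) (coords I q₀ (β₀ m)) ≤ r₂ / 4 := by
      refine hcm.trans ?_
      have : Real.exp (L * |m - 0|) ≤ B := by
        rw [sub_zero, abs_of_nonneg hm0]
        exact Real.exp_le_exp.2 (by gcongr; linarith)
      calc _ ≤ r₂ / (4 * B) * B := by gcongr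
        _ = r₂ / 4 := by field_simp
    have e7 := dist_triangle4 (coords I q₀ (β h)) (coords I q₀ (β m)) (coords I q₀ (β₀ m))
      (coords I q₀ (β₀ τ))
    rw [dist_comm (coords I q₀ (β₀ m))] at e7
    linarith [hhm.2, hτm.2]
  obtain ⟨b1, b2, b3, b4⟩ := key hu hv hs hsd hβ h0 hc
  obtain ⟨b1', b2', b3', b4'⟩ := key hu' hv' hs' hsd' hβ' h0' hc'
  have hmin : min τ s₀ = τ := min_eq_left hτs
  have hmax : max τ s₀ = s₀ := max_eq_right hτs
  have hl : IsGeodesicLift g (fun x => β (x + (s - s₀))) τ s₀ :=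
    hβ.shift (by linarith) (by linarith)
  have hl' : IsGeodesicLift g (fun x => β' (x + (s' - s₀))) τ s₀ :=
    hβ'.shift (by linarith) (by linarith)
  have g1 : β (τ + (s - s₀)) ∈ V₁ := by rwa [show τ + (s - s₀) = τ + s - s₀ by ring]
  have g2 : β' (τ + (s' - s₀)) ∈ V₁ := by rwa [show τ + (s' - s₀) = τ + s' - s₀ by ring]
  have f1 := hC₃ (fun x => β (x + (s - s₀))) (fun x => β' (x + (s' - s₀))) (by rwa [hmin, hmax])
    (by rwa [hmin, hmax]) g1 g2
  have f2 := hC₃ (fun x => β' (x + (s' - s₀))) (fun x => β (x + (s - s₀))) (by rwa [hmin, hmax])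
    (by rwa [hmin, hmax]) g2 g1
  have f3 := hC₂ (fun x => β (x + (s - s₀))) (fun x => β' (x + (s' - s₀)))
    (by rwa [min_comm, max_comm, hmin, hmax]) (by rwa [min_comm, max_comm, hmin, hmax])
    f1.1.2 f2.1.2
  have f4 := hC₁ u u' v v' (hu.trans_le a1) (hu'.trans_le a1) (hv.trans_le a1) (hv'.trans_le a1)
    _ _ b1 b1' b2 b2' β β' (hβ.mono le_rfl b3) (hβ'.mono le_rfl b3') h0 h0' hc hc'
  simp only [add_sub_cancel] at f1 f3
  refine ⟨f1.1.1, ?_⟩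
  have f5 : dist (u, v, s) (u', v', s') = dist (u, v, τ + s - s₀) (u', v', τ + s' - s₀) := by
    have e : s - s' = τ + s - s₀ - (τ + s' - s₀) := by ring
    simp only [Prod.dist_eq, Real.dist_eq]
    rw [e]
  rw [f5]
  refine f4.trans ?_
  have f6 := f3.2
  rw [show τ + (s - s₀) = τ + s - s₀ by ring, show τ + (s' - s₀) = τ + s' - s₀ by ring] at f6
  calc (C₁ : ℝ) * _ ≤ C₁ * (C₂ * dist (coords I q₁ (β s)) (coords I q₁ (β' s'))) := by gcongr
    _ = _ := by push_cast; ring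

end Transversality

/-! ### Hypersurfaces in coordinates -/

section LocalParam

variable {n : ℕ} {H : Type*} [TopologicalSpace H]
  {I : ModelWithCorners ℝ (EuclideanSpace ℝ (Fin n)) H}
  {N : Type*} [TopologicalSpace N] [ChartedSpace H N] [IsManifold I ∞ N]
  {d : ℕ} {S : Type*} [TopologicalSpace S] [ChartedSpace (EuclideanSpace ℝ (Fin d)) S]
  [IsManifold (𝓡 d) ∞ S]

variable (I) in
/-- A map `ι : S → N` in the charts centred at `z₀` and `q`. -/
def localParam (ι : S → N) (z₀ : S) (q : N) (u : EuclideanSpace ℝ (Fin d)) :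
    EuclideanSpace ℝ (Fin n) :=
  extChartAt I q (ι ((extChartAt (𝓡 d) z₀).symm u))

variable {ι : S → N}

lemma contMDiffAt_extChartAt_symm_boundaryless {z₀ : S} {u : EuclideanSpace ℝ (Fin d)}
    (hu : u ∈ (extChartAt (𝓡 d) z₀).target) :
    ContMDiffAt 𝓘(ℝ, EuclideanSpace ℝ (Fin d)) (𝓡 d) ∞ (extChartAt (𝓡 d) z₀).symm u :=
  (contMDiffOn_extChartAt_symm z₀).contMDiffAt ((isOpen_extChartAt_target z₀).mem_nhds hu)

lemma contDiffAt_localParam (hι : ContMDiff (𝓡 d) I ∞ ι) {z₀ : S} {q : N}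
    {u : EuclideanSpace ℝ (Fin d)} (hu : u ∈ (extChartAt (𝓡 d) z₀).target)
    (hq : ι ((extChartAt (𝓡 d) z₀).symm u) ∈ (chartAt H q).source) :
    ContDiffAt ℝ ∞ (localParam I ι z₀ q) u := by
  rw [← contMDiffAt_iff_contDiffAt]
  have h1 := contMDiffAt_extChartAt_symm_boundaryless hu
  have h2 : ContMDiffAt 𝓘(ℝ, EuclideanSpace ℝ (Fin d)) I ∞
      (fun u => ι ((extChartAt (𝓡 d) z₀).symm u)) u := hι.contMDiffAt.comp u h1
  exact (contMDiffAt_extChartAt' (n := ∞) hq).comp u h2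

lemma coords_mfderiv (hι : ContMDiff (𝓡 d) I ∞ ι) {z₀ : S} {q : N}
    {u : EuclideanSpace ℝ (Fin d)} (hu : u ∈ (extChartAt (𝓡 d) z₀).target)
    (hq : ι ((extChartAt (𝓡 d) z₀).symm u) ∈ (chartAt H q).source)
    (a : EuclideanSpace ℝ (Fin d)) :
    (coords I q ⟨ι ((extChartAt (𝓡 d) z₀).symm u),
      mfderiv (𝓡 d) I ι ((extChartAt (𝓡 d) z₀).symm u)
        (vecAt (𝓡 d) z₀ ((extChartAt (𝓡 d) z₀).symm u) a)⟩).2 =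
      fderiv ℝ (localParam I ι z₀ q) u a := by
  have : IsManifold I 1 N := IsManifold.of_le (n := ∞) (by norm_cast)
  have : IsManifold (𝓡 d) 1 S := IsManifold.of_le (n := ∞) (by norm_cast)
  set z := (extChartAt (𝓡 d) z₀).symm u with hz
  have hzs : z ∈ (chartAt (EuclideanSpace ℝ (Fin d)) z₀).source := by
    rw [← extChartAt_source (𝓡 d)]; exact (extChartAt (𝓡 d) z₀).map_target hu
  have hzu : extChartAt (𝓡 d) z₀ z = u := (extChartAt (𝓡 d) z₀).right_inv hu
  have hb : ι z ∈ (trivializationAt (EuclideanSpace ℝ (Fin n))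
      (TangentSpace I : N → Type _) q).baseSet := by
    rwa [TangentBundle.trivializationAt_baseSet]
  have h1 : ∀ w : TangentSpace I (ι z), (coords I q ⟨ι z, w⟩).2 =
      mfderiv I 𝓘(ℝ, EuclideanSpace ℝ (Fin n)) (extChartAt I q) (ι z) w := by
    intro w
    have e : (trivializationAt (EuclideanSpace ℝ (Fin n))
        (TangentSpace I : N → Type _) q).continuousLinearMapAt ℝ (ι z) w =
        (coords I q ⟨ι z, w⟩).2 := by
      rw [Bundle.Trivialization.continuousLinearMapAt_apply,
        Bundle.Trivialization.coe_linearMapAt_of_mem _ hb]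
      rfl
    exact e.symm.trans (DFunLike.congr_fun
      (TangentBundle.continuousLinearMapAt_trivializationAt hq) w)
  have h2 : ∀ a, vecAt (𝓡 d) z₀ z a =
      mfderiv 𝓘(ℝ, EuclideanSpace ℝ (Fin d)) (𝓡 d) (extChartAt (𝓡 d) z₀).symm u a := by
    intro a
    unfold vecAt
    rw [TangentBundle.symmL_trivializationAt hzs, hzu]
    simp only [modelWithCornersSelf_coe, range_id, mfderivWithin_univ]
    rfl
  rw [h1, h2]
  have m1 : MDifferentiableAt 𝓘(ℝ, EuclideanSpace ℝ (Fin d)) (𝓡 d)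
      (extChartAt (𝓡 d) z₀).symm u :=
    (contMDiffAt_extChartAt_symm_boundaryless hu).mdifferentiableAt (by simp)
  have m2 : MDifferentiableAt (𝓡 d) I ι z := hι.contMDiffAt.mdifferentiableAt (by simp)
  have m3 : MDifferentiableAt I 𝓘(ℝ, EuclideanSpace ℝ (Fin n)) (extChartAt I q) (ι z) :=
    mdifferentiableAt_extChartAt hq
  have e1 := mfderiv_comp (f := (extChartAt (𝓡 d) z₀).symm) (g := ι) u m2 m1
  have e2 := mfderiv_comp (f := ι ∘ (extChartAt (𝓡 d) z₀).symm) (g := extChartAt I q) u m3 (m2.comp u m1)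
  have e3 : fderiv ℝ (localParam I ι z₀ q) u =
      mfderiv 𝓘(ℝ, EuclideanSpace ℝ (Fin d)) 𝓘(ℝ, EuclideanSpace ℝ (Fin n))
        (extChartAt I q ∘ ι ∘ (extChartAt (𝓡 d) z₀).symm) u := mfderiv_eq_fderiv.symm
  rw [e3]
  exact (DFunLike.congr_fun (e2.trans (congrArg _ e1)) a).symm

lemma mfderiv_eq_vecAt (hι : ContMDiff (𝓡 d) I ∞ ι) {z₀ : S} {q : N}
    {u : EuclideanSpace ℝ (Fin d)} (hu : u ∈ (extChartAt (𝓡 d) z₀).target)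
    (hq : ι ((extChartAt (𝓡 d) z₀).symm u) ∈ (chartAt H q).source)
    (a : EuclideanSpace ℝ (Fin d)) :
    mfderiv (𝓡 d) I ι ((extChartAt (𝓡 d) z₀).symm u)
        (vecAt (𝓡 d) z₀ ((extChartAt (𝓡 d) z₀).symm u) a) =
      vecAt I q (ι ((extChartAt (𝓡 d) z₀).symm u)) (fderiv ℝ (localParam I ι z₀ q) u a) := by
  rw [← coords_mfderiv hι hu hq, vecAt_coords hq]

/-- In coordinates: a vector is transversal to the hypersurface iff it is independent of the
derivatives of the parametrisation. -/
lemma fderiv_localParam_eq_smul (hι : IsInteriorEmbedding (d := d) I ι) {z₀ z : S} {q : N}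
    (hz : z ∈ (chartAt (EuclideanSpace ℝ (Fin d)) z₀).source)
    (hq : ι z ∈ (chartAt H q).source) {θ : TangentSpace I (ι z)}
    (hθ : θ ∉ range (mfderiv (𝓡 d) I ι z)) {c : ℝ} (hc : c ≠ 0) (a : EuclideanSpace ℝ (Fin d))
    (δ : ℝ) (h : fderiv ℝ (localParam I ι z₀ q) (extChartAt (𝓡 d) z₀ z) a =
      δ • (c • (coords I q ⟨ι z, θ⟩).2)) : a = 0 ∧ δ = 0 := by
  have hz' : z ∈ (extChartAt (𝓡 d) z₀).source := by rwa [extChartAt_source]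
  have hu := (extChartAt (𝓡 d) z₀).map_source hz'
  have hl := (extChartAt (𝓡 d) z₀).left_inv hz'
  have h1 := mfderiv_eq_vecAt hι.contMDiff (q := q) hu (by rwa [hl]) a
  rw [hl, h, smul_smul, vecAt_smul, vecAt_coords hq] at h1
  have hδ : δ = 0 := by
    by_contra hδ
    have hne : δ * c ≠ 0 := mul_ne_zero hδ hc
    refine hθ ⟨(δ * c)⁻¹ • vecAt (𝓡 d) z₀ z a, ?_⟩
    rw [map_smul, h1, smul_smul, inv_mul_cancel₀ hne, one_smul]
  refine ⟨?_, hδ⟩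
  rw [hδ, zero_mul, zero_smul] at h1
  have h2 : vecAt (𝓡 d) z₀ z a = 0 := hι.injective_mfderiv z (h1.trans (map_zero _).symm)
  have h3 : vecAt (𝓡 d) z₀ z (0 : EuclideanSpace ℝ (Fin d)) = 0 := map_zero _
  exact vecAt_injective hz (h2.trans h3.symm)

end LocalParam

/-! ### Families of geodesics: local injectivity and continuity -/

section Family

variable {n : ℕ} {H : Type*} [TopologicalSpace H]
  {I : ModelWithCorners ℝ (EuclideanSpace ℝ (Fin n)) H}
  {N : Type*} [TopologicalSpace N] [ChartedSpace H N] [IsManifold I ∞ N]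
  {d : ℕ} {S : Type*} [TopologicalSpace S] [ChartedSpace (EuclideanSpace ℝ (Fin d)) S]
  [IsManifold (𝓡 d) ∞ S] {ι : S → N}
  {g : Metric I N} {M : Set N} {ℋ : Set (TangentBundle I N)} {lm lp : TangentBundle I N → ℝ}
  {γ : TangentBundle I N → ℝ → TangentBundle I N}

/-- The curve `t ↦ γ p (r t)`, with velocities multiplied by `r`. -/
def scaledCurve (γ : TangentBundle I N → ℝ → TangentBundle I N) (r : ℝ) (p : TangentBundle I N)
    (t : ℝ) : TangentBundle I N := scaleVec r (γ p (r * t))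

lemma mul_mem_Icc_of_mem {a b r s t : ℝ} (ha : a ≤ 0) (hb : 0 ≤ b) (hs : r * s ∈ Icc a b)
    (ht : t ∈ Icc 0 s) : r * t ∈ Icc a b := by
  rcases le_total 0 r with hr | hr
  · exact ⟨ha.trans (mul_nonneg hr ht.1), (mul_le_mul_of_nonneg_left ht.2 hr).trans hs.2⟩
  · exact ⟨hs.1.trans (mul_le_mul_of_nonpos_left ht.2 hr),
      (mul_nonpos_of_nonpos_of_nonneg hr ht.1).trans hb⟩

lemma IsGeodesicFamily.isGeodesicLift_scaledCurve
    (hF : IsGeodesicFamily (d := d) g M ι ℋ lm lp γ) {p : TangentBundle I N} (hp : p ∈ ℋ)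
    {r s : ℝ} (hs : r * s ∈ Icc (lm p) (lp p)) :
    IsGeodesicLift g (scaledCurve γ r p) 0 s := by
  have := (hF.geodesic p hp).scale (a' := 0) (b' := s) (r := r) (c := 0) fun t ht => by
    rw [add_zero]; exact mul_mem_Icc_of_mem (hF.lm_nonpos p hp) (hF.lp_nonneg p hp) hs ht
  simp only [add_zero] at this
  exact this

lemma IsGeodesicFamily.scaledCurve_zero
    (hF : IsGeodesicFamily (d := d) g M ι ℋ lm lp γ) {p : TangentBundle I N} (hp : p ∈ ℋ)
    (r : ℝ) : scaledCurve γ r p 0 = scaleVec r p := by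
  rw [scaledCurve, mul_zero, hF.initial p hp]

lemma IsGeodesicFamily.exists_transversal
    (hF : IsGeodesicFamily (d := d) g M ι ℋ lm lp γ) {p : TangentBundle I N} (hp : p ∈ ℋ) :
    ∃ (z : S) (θ : TangentSpace I (ι z)), p = ⟨ι z, θ⟩ ∧ g.inner (ι z) θ θ = 1 ∧
      θ ∉ range (mfderiv (𝓡 d) I ι z) := by
  obtain ⟨U, _, hU⟩ := hF.isOpen
  rw [hU] at hp
  exact hp.2

/-- Near a point of a family of geodesics, the initial data and the time depend in a Lipschitz way
on the end point of the geodesic. -/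
theorem IsGeodesicFamily.exists_dist_le [T2Space N]
    (hF : IsGeodesicFamily (d := d) g M ι ℋ lm lp γ) (hι : IsInteriorEmbedding (d := d) I ι)
    {z₀ : S} {p₀ : TangentBundle I N} (hp₀ : p₀ ∈ ℋ) (hz₀ : p₀.proj = ι z₀) {ε t₀ : ℝ}
    (hε : ε ≠ 0)
    (ht₀ : 0 ≤ t₀) (hεt₀ : ε * t₀ ∈ Icc (lm p₀) (lp p₀)) {q₁ : N}
    (hq₁ : scaledCurve γ ε p₀ t₀ ∈ coordDomain I q₁) {W : Set (TangentBundle I N)}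
    (hW : W ∈ 𝓝 (scaledCurve γ ε p₀ t₀)) :
    ∃ r > 0, ∃ C : ℝ≥0, ∀ p ∈ ℋ, ∀ p' ∈ ℋ, ∀ z z', p.proj = ι z → p'.proj = ι z' →
      z ∈ (chartAt (EuclideanSpace ℝ (Fin d)) z₀).source →
      z' ∈ (chartAt (EuclideanSpace ℝ (Fin d)) z₀).source →
      ι z ∈ (chartAt H (ι z₀)).source → ι z' ∈ (chartAt H (ι z₀)).source → ∀ ρ ρ' s s' : ℝ,
      dist (extChartAt (𝓡 d) z₀ z) (extChartAt (𝓡 d) z₀ z₀) < r →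
      dist (extChartAt (𝓡 d) z₀ z') (extChartAt (𝓡 d) z₀ z₀) < r →
      dist (ρ • (coords I (ι z₀) p).2) (coords I (ι z₀) p₀).2 < r →
      dist (ρ' • (coords I (ι z₀) p').2) (coords I (ι z₀) p₀).2 < r →
      0 ≤ s → 0 ≤ s' → dist s t₀ < r → dist s' t₀ < r →
      ε * ρ * s ∈ Icc (lm p) (lp p) → ε * ρ' * s' ∈ Icc (lm p') (lp p') →
      scaledCurve γ (ε * ρ) p s ∈ W ∧
      dist (extChartAt (𝓡 d) z₀ z, ρ • (coords I (ι z₀) p).2, s)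
        (extChartAt (𝓡 d) z₀ z', ρ' • (coords I (ι z₀) p').2, s') ≤
      C * dist (coords I q₁ (scaledCurve γ (ε * ρ) p s))
        (coords I q₁ (scaledCurve γ (ε * ρ') p' s')) := by
  obtain ⟨z₁, θ, rfl, hunit, hθ⟩ := hF.exists_transversal hp₀
  have hzz : z₁ = z₀ := hι.isEmbedding.injective hz₀
  subst hzz
  have hz₁s : z₁ ∈ (chartAt (EuclideanSpace ℝ (Fin d)) z₁).source := mem_chart_source _ _
  have hqs : ι z₁ ∈ (chartAt H (ι z₁)).source := mem_chart_source _ _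
  have hu₁ := mem_extChartAt_target (I := 𝓡 d) z₁
  have hl : (extChartAt (𝓡 d) z₁).symm (extChartAt (𝓡 d) z₁ z₁) = z₁ := by simp
  have hψ := (contDiffAt_localParam (q := ι z₁) hι.contMDiff hu₁
    (by rwa [hl])).hasStrictFDerivAt (by simp)
  have hβ₀ := hF.isGeodesicLift_scaledCurve hp₀ hεt₀
  have h0 := hF.scaledCurve_zero hp₀ ε
  have hqi : ι z₁ ∈ I.interior N := hι.mem_interior z₁
  have hd0 : scaledCurve γ ε ⟨ι z₁, θ⟩ 0 ∈ coordDomain I (ι z₁) := by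
    rw [h0]; exact mem_baseDomain_self hqi
  have hc0 := coords_scaleVec ε (p := (⟨ι z₁, θ⟩ : TangentBundle I N)) hqs
  rw [← h0] at hc0
  have hψv : ∀ z ∈ (chartAt (EuclideanSpace ℝ (Fin d)) z₁).source,
      localParam I ι z₁ (ι z₁) (extChartAt (𝓡 d) z₁ z) = extChartAt I (ι z₁) (ι z) := by
    intro z hz
    unfold localParam
    rw [(extChartAt (𝓡 d) z₁).left_inv (by rwa [extChartAt_source])]
  obtain ⟨r, hr, C, hC⟩ := exists_dist_initial_le ht₀ hβ₀ hd0 hq₁ hψ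
    (by rw [hc0]; exact hψv z₁ hz₁s)
    (by
      rw [hc0]
      exact fun a δ h => fderiv_localParam_eq_smul hι hz₁s hqs hθ hε a δ h) hW
  have hεpos : 0 < |ε| := abs_pos.2 hε
  -- The initial velocity of the scaled curve is `ε • ρ • v`: closeness of `ρ • v` is multiplied by
  -- `|ε|`, and an estimate for it is recovered with `|ε|⁻¹`.
  refine ⟨min r (r / |ε|), by positivity, (max 1 |ε|⁻¹).toNNReal * C, ?_⟩
  intro p hp p' hp' z z' hz hz' hzs hzs' hιz hιz' ρ ρ' s s' hu hu' hv hv' hs hs' hst hst' hI hI'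
  have hcs : ∀ {p : TangentBundle I N} {z : S} {ρ : ℝ}, p ∈ ℋ → p.proj = ι z →
      ι z ∈ (chartAt H (ι z₁)).source →
      z ∈ (chartAt (EuclideanSpace ℝ (Fin d)) z₁).source →
      scaledCurve γ (ε * ρ) p 0 ∈ coordDomain I (ι z₁) ∧
      coords I (ι z₁) (scaledCurve γ (ε * ρ) p 0) =
        (localParam I ι z₁ (ι z₁) (extChartAt (𝓡 d) z₁ z), ε • ρ • (coords I (ι z₁) p).2) := by
    intro p z ρ hp hz hιz hzs
    rw [hF.scaledCurve_zero hp]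
    have hps : p.proj ∈ (chartAt H (ι z₁)).source := by rwa [hz]
    refine ⟨⟨hps, by change p.proj ∈ _; rw [hz]; exact hι.mem_interior z⟩, ?_⟩
    rw [coords_scaleVec _ hps, hψv z hzs, smul_smul, ← hz]
    rfl
  have hvd : ∀ {v : EuclideanSpace ℝ (Fin n)}, dist v (coords I (ι z₁) ⟨ι z₁, θ⟩).2 <
      min r (r / |ε|) → dist (ε • v) (coords I (ι z₁) (scaledCurve γ ε ⟨ι z₁, θ⟩ 0)).2 < r := by
    intro v hv
    rw [hc0, dist_smul₀, Real.norm_eq_abs]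
    have := hv.trans_le (min_le_right _ _)
    rwa [lt_div_iff₀ hεpos, mul_comm] at this
  obtain ⟨hd, hc⟩ := hcs (ρ := ρ) hp hz hιz hzs
  obtain ⟨hd', hc'⟩ := hcs (ρ := ρ') hp' hz' hιz' hzs'
  obtain ⟨hmem, hdist⟩ := hC _ _ _ _ s s' (hu.trans_le (min_le_left _ _))
    (hu'.trans_le (min_le_left _ _)) (hvd hv) (hvd hv') hs hs' (hst.trans_le (min_le_left _ _))
    (hst'.trans_le (min_le_left _ _)) _ _ (hF.isGeodesicLift_scaledCurve hp hI)
    (hF.isGeodesicLift_scaledCurve hp' hI') hd hd' hc hc'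
  refine ⟨hmem, ?_⟩
  set X := dist (coords I q₁ (scaledCurve γ (ε * ρ) p s))
        (coords I q₁ (scaledCurve γ (ε * ρ') p' s')) with hX
  simp only [Prod.dist_eq, dist_smul₀, Real.norm_eq_abs] at hdist
  have e1 := (le_max_left _ _).trans hdist
  have e2 := ((le_max_left _ _).trans (le_max_right _ _)).trans hdist
  have e3 := ((le_max_right _ _).trans (le_max_right _ _)).trans hdist
  have hX0 : 0 ≤ C * X := by positivity
  have hone : C * X ≤ max 1 |ε|⁻¹ * (C * X) := le_mul_of_one_le_left hX0 (le_max_left _ _)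
  push_cast
  rw [Real.coe_toNNReal _ (by positivity), mul_assoc]
  simp only [Prod.dist_eq]
  refine max_le (e1.trans hone) (max_le ?_ (e3.trans hone))
  have : dist (ρ • (coords I (ι z₁) p).2) (ρ' • (coords I (ι z₁) p').2) ≤ |ε|⁻¹ * (C * X) := by
    rw [inv_mul_eq_div, le_div_iff₀ hεpos, mul_comm]; exact e2
  exact this.trans (by gcongr; exact le_max_right _ _)

/-- Since `ι` is a topological embedding, closeness of base points in `N` forces closeness of
parameters in `S`. -/
lemma eventually_of_mem_nhds (hι : IsInteriorEmbedding (d := d) I ι) {z₀ : S}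
    {p₀ : TangentBundle I N} (hz₀ : p₀.proj = ι z₀) {A : Set S} (hA : A ∈ 𝓝 z₀) :
    ∀ᶠ p in 𝓝 p₀, ∀ z, p.proj = ι z → z ∈ A := by
  rw [hι.isEmbedding.nhds_eq_comap, mem_comap] at hA
  obtain ⟨B, hB, hBA⟩ := hA
  have hc : ContinuousAt (fun p : TangentBundle I N => p.proj) p₀ :=
    (FiberBundle.continuous_proj _ _).continuousAt
  rw [← hz₀] at hB
  filter_upwards [hc hB] with p hp z hz
  exact hBA (by rw [mem_preimage, ← hz]; exact hp)

/-- The half-trajectories `{(p, t) : 0 ≤ t, l⁻(p) ≤ ε t ≤ l⁺(p)}` of a family of geodesics. -/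
def halfDomain (ℋ : Set (TangentBundle I N)) (lm lp : TangentBundle I N → ℝ) (ε : ℝ) :
    Set (TangentBundle I N × ℝ) :=
  {x | x.1 ∈ ℋ ∧ 0 ≤ x.2 ∧ ε * x.2 ∈ Icc (lm x.1) (lp x.1)}

/-- The family comes with no regularity in the initial data. Continuity is extracted from
`IsGeodesicFamily.exists_dist_le` with `ρ = 1` and with `p` compared to itself: only the membership
of the end point in `W` is used. -/
theorem IsGeodesicFamily.continuousOn_scaledCurve [T2Space N]
    (hF : IsGeodesicFamily (d := d) g M ι ℋ lm lp γ) (hι : IsInteriorEmbedding (d := d) I ι)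
    {ε : ℝ} (hε : ε ≠ 0) :
    ContinuousOn (fun x : TangentBundle I N × ℝ => scaledCurve γ ε x.1 x.2)
      (halfDomain ℋ lm lp ε) := by
  rintro ⟨p₀, t₀⟩ ⟨hp₀, ht₀, hεt₀⟩ W hW
  simp only at hp₀ ht₀ hεt₀ hW
  obtain ⟨z₀, θ, hpz, -, -⟩ := hF.exists_transversal hp₀
  have hz₀ : p₀.proj = ι z₀ := by rw [hpz]
  have hi := (hF.geodesic p₀ hp₀).mem_interior _ hεt₀
  obtain ⟨r, hr, C, h⟩ := hF.exists_dist_le hι hp₀ hz₀ hε ht₀ hεt₀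
    (q₁ := (scaledCurve γ ε p₀ t₀).proj) (mem_baseDomain_self hi) hW
  have hA : {z ∈ (chartAt (EuclideanSpace ℝ (Fin d)) z₀).source |
      ι z ∈ (chartAt H (ι z₀)).source ∧
      dist (extChartAt (𝓡 d) z₀ z) (extChartAt (𝓡 d) z₀ z₀) < r} ∈ 𝓝 z₀ := by
    refine inter_mem (chart_source_mem_nhds _ _) (inter_mem ?_ ?_)
    · exact hι.isEmbedding.continuous.continuousAt (chart_source_mem_nhds _ _)
    · exact (continuousAt_extChartAt z₀) (Metric.ball_mem_nhds _ hr)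
  have hd : p₀ ∈ coordDomain I (ι z₀) := by
    show p₀.proj ∈ baseDomain I (ι z₀)
    rw [hz₀]; exact mem_baseDomain_self (hι.mem_interior z₀)
  have hv : ∀ᶠ p in 𝓝 p₀, dist (coords I (ι z₀) p).2 (coords I (ι z₀) p₀).2 < r :=
    (continuousAt_coords hd).snd (Metric.ball_mem_nhds _ hr)
  have hev : ∀ᶠ x in 𝓝[halfDomain ℋ lm lp ε] (p₀, t₀), x ∈ halfDomain ℋ lm lp ε ∧
      (∀ z, x.1.proj = ι z → z ∈ {z ∈ (chartAt (EuclideanSpace ℝ (Fin d)) z₀).source |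
      ι z ∈ (chartAt H (ι z₀)).source ∧
      dist (extChartAt (𝓡 d) z₀ z) (extChartAt (𝓡 d) z₀ z₀) < r}) ∧
      dist (coords I (ι z₀) x.1).2 (coords I (ι z₀) p₀).2 < r ∧ dist x.2 t₀ < r := by
    refine eventually_mem_nhdsWithin.and (Filter.Eventually.filter_mono nhdsWithin_le_nhds ?_)
    rw [nhds_prod_eq]
    have ht : ∀ᶠ t in 𝓝 t₀, dist t t₀ < r := Metric.ball_mem_nhds t₀ hr
    exact (((eventually_of_mem_nhds hι hz₀ hA).prod_inl _).and ((hv.prod_inl _).and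
      (ht.prod_inr _)))
  rw [mem_map]
  filter_upwards [hev] with x hx
  obtain ⟨⟨h1, h2, h3⟩, h4, h5, h6⟩ := hx
  obtain ⟨z, θ', hpz', -, -⟩ := hF.exists_transversal h1
  have hz : x.1.proj = ι z := by rw [hpz']
  obtain ⟨a1, a2, a3⟩ := h4 z hz
  have := (h x.1 h1 x.1 h1 z z hz hz a1 a1 a2 a2 1 1 x.2 x.2 a3 a3 (by rwa [one_smul])
    (by rwa [one_smul]) h2 h2 h6 h6 (by rwa [mul_one]) (by rwa [mul_one])).1
  rwa [mul_one] at this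

theorem IsGeodesicFamily.continuousOn_halfDomain [T2Space N]
    (hF : IsGeodesicFamily (d := d) g M ι ℋ lm lp γ) (hι : IsInteriorEmbedding (d := d) I ι)
    {ε : ℝ} (hε : ε ≠ 0) :
    ContinuousOn (fun x : TangentBundle I N × ℝ => γ x.1 (ε * x.2)) (halfDomain ℋ lm lp ε) := by
  have h := (continuous_scaleVec (I := I) (N := N) ε⁻¹).comp (hF.continuousOn_scaledCurve hι hε)
    fun x hx => (hF.geodesic x.1 hx.1).mem_interior _ hx.2.2
  refine h.congr fun x _ => ?_
  simp only [Function.comp_apply, scaledCurve, scaleVec_scaleVec]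
  rw [inv_mul_cancel₀ hε, scaleVec_one]

end Family

/-! ### Distance-expanding maps do not concentrate measure -/

section Antilipschitz

variable {E F : Type*} [NormedAddCommGroup E] [NormedSpace ℝ E] [FiniteDimensional ℝ E]
  [MeasurableSpace E] [BorelSpace E] [NormedAddCommGroup F] [NormedSpace ℝ F]
  [FiniteDimensional ℝ F] [MeasurableSpace F] [BorelSpace F]

/-- Maps between spaces of the same dimension which do not decrease distances too much do not
increase densities too much. -/
theorem exists_measure_inter_preimage_le (μ : Measure E) [μ.IsAddHaarMeasure] (ν : Measure F)
    [ν.IsAddHaarMeasure] (h : Module.finrank ℝ E = Module.finrank ℝ F) (K : ℝ≥0) :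
    ∃ C : ENNReal, C ≠ ⊤ ∧ ∀ (s : Set E) (f : E → F),
      (∀ x ∈ s, ∀ y ∈ s, dist x y ≤ K * dist (f x) (f y)) →
      ∀ B, μ (s ∩ f ⁻¹' B) ≤ C * ν B := by
  -- Haar measures are multiples of the Hausdorff measure of top dimension `D`. The inverse of `f`
  -- is `K`-Lipschitz on `f '' s ∩ B`, so it enlarges Hausdorff measure at most by `K ^ D`. No
  -- measurability of `s`, `f` or `B` is involved.
  set c := Measure.addHaarScalarFactor μ (μH[(Module.finrank ℝ E : ℝ)])
  set c' := Measure.addHaarScalarFactor (μH[(Module.finrank ℝ F : ℝ)]) ν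
  have hμ : μ = c • (μH[(Module.finrank ℝ E : ℝ)]) := Measure.isAddLeftInvariant_eq_smul _ _
  have hν : (μH[(Module.finrank ℝ F : ℝ)]) = c' • ν := Measure.isAddLeftInvariant_eq_smul _ _
  refine ⟨c * ((K : ENNReal) ^ (Module.finrank ℝ F : ℝ) * c'), ?_, fun s f hf B => ?_⟩
  · exact ENNReal.mul_ne_top ENNReal.coe_ne_top (ENNReal.mul_ne_top
      (ENNReal.rpow_ne_top_of_nonneg (by positivity) ENNReal.coe_ne_top) ENNReal.coe_ne_top)
  have hinj : InjOn f s := fun x hx y hy hxy => by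
    have := hf x hx y hy
    rw [hxy, dist_self, mul_zero] at this
    exact dist_le_zero.1 this
  rcases s.eq_empty_or_nonempty with rfl | ⟨x₀, hx₀⟩
  · simp
  have : Nonempty E := ⟨x₀⟩
  have hl : LipschitzOnWith K (Function.invFunOn f s) (f '' s ∩ B) := by
    refine LipschitzOnWith.of_dist_le_mul ?_
    rintro _ ⟨⟨x, hx, rfl⟩, -⟩ _ ⟨⟨y, hy, rfl⟩, -⟩
    rw [hinj.leftInvOn_invFunOn hx, hinj.leftInvOn_invFunOn hy]
    exact hf x hx y hy
  have hsub : s ∩ f ⁻¹' B ⊆ Function.invFunOn f s '' (f '' s ∩ B) := fun x hx =>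
    ⟨f x, ⟨mem_image_of_mem f hx.1, hx.2⟩, hinj.leftInvOn_invFunOn hx.1⟩
  have h1 := hl.hausdorffMeasure_image_le (d := (Module.finrank ℝ F : ℝ)) (by positivity)
  have h2 : (μH[(Module.finrank ℝ F : ℝ)]) (f '' s ∩ B) ≤ c' * ν B := by
    rw [hν, Measure.smul_apply]
    exact mul_le_mul_right (measure_mono inter_subset_right) _
  calc μ (s ∩ f ⁻¹' B) = c * (μH[(Module.finrank ℝ F : ℝ)]) (s ∩ f ⁻¹' B) := by
        conv_lhs => rw [hμ, Measure.smul_apply, h]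
        rfl
    _ ≤ c * ((K : ENNReal) ^ (Module.finrank ℝ F : ℝ) * (c' * ν B)) := by
        gcongr
        exact (measure_mono hsub).trans (h1.trans (by gcongr))
    _ = _ := by ring

/-- By the bound on sets, the push-forward under `f` of `μ` restricted to `s` is at most `C • ν`.
Continuity serves only to make `f` almost everywhere measurable. -/
theorem exists_setLIntegral_comp_le (μ : Measure E) [μ.IsAddHaarMeasure] (ν : Measure F)
    [ν.IsAddHaarMeasure] (h : Module.finrank ℝ E = Module.finrank ℝ F) (K : ℝ≥0) :
    ∃ C : ENNReal, C ≠ ⊤ ∧ ∀ (s : Set E) (f : E → F), MeasurableSet s → ContinuousOn f s →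
      (∀ x ∈ s, ∀ y ∈ s, dist x y ≤ K * dist (f x) (f y)) →
      ∀ φ : F → ENNReal, Measurable φ → ∫⁻ x in s, φ (f x) ∂μ ≤ C * ∫⁻ y, φ y ∂ν := by
  obtain ⟨C, hC, hC'⟩ := exists_measure_inter_preimage_le μ ν h K
  refine ⟨C, hC, fun s f hs hf hd φ hφ => ?_⟩
  have ha := hf.aemeasurable (μ := μ) hs
  rw [← lintegral_map' hφ.aemeasurable ha, ← smul_eq_mul, ← lintegral_smul_measure]
  refine lintegral_mono' (Measure.le_iff.2 fun B hB => ?_) le_rfl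
  rw [Measure.map_apply_of_aemeasurable ha hB, Measure.restrict_apply' hs, inter_comm]
  exact hC' s f hd B

end Antilipschitz

/-! ### Gram determinants and volume measures in charts -/

section Gram

variable {n : ℕ} {H : Type*} [TopologicalSpace H]
  {I : ModelWithCorners ℝ (EuclideanSpace ℝ (Fin n)) H}
  {N : Type*} [TopologicalSpace N] [ChartedSpace H N] [IsManifold I ∞ N]

lemma det_gram_comp (g : Metric I N) (x : N) {k : ℕ}
    (X : EuclideanSpace ℝ (Fin k) →ₗ[ℝ] TangentSpace I x)
    (A : EuclideanSpace ℝ (Fin k) →L[ℝ] EuclideanSpace ℝ (Fin k)) :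
    (gram g x fun i => X (A (EuclideanSpace.single i 1))).det =
      A.det ^ 2 * (gram g x fun i => X (EuclideanSpace.single i 1)).det := by
  set b := (EuclideanSpace.basisFun (Fin k) ℝ).toBasis
  set P := LinearMap.toMatrix b b (A : EuclideanSpace ℝ (Fin k) →ₗ[ℝ] EuclideanSpace ℝ (Fin k))
  have hP : ∀ i, A (EuclideanSpace.single i 1) = ∑ j, P j i • EuclideanSpace.single j (1 : ℝ) := by
    intro i
    have := b.sum_repr (A (EuclideanSpace.single i 1))
    rw [← this]
    refine Finset.sum_congr rfl fun j _ => ?_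
    simp [P, b, LinearMap.toMatrix_apply]
  have hg : (gram g x fun i => X (A (EuclideanSpace.single i 1))) =
      P.transpose * (gram g x fun i => X (EuclideanSpace.single i 1)) * P := by
    ext i j
    simp only [gram, Matrix.of_apply, hP, map_sum, map_smul, sum_apply, smul_apply,
      Matrix.mul_apply, Matrix.transpose_apply, smul_eq_mul, Finset.sum_mul]
    refine Finset.sum_congr rfl fun a _ => ?_
    rw [Finset.mul_sum]
    refine Finset.sum_congr rfl fun c _ => ?_
    ring
  rw [hg, Matrix.det_mul, Matrix.det_mul, Matrix.det_transpose]
  have : P.det = A.det := LinearMap.det_toMatrix b _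
  rw [this]
  ring

end Gram

lemma measurableSet_inter_preimage_of_continuousOn {X Y : Type*} [TopologicalSpace X]
    [MeasurableSpace X] [OpensMeasurableSpace X] [TopologicalSpace Y] [MeasurableSpace Y]
    [BorelSpace Y] {f : X → Y} {s : Set X} (hf : ContinuousOn f s) (hs : MeasurableSet s)
    {A : Set Y} (hA : MeasurableSet A) : MeasurableSet (s ∩ f ⁻¹' A) := by
  have h := (continuousOn_iff_continuous_domRestrict.1 hf).measurable hA
  have := hs.subtype_image h
  convert this using 1
  ext x
  simp [and_comm]

section Volume

variable {n : ℕ} {H : Type*} [TopologicalSpace H]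
  {I : ModelWithCorners ℝ (EuclideanSpace ℝ (Fin n)) H}
  {N : Type*} [TopologicalSpace N] [ChartedSpace H N] [IsManifold I ∞ N]
  {k : ℕ} {H' : Type*} [TopologicalSpace H']

section General

variable {J : ModelWithCorners ℝ (EuclideanSpace ℝ (Fin k)) H'} {S : Type*} [TopologicalSpace S]
  [ChartedSpace H' S] [IsManifold J ∞ S] [MeasurableSpace S]

variable (J) in
/-- The density of the volume of an immersed manifold in the chart centred at `s`. -/
def volDensity (g : Metric I N) (ι : S → N) (s z : S) : ENNReal :=
  ENNReal.ofReal (√ (gram g (ι z) fun i => mfderiv J I ι z (frame J s z i)).det)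

variable (J) in
/-- The volume measure of an immersed manifold in the chart centred at `s`. -/
def chartMeasure (g : Metric I N) (ι : S → N) (s : S) : Measure S :=
  (((volume : Measure (EuclideanSpace ℝ (Fin k))).restrict (extChartAt J s).target).withDensity
    fun y => volDensity J g ι s ((extChartAt J s).symm y)).map (extChartAt J s).symm

lemma volumeOf_eq_iSup (g : Metric I N) (ι : S → N) :
    volumeOf g J ι = ⨆ s, chartMeasure J g ι s := rfl

variable (J) in
lemma measurableSet_extChartAt_target (s : S) : MeasurableSet (extChartAt J s).target := by
  rw [extChartAt_target]
  exact ((OpenPartialHomeomorph.open_target _).preimage J.continuous_symm).measurableSet.inter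
    J.isClosed_range.measurableSet

variable [BorelSpace S]

lemma aemeasurable_extChartAt_symm (s : S) (f : EuclideanSpace ℝ (Fin k) → ENNReal) :
    AEMeasurable (extChartAt J s).symm
      ((volume.restrict (extChartAt J s).target).withDensity f) :=
  ((continuousOn_extChartAt_symm s).aemeasurable (measurableSet_extChartAt_target J s)).mono_ac
    (withDensity_absolutelyContinuous _ _)

lemma chartMeasure_apply (g : Metric I N) (ι : S → N) (s : S) {A : Set S} (hA : MeasurableSet A) :
    chartMeasure J g ι s A = ∫⁻ y in (extChartAt J s).target ∩ (extChartAt J s).symm ⁻¹' A,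
      volDensity J g ι s ((extChartAt J s).symm y) := by
  rw [chartMeasure, Measure.map_apply_of_aemeasurable (aemeasurable_extChartAt_symm s _) hA,
    withDensity_apply', Measure.restrict_restrict' (measurableSet_extChartAt_target J s),
    inter_comm]

end General

section Boundaryless

variable {d : ℕ} {S : Type*} [TopologicalSpace S]
  [ChartedSpace (EuclideanSpace ℝ (Fin d)) S] [IsManifold (𝓡 d) ∞ S]
  [MeasurableSpace S] [BorelSpace S]

/-- Transformation law of the Riemannian density: the derivative of the transition map carries one
coordinate frame to the other, and Gram determinants then change by the square of its determinant
(`det_gram_comp`). -/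
lemma volDensity_eq_abs_det_mul (g : Metric I N) (ι : S → N) {z₀ s : S}
    {u : EuclideanSpace ℝ (Fin d)} (hu : u ∈ (extChartAt (𝓡 d) z₀).target)
    (hs : (extChartAt (𝓡 d) z₀).symm u ∈ (chartAt (EuclideanSpace ℝ (Fin d)) s).source) :
    volDensity (𝓡 d) g ι z₀ ((extChartAt (𝓡 d) z₀).symm u) =
      ENNReal.ofReal |(fderiv ℝ (localParam (𝓡 d) (id : S → S) z₀ s) u).det| *
        volDensity (𝓡 d) g ι s ((extChartAt (𝓡 d) z₀).symm u) := by
  set z := (extChartAt (𝓡 d) z₀).symm u with hz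
  set A := fderiv ℝ (localParam (𝓡 d) (id : S → S) z₀ s) u
  have h : ∀ a, vecAt (𝓡 d) z₀ z a = vecAt (𝓡 d) s z (A a) := fun a => by
    have := mfderiv_eq_vecAt (I := 𝓡 d) (ι := (id : S → S)) contMDiff_id hu (q := s) hs a
    rwa [mfderiv_id] at this
  let X : EuclideanSpace ℝ (Fin d) →ₗ[ℝ] TangentSpace I (ι z) :=
    (mfderiv (𝓡 d) I ι z).toLinearMap ∘ₗ
      ((trivializationAt (EuclideanSpace ℝ (Fin d)) (TangentSpace (𝓡 d) : S → Type _) s).symmL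
        ℝ z).toLinearMap
  have h1 : (gram g (ι z) fun i => mfderiv (𝓡 d) I ι z (frame (𝓡 d) z₀ z i)) =
      gram g (ι z) fun i => X (A (EuclideanSpace.single i 1)) := by
    congr 1
    ext1 i
    rw [frame, h]
    rfl
  have h2 := det_gram_comp g (ι z) X A
  rw [← h1] at h2
  rw [volDensity, h2, Real.sqrt_mul (sq_nonneg _), Real.sqrt_sq_eq_abs,
    ENNReal.ofReal_mul (abs_nonneg _)]
  rfl

/-- Compatibility of the chart measures on overlaps, by the change of variables formula for the
transition map `T`; one inequality is enough for bounding their supremum. -/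
lemma chartMeasure_restrict_le (g : Metric I N) (ι : S → N) (s z₀ : S) :
    (chartMeasure (𝓡 d) g ι s).restrict (chartAt (EuclideanSpace ℝ (Fin d)) z₀).source ≤
      chartMeasure (𝓡 d) g ι z₀ := by
  refine Measure.le_iff.2 fun A hA => ?_
  set U := (chartAt (EuclideanSpace ℝ (Fin d)) z₀).source with hU
  set V := (chartAt (EuclideanSpace ℝ (Fin d)) s).source with hV
  have hUo : IsOpen U := (chartAt (EuclideanSpace ℝ (Fin d)) z₀).open_source
  have hVo : IsOpen V := (chartAt (EuclideanSpace ℝ (Fin d)) s).open_source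
  have hUs : U = (extChartAt (𝓡 d) z₀).source := (extChartAt_source (𝓡 d) z₀).symm
  have hVs : V = (extChartAt (𝓡 d) s).source := (extChartAt_source (𝓡 d) s).symm
  rw [Measure.restrict_apply hA, chartMeasure_apply g ι s (hA.inter hUo.measurableSet),
    chartMeasure_apply g ι z₀ hA]
  set O := (extChartAt (𝓡 d) z₀).target ∩ (extChartAt (𝓡 d) z₀).symm ⁻¹' (A ∩ V)
  have hO : MeasurableSet O := measurableSet_inter_preimage_of_continuousOn
    (continuousOn_extChartAt_symm z₀) (measurableSet_extChartAt_target _ z₀)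
    (hA.inter hVo.measurableSet)
  set T := localParam (d := d) (𝓡 d) (id : S → S) z₀ s
  have hT : ∀ u ∈ O, (extChartAt (𝓡 d) s).symm (T u) = (extChartAt (𝓡 d) z₀).symm u :=
    fun u hu => (extChartAt (𝓡 d) s).left_inv (hVs ▸ hu.2.2)
  have himg : (extChartAt (𝓡 d) s).target ∩ (extChartAt (𝓡 d) s).symm ⁻¹' (A ∩ U) = T '' O := by
    ext y
    constructor
    · rintro ⟨hy, hyA, hyU⟩
      have hl := (extChartAt (𝓡 d) z₀).left_inv (hUs ▸ hyU)
      refine ⟨extChartAt (𝓡 d) z₀ ((extChartAt (𝓡 d) s).symm y),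
        ⟨(extChartAt (𝓡 d) z₀).map_source (hUs ▸ hyU), ?_⟩, ?_⟩
      · rw [mem_preimage, hl]
        exact ⟨hyA, hVs ▸ (extChartAt (𝓡 d) s).map_target hy⟩
      · show extChartAt (𝓡 d) s ((extChartAt (𝓡 d) z₀).symm _) = y
        rw [hl, (extChartAt (𝓡 d) s).right_inv hy]
    · rintro ⟨u, hu, rfl⟩
      refine ⟨(extChartAt (𝓡 d) s).map_source (hVs ▸ hu.2.2), ?_⟩
      rw [mem_preimage, hT u hu]
      exact ⟨hu.2.1, hUs ▸ (extChartAt (𝓡 d) z₀).map_target hu.1⟩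
  have hinj : InjOn T O := fun u hu u' hu' h => by
    have := hT u hu
    rw [h, hT u' hu'] at this
    exact (extChartAt (𝓡 d) z₀).symm.injOn hu.1 hu'.1 this.symm
  rw [himg, lintegral_image_eq_lintegral_abs_det_fderiv_mul volume hO
    (f' := fun u => fderiv ℝ T u) (fun u hu => ((contDiffAt_localParam (I := 𝓡 d)
      (ι := (id : S → S)) contMDiff_id hu.1 hu.2.2).differentiableAt
        (by simp)).hasFDerivAt.hasFDerivWithinAt) hinj]
  rw [setLIntegral_congr_fun hO (g := fun u => volDensity (𝓡 d) g ι z₀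
    ((extChartAt (𝓡 d) z₀).symm u)) fun u hu => ?_]
  · exact lintegral_mono_set fun u hu => ⟨hu.1, hu.2.1⟩
  · simp only
    rw [hT u hu]
    exact (volDensity_eq_abs_det_mul g ι hu.1 hu.2.2).symm

/-- The sum of the measure of the chart at `z₀` and of the volume outside its domain dominates every
chart measure, hence their supremum. Restricting this to the domain removes the second summand. -/
lemma volumeOf_restrict_le (g : Metric I N) (ι : S → N) (z₀ : S) :
    (volumeOf g (𝓡 d) ι).restrict (chartAt (EuclideanSpace ℝ (Fin d)) z₀).source ≤
      chartMeasure (𝓡 d) g ι z₀ := by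
  set U := (chartAt (EuclideanSpace ℝ (Fin d)) z₀).source
  have hU : MeasurableSet U :=
    (chartAt (EuclideanSpace ℝ (Fin d)) z₀).open_source.measurableSet
  have h : volumeOf g (𝓡 d) ι ≤
      chartMeasure (𝓡 d) g ι z₀ + (volumeOf g (𝓡 d) ι).restrict Uᶜ := by
    conv_lhs => rw [volumeOf_eq_iSup]
    refine iSup_le fun s => ?_
    rw [← Measure.restrict_add_restrict_compl (μ := chartMeasure (𝓡 d) g ι s) hU]
    exact add_le_add (chartMeasure_restrict_le g ι s z₀)
      (Measure.restrict_mono le_rfl (le_iSup (fun s => chartMeasure (𝓡 d) g ι s) s))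
  have h2 := Measure.restrict_mono (le_refl U) h
  rw [Measure.restrict_add, Measure.restrict_restrict hU, inter_compl_self,
    Measure.restrict_empty, add_zero] at h2
  exact h2.trans Measure.restrict_le_self

lemma continuousAt_det_gram_mfderiv (g : Metric I N) {ι : S → N}
    (hι : IsInteriorEmbedding (d := d) I ι) (z₀ : S) :
    ContinuousAt (fun u => (gram g (ι ((extChartAt (𝓡 d) z₀).symm u)) fun i =>
      mfderiv (𝓡 d) I ι ((extChartAt (𝓡 d) z₀).symm u)
        (frame (𝓡 d) z₀ ((extChartAt (𝓡 d) z₀).symm u) i)).det) (extChartAt (𝓡 d) z₀ z₀) := by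
  set u₀ := extChartAt (𝓡 d) z₀ z₀
  set ψ := localParam (d := d) I ι z₀ (ι z₀)
  have hu₀ : u₀ ∈ (extChartAt (𝓡 d) z₀).target := mem_extChartAt_target z₀
  have hb : ι ((extChartAt (𝓡 d) z₀).symm u₀) ∈ baseDomain I (ι z₀) := by
    rw [extChartAt_to_inv]; exact mem_baseDomain_self (hι.mem_interior z₀)
  have hc : ContinuousAt (fun u => ι ((extChartAt (𝓡 d) z₀).symm u)) u₀ :=
    hι.contMDiff.continuous.continuousAt.comp
      ((continuousOn_extChartAt_symm z₀).continuousAt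
        ((isOpen_extChartAt_target z₀).mem_nhds hu₀))
  have hψ : ContDiffAt ℝ ∞ ψ u₀ := contDiffAt_localParam hι.contMDiff hu₀ hb.1
  have hm : ∀ i j, ContinuousAt (fun u => metricMatrix g (ι z₀) (ψ u) i j) u₀ := fun i j =>
    ContinuousAt.comp (f := ψ) (((contDiffOn_metricMatrix g (ι z₀) i j).continuousOn).continuousAt
      ((isOpen_coordTarget _).mem_nhds (extChartAt_mem_coordTarget hb))) hψ.continuousAt
  have hD : ∀ (i : Fin d) (a : Fin n), ContinuousAt
      (fun u => (fderiv ℝ ψ u (EuclideanSpace.single i 1)) a) u₀ := fun i a => by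
    have h1 : ContinuousAt (fderiv ℝ ψ) u₀ :=
      (hψ.fderiv_right (m := 0) (by norm_cast)).continuousAt
    have h2 : ContinuousAt (fun u => fderiv ℝ ψ u (EuclideanSpace.single i 1)) u₀ :=
      h1.clm_apply continuousAt_const
    exact (EuclideanSpace.proj a : EuclideanSpace ℝ (Fin n) →L[ℝ] ℝ).continuous.continuousAt.comp h2
  have hev : ∀ᶠ u in 𝓝 u₀, u ∈ (extChartAt (𝓡 d) z₀).target ∧
      ι ((extChartAt (𝓡 d) z₀).symm u) ∈ baseDomain I (ι z₀) :=
    Filter.Eventually.and ((isOpen_extChartAt_target z₀).mem_nhds hu₀)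
      (hc.eventually ((isOpen_baseDomain _).mem_nhds hb))
  refine ContinuousAt.congr (f := fun u => (Matrix.of fun i j : Fin d => ∑ a, ∑ c,
    (fderiv ℝ ψ u (EuclideanSpace.single i 1)) a * (fderiv ℝ ψ u (EuclideanSpace.single j 1)) c *
      metricMatrix g (ι z₀) (ψ u) a c).det) ?_ ?_
  · have hcm : ContinuousAt (fun u => Matrix.of fun i j : Fin d => ∑ a, ∑ c,
        (fderiv ℝ ψ u (EuclideanSpace.single i 1)) a *
        (fderiv ℝ ψ u (EuclideanSpace.single j 1)) c * metricMatrix g (ι z₀) (ψ u) a c) u₀ := by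
      refine continuousAt_pi.2 fun i => continuousAt_pi.2 fun j => ?_
      simp only [Matrix.of_apply]
      exact tendsto_finsetSum _ fun a _ => tendsto_finsetSum _ fun c _ =>
        ((hD i a).mul (hD j c)).mul (hm a c)
    exact (continuous_id.matrix_det).continuousAt.comp hcm
  · filter_upwards [hev] with u hu
    congr 1
    ext i j
    simp only [gram, Matrix.of_apply, frame]
    rw [mfderiv_eq_vecAt hι.contMDiff hu.1 hu.2.1, mfderiv_eq_vecAt hι.contMDiff hu.1 hu.2.1,
      inner_vecAt]
    have hl : (extChartAt I (ι z₀)).symm (ψ u) = ι ((extChartAt (𝓡 d) z₀).symm u) :=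
      (extChartAt I (ι z₀)).left_inv (by rw [extChartAt_source]; exact hu.2.1)
    have hm' : metricMatrix g (ι z₀) (ψ u) = gram g (ι ((extChartAt (𝓡 d) z₀).symm u))
        (frame I (ι z₀) (ι ((extChartAt (𝓡 d) z₀).symm u))) := by
      unfold metricMatrix; rw [hl]
    rw [hm']

/-- The volume of a hypersurface is bounded by the Lebesgue measure in a chart. -/
theorem exists_lintegral_volumeOf_le (g : Metric I N) {ι : S → N}
    (hι : IsInteriorEmbedding (d := d) I ι) (z₀ : S) :
    ∃ r > 0, ∃ C : ENNReal, C ≠ ⊤ ∧ ∀ F : S → ENNReal,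
      (∀ z, F z ≠ 0 → z ∈ (chartAt (EuclideanSpace ℝ (Fin d)) z₀).source ∧
        dist (extChartAt (𝓡 d) z₀ z) (extChartAt (𝓡 d) z₀ z₀) < r) →
      ∫⁻ z, F z ∂(volumeOf g (𝓡 d) ι) ≤
        C * ∫⁻ u in (extChartAt (𝓡 d) z₀).target, F ((extChartAt (𝓡 d) z₀).symm u) := by
  have hcont := (continuousAt_det_gram_mfderiv g hι z₀).sqrt
  obtain ⟨c, hc⟩ : ∃ c, ∀ᶠ u in 𝓝 (extChartAt (𝓡 d) z₀ z₀), √ (gram g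
      (ι ((extChartAt (𝓡 d) z₀).symm u)) fun i => mfderiv (𝓡 d) I ι ((extChartAt (𝓡 d) z₀).symm u)
        (frame (𝓡 d) z₀ ((extChartAt (𝓡 d) z₀).symm u) i)).det < c :=
    ⟨_, hcont.eventually (gt_mem_nhds (lt_add_one _))⟩
  obtain ⟨r, hr, hball⟩ := Metric.mem_nhds_iff.1 hc
  refine ⟨r, hr, ENNReal.ofReal c, ENNReal.ofReal_ne_top, fun F hF => ?_⟩
  set u₀ := extChartAt (𝓡 d) z₀ z₀
  set U := (chartAt (EuclideanSpace ℝ (Fin d)) z₀).source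
  set ρ := fun y => volDensity (𝓡 d) g ι z₀ ((extChartAt (𝓡 d) z₀).symm y)
  set F' := fun u => F ((extChartAt (𝓡 d) z₀).symm u)
  have hUs : U = (extChartAt (𝓡 d) z₀).source := (extChartAt_source (𝓡 d) z₀).symm
  have hU : MeasurableSet U :=
    (chartAt (EuclideanSpace ℝ (Fin d)) z₀).open_source.measurableSet
  have hFU : U.indicator F = F := by
    refine indicator_eq_self.2 fun z hz => (hF z hz).1
  have hB : MeasurableSet (Metric.ball u₀ r) := Metric.isOpen_ball.measurableSet
  calc ∫⁻ z, F z ∂(volumeOf g (𝓡 d) ι)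
      = ∫⁻ z in U, F z ∂(volumeOf g (𝓡 d) ι) := by rw [← lintegral_indicator hU, hFU]
    _ ≤ ∫⁻ z, F z ∂(chartMeasure (𝓡 d) g ι z₀) :=
        lintegral_mono' (volumeOf_restrict_le g ι z₀) le_rfl
    _ ≤ ∫⁻ u, F' u ∂((volume.restrict (extChartAt (𝓡 d) z₀).target).withDensity ρ) :=
        lintegral_map_le _ _
    _ ≤ ∫⁻ u, (Metric.ball u₀ r).indicator F' u
          ∂((volume.restrict (extChartAt (𝓡 d) z₀).target).withDensity ρ) := by
        refine lintegral_mono_ae ?_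
        refine (withDensity_absolutelyContinuous _ ρ).ae_le ?_
        filter_upwards [ae_restrict_mem (measurableSet_extChartAt_target (𝓡 d) z₀)] with u hu
        by_cases h : F' u = 0
        · rw [h]; exact zero_le
        · have := (hF _ h).2
          rw [(extChartAt (𝓡 d) z₀).right_inv hu] at this
          rw [indicator_of_mem (by exact this)]
    _ = ∫⁻ u, F' u ∂(((volume.restrict (extChartAt (𝓡 d) z₀).target).restrict
          (Metric.ball u₀ r)).withDensity ρ) := by
        rw [lintegral_indicator hB, restrict_withDensity hB]
    _ ≤ ∫⁻ u, F' u ∂(((volume.restrict (extChartAt (𝓡 d) z₀).target).restrict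
          (Metric.ball u₀ r)).withDensity fun _ => ENNReal.ofReal c) := by
        refine lintegral_mono' (withDensity_mono ?_) le_rfl
        filter_upwards [ae_restrict_mem hB] with u hu
        exact ENNReal.ofReal_le_ofReal (le_of_lt (hball hu))
    _ ≤ _ := by
        rw [withDensity_const, lintegral_smul_measure, smul_eq_mul]
        exact mul_le_mul_right (lintegral_mono' Measure.restrict_le_self le_rfl) _

end Boundaryless

/-- The Lebesgue measure in a chart is bounded by the Riemannian volume. -/
theorem exists_setLIntegral_le_vol [MeasurableSpace N] [BorelSpace N] (g : Metric I N) (q : N)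
    {y₁ : EuclideanSpace ℝ (Fin n)} (hy₁ : y₁ ∈ coordTarget I q) :
    ∃ r > 0, ∃ C : ENNReal, C ≠ ⊤ ∧ ∀ φ : N → ENNReal, Measurable φ →
      ∫⁻ y in Metric.ball y₁ r, φ ((extChartAt I q).symm y) ≤ C * ∫⁻ x, φ x ∂(vol g) := by
  have hcont : ContinuousAt (fun y => √ (metricMatrix g q y).det) y₁ :=
    (((contDiffOn_det fun i j => contDiffOn_metricMatrix g q i j).continuousOn).continuousAt
      ((isOpen_coordTarget q).mem_nhds hy₁)).sqrt
  set c := √ (metricMatrix g q y₁).det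
  have hc : 0 < c := Real.sqrt_pos.2 (posDef_metricMatrix g q hy₁).det_pos
  obtain ⟨r, hr, hball⟩ := Metric.mem_nhds_iff.1 (inter_mem
    ((isOpen_coordTarget q).mem_nhds hy₁) (hcont.eventually (lt_mem_nhds (half_lt_self hc))))
  refine ⟨r, hr, (ENNReal.ofReal (c / 2))⁻¹, ?_, fun φ hφ => ?_⟩
  · exact ENNReal.inv_ne_top.2 (by simpa using hc)
  have hB : MeasurableSet (Metric.ball y₁ r) := Metric.isOpen_ball.measurableSet
  set ρ := fun y => volDensity I g (id : N → N) q ((extChartAt I q).symm y)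
  have hρ : ∀ y, ρ y = ENNReal.ofReal (√ (metricMatrix g q y).det) := fun y => by
    simp only [ρ, volDensity, mfderiv_id, metricMatrix]
    rfl
  have hsub : Metric.ball y₁ r ⊆ (extChartAt I q).target := fun y hy =>
    interior_subset (hball hy).1
  have h1 : ENNReal.ofReal (c / 2) • (volume.restrict (Metric.ball y₁ r)) ≤
      (volume.restrict (extChartAt I q).target).withDensity ρ := by
    refine le_trans ?_ (Measure.restrict_le_self (s := Metric.ball y₁ r))
    rw [restrict_withDensity hB, Measure.restrict_restrict hB, inter_eq_left.2 hsub,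
      ← withDensity_const]
    refine withDensity_mono ?_
    filter_upwards [ae_restrict_mem hB] with y hy
    rw [hρ]
    exact ENNReal.ofReal_le_ofReal (hball hy).2.le
  have h2 : ENNReal.ofReal (c / 2) * ∫⁻ y in Metric.ball y₁ r, φ ((extChartAt I q).symm y) ≤
      ∫⁻ x, φ x ∂(vol g) := by
    rw [← smul_eq_mul, ← lintegral_smul_measure]
    refine (lintegral_mono' h1 le_rfl).trans ?_
    rw [← lintegral_map' hφ.aemeasurable (aemeasurable_extChartAt_symm q ρ)]
    -- Bounding the volume from below takes a single member of the supremum, so no compatibility of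
    -- charts of `N` is needed.
    exact lintegral_mono' (le_iSup (fun s => chartMeasure I g (id : N → N) s) q) le_rfl
  have hc0 : ENNReal.ofReal (c / 2) ≠ 0 := by simpa using hc
  calc _ = (ENNReal.ofReal (c / 2))⁻¹ * (ENNReal.ofReal (c / 2) *
        ∫⁻ y in Metric.ball y₁ r, φ ((extChartAt I q).symm y)) := by
        rw [← mul_assoc, ENNReal.inv_mul_cancel hc0 ENNReal.ofReal_ne_top, one_mul]
    _ ≤ _ := by gcongr

end Volume

/-! ### Integrals of homogeneous functions -/

section Cone

variable {E : Type*} [NormedAddCommGroup E] [NormedSpace ℝ E] [FiniteDimensional ℝ E]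
  [MeasurableSpace E] [BorelSpace E]

lemma lintegral_eq_mul_lintegral_comp_smul (μ : Measure E) [μ.IsAddHaarMeasure] {c : ℝ}
    (hc : 0 < c) {F : E → ENNReal} (hF : Measurable F) :
    ∫⁻ w, F w ∂μ = ENNReal.ofReal (c ^ Module.finrank ℝ E) * ∫⁻ w, F (c • w) ∂μ := by
  have h1 : ∫⁻ w, F (c • w) ∂μ = ∫⁻ w, F w ∂(μ.map (c • ·)) :=
    (lintegral_map hF (measurable_const_smul c)).symm
  have hp : 0 < c ^ Module.finrank ℝ E := pow_pos hc _
  rw [h1, Measure.map_addHaar_smul μ hc.ne', lintegral_smul_measure, smul_eq_mul, ← mul_assoc,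
    ← ENNReal.ofReal_mul hp.le, abs_of_pos (inv_pos.2 hp), mul_inv_cancel₀ hp.ne',
    ENNReal.ofReal_one, one_mul]

/-- The integral of a function which is homogeneous of degree `0` over a punctured ball is
controlled by its integral over a spherical shell. -/
theorem setLIntegral_ball_le_shell (μ : Measure E) [μ.IsAddHaarMeasure]
    (hD : 1 ≤ Module.finrank ℝ E) {Q : E → ℝ} (hQ : Measurable Q)
    (hQs : ∀ (c : ℝ) w, Q (c • w) = c ^ 2 * Q w) {s : ℝ} (hs : 0 < s) (hs1 : s < 1)
    {F : E → ENNReal} (hF : Measurable F) (hFs : ∀ (c : ℝ) w, 0 < c → F (c • w) = F w) :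
    ∫⁻ w in {w | 0 < Q w ∧ Q w < 1}, F w ∂μ ≤
      (1 - ENNReal.ofReal s)⁻¹ * ∫⁻ w in {w | 1 < Q w ∧ Q w ≤ (s ^ 2)⁻¹}, F w ∂μ := by
  set A : Set E := {w | 1 < Q w ∧ Q w ≤ (s ^ 2)⁻¹}
  -- The punctured ball is covered by the shells `s ^ (k + 1) • A`. With `D` the dimension, the
  -- integral over the `k`-th one is `s ^ ((k + 1) D) ≤ s ^ k` times that over `A`, which leads to a
  -- geometric series.
  set B : ℕ → Set E := fun k => {w | (s ^ 2) ^ (k + 1) < Q w ∧ Q w ≤ (s ^ 2) ^ k}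
  have hB : ∀ k, MeasurableSet (B k) := fun k =>
    (measurableSet_lt measurable_const hQ).inter (measurableSet_le hQ measurable_const)
  have hA : MeasurableSet A :=
    (measurableSet_lt measurable_const hQ).inter (measurableSet_le hQ measurable_const)
  have hsub : {w | 0 < Q w ∧ Q w < 1} ⊆ ⋃ k, B k := fun w hw => by
    obtain ⟨k, hk⟩ := exists_nat_pow_near_of_lt_one hw.1 hw.2.le (pow_pos hs 2)
      (pow_lt_one₀ hs.le hs1 two_ne_zero)
    exact mem_iUnion.2 ⟨k, hk⟩
  have hk : ∀ k, ∫⁻ w in B k, F w ∂μ ≤ ENNReal.ofReal s ^ k * ∫⁻ w in A, F w ∂μ := fun k => by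
    have hc : 0 < s ^ (k + 1) := pow_pos hs _
    rw [← lintegral_indicator (hB k),
      lintegral_eq_mul_lintegral_comp_smul μ hc (hF.indicator (hB k)), ← lintegral_indicator hA]
    have hmem : ∀ w, s ^ (k + 1) • w ∈ B k ↔ w ∈ A := fun w => by
      have h0 : 0 < s ^ 2 := pow_pos hs 2
      have h1 : 0 < (s ^ 2) ^ (k + 1) := pow_pos h0 _
      have h2 : (s ^ (k + 1)) ^ 2 = (s ^ 2) ^ (k + 1) := by ring
      have h3 : (s ^ 2) ^ k = (s ^ 2) ^ (k + 1) * (s ^ 2)⁻¹ := by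
        rw [pow_succ (s ^ 2) k, mul_assoc, mul_inv_cancel₀ h0.ne', mul_one]
      simp only [B, A, mem_ofPred_eq, hQs, h2]
      rw [h3, mul_le_mul_iff_right₀ h1, lt_mul_iff_one_lt_right h1]
    have heq : ∀ w, (B k).indicator F (s ^ (k + 1) • w) = A.indicator F w := fun w => by
      by_cases hw : w ∈ A
      · rw [indicator_of_mem hw, indicator_of_mem ((hmem w).2 hw), hFs _ _ hc]
      · rw [indicator_of_notMem hw, indicator_of_notMem (mt (hmem w).1 hw)]
    simp only [heq]
    gcongr
    rw [← ENNReal.ofReal_pow hs.le]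
    refine ENNReal.ofReal_le_ofReal ?_
    rw [← pow_mul]
    exact pow_le_pow_of_le_one hs.le hs1.le
      ((Nat.le_succ k).trans (Nat.le_mul_of_pos_right _ hD))
  calc ∫⁻ w in {w | 0 < Q w ∧ Q w < 1}, F w ∂μ ≤ ∫⁻ w in ⋃ k, B k, F w ∂μ :=
        lintegral_mono_set hsub
    _ ≤ ∑' k, ∫⁻ w in B k, F w ∂μ := lintegral_iUnion_le _ _
    _ ≤ ∑' k, ENNReal.ofReal s ^ k * ∫⁻ w in A, F w ∂μ := ENNReal.tsum_le_tsum hk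
    _ = _ := by rw [ENNReal.tsum_mul_right, ENNReal.tsum_geometric]

lemma lintegral_comp_linearMap (μ : Measure E) [μ.IsAddHaarMeasure] (A : E →L[ℝ] E)
    (hA : A.det ≠ 0) {F : E → ENNReal} (hF : Measurable F) :
    ENNReal.ofReal |A.det| * ∫⁻ w, F (A w) ∂μ = ∫⁻ w, F w ∂μ := by
  rw [← lintegral_map hF A.continuous.measurable]
  have h := Measure.map_linearMap_addHaar_eq_smul_addHaar μ (f := (A : E →ₗ[ℝ] E)) hA
  have h' : μ.map A = ENNReal.ofReal |A.det⁻¹| • μ := h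
  rw [h', lintegral_smul_measure, smul_eq_mul, ← mul_assoc, ← ENNReal.ofReal_mul (abs_nonneg _),
    ← abs_mul, mul_inv_cancel₀ hA, abs_one, ENNReal.ofReal_one, one_mul]

end Cone

/-! ### The measure on unit spheres -/

section Sphere

variable {n : ℕ} {H : Type*} [TopologicalSpace H]
  {I : ModelWithCorners ℝ (EuclideanSpace ℝ (Fin n)) H}
  {N : Type*} [TopologicalSpace N] [ChartedSpace H N] [IsManifold I ∞ N]

/-- The squared length, in terms of the components in the chart centred at `q`. -/
def lengthSq (g : Metric I N) (q x : N) (v : EuclideanSpace ℝ (Fin n)) : ℝ :=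
  g.inner x (vecAt I q x v) (vecAt I q x v)

lemma lengthSq_smul (g : Metric I N) (q x : N) (c : ℝ) (v : EuclideanSpace ℝ (Fin n)) :
    lengthSq g q x (c • v) = c ^ 2 * lengthSq g q x v := by
  unfold lengthSq
  rw [vecAt_smul, map_smul, map_smul, smul_apply, smul_eq_mul, smul_eq_mul]
  ring

lemma continuous_lengthSq (g : Metric I N) (q x : N) : Continuous (lengthSq g q x) := by
  unfold lengthSq
  simp only [inner_vecAt]
  fun_prop

/-- The unit vector at `x` in the direction of the vector with components `v`. -/
def unitVecAt (g : Metric I N) (q x : N) (v : EuclideanSpace ℝ (Fin n)) : TangentBundle I N :=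
  ⟨x, vecAt I q x ((√ (lengthSq g q x v))⁻¹ • v)⟩

lemma unitVecAt_smul (g : Metric I N) (q x : N) {c : ℝ} (hc : 0 < c)
    (v : EuclideanSpace ℝ (Fin n)) : unitVecAt g q x (c • v) = unitVecAt g q x v := by
  unfold unitVecAt
  rw [lengthSq_smul, Real.sqrt_mul (sq_nonneg c), Real.sqrt_sq hc.le, smul_smul, mul_inv,
    mul_assoc, mul_comm, mul_assoc, mul_inv_cancel₀ hc.ne', mul_one]

lemma continuous_mk_vecAt (q x : N) :
    Continuous fun v => (⟨x, vecAt I q x v⟩ : TangentBundle I N) := by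
  have h1 : Continuous fun v => vecAt I q x v := ContinuousLinearMap.continuous
    ((trivializationAt (EuclideanSpace ℝ (Fin n)) (TangentSpace I : N → Type _) q).symmL ℝ x)
  exact (FiberBundle.totalSpaceMk_isInducing (EuclideanSpace ℝ (Fin n))
    (TangentSpace I : N → Type _) x).continuous.comp h1

lemma measurable_unitVecAt (g : Metric I N) (q x : N) : Measurable (unitVecAt g q x) := by
  have h : Measurable fun v => (√ (lengthSq g q x v))⁻¹ • v :=
    ((continuous_lengthSq g q x).measurable.sqrt.inv).smul measurable_id
  exact (continuous_mk_vecAt q x).measurable.comp h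

lemma abs_inner_le_one (g : Metric I N) {x : N} {u w : TangentSpace I x}
    (hu : g.inner x u u = 1) (hw : g.inner x w w = 1) : |g.inner x u w| ≤ 1 := by
  set c := g.inner x u w with hc
  have h0 : 0 ≤ g.inner x (u - c • w) (u - c • w) := by
    by_cases h : u - c • w = 0
    · rw [h]; simp
    · exact (g.pos x _ h).le
  have h1 : g.inner x (u - c • w) (u - c • w) = 1 - c ^ 2 := by
    simp only [map_sub, map_smul, sub_apply, smul_apply, smul_eq_mul, hu, hw, g.symm x w u, ← hc]
    ring
  rw [h1] at h0
  exact abs_le_one_iff_mul_self_le_one.2 (by nlinarith)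

variable (I) in
/-- The change of components of the vectors at `x` from the chart centred at `p` to the chart
centred at `q`. -/
def frameChange (p q x : N) : EuclideanSpace ℝ (Fin n) →L[ℝ] EuclideanSpace ℝ (Fin n) :=
  ((trivializationAt (EuclideanSpace ℝ (Fin n)) (TangentSpace I : N → Type _)
    q).continuousLinearMapAt ℝ x).comp
  ((trivializationAt (EuclideanSpace ℝ (Fin n)) (TangentSpace I : N → Type _) p).symmL ℝ x)

lemma vecAt_frameChange (p : N) {q x : N} (hx : x ∈ (chartAt H q).source)
    (v : EuclideanSpace ℝ (Fin n)) : vecAt I q x (frameChange I p q x v) = vecAt I p x v := by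
  have hx' : x ∈ (trivializationAt (EuclideanSpace ℝ (Fin n))
    (TangentSpace I : N → Type _) q).baseSet := hx
  exact (trivializationAt (EuclideanSpace ℝ (Fin n))
    (TangentSpace I : N → Type _) q).symmL_continuousLinearMapAt hx' _

lemma det_gram_frame (g : Metric I N) (p : N) {q x : N} (hx : x ∈ (chartAt H q).source) :
    (gram g x (frame I p x)).det =
      (frameChange I p q x).det ^ 2 * (gram g x (frame I q x)).det := by
  refine Eq.trans ?_ (det_gram_comp g x ((trivializationAt (EuclideanSpace ℝ (Fin n))
    (TangentSpace I : N → Type _) q).symmL ℝ x).toLinearMap (frameChange I p q x))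
  congr 2
  ext1 i
  exact (vecAt_frameChange p hx _).symm

/-- The flux through the hemispheres is controlled by the Lebesgue measure on a shell. -/
theorem lintegral_sphereMeasure_le (hn : 1 ≤ n) (g : Metric I N) {q x : N}
    (hx : x ∈ (chartAt H q).source) {ν : TangentSpace I x} (hν : g.inner x ν ν = 1) {s : ℝ}
    (hs : 0 < s) (hs1 : s < 1) {G : TangentBundle I N → ENNReal} (hG : Measurable G) :
    ∫⁻ p, G p ∂(((sphereMeasure g x).withDensity fun v =>
      ENNReal.ofReal |g.inner x ν (vecAt I x x v)|).map
      fun v => (⟨x, vecAt I x x v⟩ : TangentBundle I N)) ≤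
    n * (ENNReal.ofReal (√ (gram g x (frame I q x)).det) * ((1 - ENNReal.ofReal s)⁻¹ *
      ∫⁻ w in {w | 1 < lengthSq g q x w ∧ lengthSq g q x w ≤ (s ^ 2)⁻¹},
        G (unitVecAt g q x w))) := by
  have hd : Measurable fun v => ENNReal.ofReal |g.inner x ν (vecAt I x x v)| := by
    have h1 : Continuous fun v => g.inner x ν (vecAt I x x v) :=
      (g.inner x ν).continuous.comp (ContinuousLinearMap.continuous
        ((trivializationAt (EuclideanSpace ℝ (Fin n)) (TangentSpace I : N → Type _) x).symmL ℝ x))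
    exact h1.abs.measurable.ennreal_ofReal
  set A := frameChange I x q x
  have hxx : x ∈ (chartAt H x).source := mem_chart_source H x
  have hdet := det_gram_frame g x hx
  have hA : A.det ≠ 0 := fun h => by
    have := (posDef_gram_frame g hxx).det_pos
    rw [hdet, h] at this
    simp at this
  have hl : ∀ v, lengthSq g x x v = lengthSq g q x (A v) := fun v => by
    unfold lengthSq; rw [vecAt_frameChange x hx]
  have hu : ∀ v, unitVecAt g x x v = unitVecAt g q x (A v) := fun v => by
    unfold unitVecAt
    rw [hl, ← map_smul, vecAt_frameChange x hx]
  set B : Set (EuclideanSpace ℝ (Fin n)) := {w | 0 < lengthSq g q x w ∧ lengthSq g q x w < 1}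
  have hB : MeasurableSet B :=
    (measurableSet_lt measurable_const (continuous_lengthSq g q x).measurable).inter
      (measurableSet_lt (continuous_lengthSq g q x).measurable measurable_const)
  have hB' : MeasurableSet (A ⁻¹' B) := A.continuous.measurable hB
  have hGu : Measurable fun w => G (unitVecAt g q x w) := hG.comp (measurable_unitVecAt g q x)
  have key : ∫⁻ p, G p ∂(((sphereMeasure g x).withDensity fun v =>
      ENNReal.ofReal |g.inner x ν (vecAt I x x v)|).map
      fun v => (⟨x, vecAt I x x v⟩ : TangentBundle I N)) ≤
      n * (ENNReal.ofReal (√ (gramAt g x).det) * ∫⁻ v in A ⁻¹' B, G (unitVecAt g q x (A v))) := by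
    refine (lintegral_map_le _ _).trans ((lintegral_withDensity_le_lintegral_mul _ hd _).trans ?_)
    rw [sphereMeasure, lintegral_smul_measure, smul_eq_mul]
    refine mul_le_mul_right ((lintegral_map_le _ _).trans ?_) _
    rw [lintegral_smul_measure, smul_eq_mul]
    refine mul_le_mul_right ?_ _
    have hset : {v | 0 < g.inner x (vecAt I x x v) (vecAt I x x v) ∧
        g.inner x (vecAt I x x v) (vecAt I x x v) < 1} = A ⁻¹' B := by
      ext v
      exact and_congr (by rw [← hl]; rfl) (by rw [← hl]; rfl)
    rw [hset]
    refine setLIntegral_mono' hB' fun v hv => ?_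
    -- The flux weight is discarded here, by Cauchy–Schwarz for two unit vectors.
    have h1 : ENNReal.ofReal |g.inner x ν (vecAt I x x
        ((√ (g.inner x (vecAt I x x v) (vecAt I x x v)))⁻¹ • v))| ≤ 1 := by
      refine ENNReal.ofReal_le_one.2 (abs_inner_le_one g hν ?_)
      have hpos : 0 < lengthSq g x x v := by rw [hl]; exact hv.1
      have := lengthSq_smul g x x (√ (lengthSq g x x v))⁻¹ v
      rw [inv_pow, Real.sq_sqrt hpos.le, inv_mul_cancel₀ hpos.ne'] at this
      exact this
    have h2 := hu v
    unfold unitVecAt lengthSq at h2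
    rw [Pi.mul_apply]
    refine (mul_le_mul_left h1 _).trans (le_of_eq ?_)
    rw [one_mul]
    exact congrArg G h2
  refine key.trans (mul_le_mul_right ?_ _)
  -- The sphere measure is written in the chart centred at `x`, which varies with `x`. Passing to
  -- the fixed chart at `q`, the factor `|A.det|` from the density is the Jacobian of the change of
  -- variables.
  have h1 : ENNReal.ofReal (√ (gramAt g x).det) =
      ENNReal.ofReal (√ (gram g x (frame I q x)).det) * ENNReal.ofReal |A.det| := by
    rw [gramAt, hdet, Real.sqrt_mul (sq_nonneg _), Real.sqrt_sq_eq_abs,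
      ENNReal.ofReal_mul (abs_nonneg _), mul_comm]
  have h2 : ∫⁻ v in A ⁻¹' B, G (unitVecAt g q x (A v)) =
      ∫⁻ v, B.indicator (fun w => G (unitVecAt g q x w)) (A v) := by
    rw [← lintegral_indicator hB']
    rfl
  rw [h1, h2, mul_assoc, lintegral_comp_linearMap volume A hA (hGu.indicator hB),
    lintegral_indicator hB]
  refine mul_le_mul_right (setLIntegral_ball_le_shell volume (by simpa using hn)
    (continuous_lengthSq g q x).measurable (lengthSq_smul g q x) hs hs1 hGu fun c w hc => ?_) _
  rw [unitVecAt_smul g q x hc]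

end Sphere

/-! ### Borel measurability of families of geodesics -/

lemma measurableSet_of_isSigmaCompact {X : Type*} [TopologicalSpace X] [T2Space X]
    [MeasurableSpace X] [OpensMeasurableSpace X] {s : Set X} (hs : IsSigmaCompact s) :
    MeasurableSet s := by
  obtain ⟨K, hK, rfl⟩ := hs
  exact MeasurableSet.iUnion fun k => (hK k).isClosed.measurableSet

lemma isSigmaCompact_of_isOpen {X : Type*} [TopologicalSpace X] [LocallyCompactSpace X]
    [SecondCountableTopology X] {s : Set X} (hs : IsOpen s) : IsSigmaCompact s := by
  have := hs.locallyCompactSpace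
  rw [isSigmaCompact_iff_sigmaCompactSpace]
  infer_instance

lemma measurable_indicator_comp_of_continuousOn {X Y Z : Type*} [TopologicalSpace X]
    [MeasurableSpace X] [OpensMeasurableSpace X] [TopologicalSpace Y] [MeasurableSpace Y]
    [BorelSpace Y] [MeasurableSpace Z] [Zero Z] {f : X → Y} {s : Set X} (hf : ContinuousOn f s)
    (hs : MeasurableSet s) {Φ : Y → Z} (hΦ : Measurable Φ) :
    Measurable (s.indicator fun x => Φ (f x)) := by
  have h0 : Measurable fun x : s => Φ (f x) :=
    hΦ.comp (continuousOn_iff_continuous_domRestrict.1 hf).measurable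
  refine measurable_of_measurable_union_cover _ _ hs hs.compl (by simp) ?_ ?_
  · convert h0 using 2 with x
    rw [indicator_of_mem x.2]
  · convert (measurable_const : Measurable fun _ : ↥sᶜ => (0 : Z)) using 2 with x
    rw [indicator_of_notMem x.2]

section Bundle

variable {n : ℕ} {H : Type*} [TopologicalSpace H]
  {I : ModelWithCorners ℝ (EuclideanSpace ℝ (Fin n)) H}
  {N : Type*} [TopologicalSpace N] [ChartedSpace H N] [IsManifold I ∞ N]

lemma continuousOn_mk_vecAt (q : N) :
    ContinuousOn (fun a : N × EuclideanSpace ℝ (Fin n) =>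
      (⟨a.1, vecAt I q a.1 a.2⟩ : TangentBundle I N)) ((chartAt H q).source ×ˢ univ) := by
  have h := (trivializationAt (EuclideanSpace ℝ (Fin n))
    (TangentSpace I : N → Type _) q).continuousOn_symm
  refine h.congr fun a ha => ?_
  have ha' : a.1 ∈ (trivializationAt (EuclideanSpace ℝ (Fin n))
    (TangentSpace I : N → Type _) q).baseSet := ha.1
  simp only [vecAt, Bundle.TotalSpace.mk']
  congr 1
  exact Bundle.Trivialization.symmL_apply _ ha' _

lemma continuousOn_inner {X : Type*} [TopologicalSpace X] (g : Metric I N) {b : X → N} {s : Set X}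
    {v w : ∀ a, TangentSpace I (b a)}
    (hv : ContinuousOn (fun a => (⟨b a, v a⟩ : TangentBundle I N)) s)
    (hw : ContinuousOn (fun a => (⟨b a, w a⟩ : TangentBundle I N)) s) :
    ContinuousOn (fun a => g.inner (b a) (v a) (w a)) s := by
  have hb : ContinuousOn b s :=
    (FiberBundle.continuous_proj (EuclideanSpace ℝ (Fin n))
      (TangentSpace I : N → Type _)).comp_continuousOn hv
  have : ContinuousOn (fun m ↦ Bundle.TotalSpace.mk' ℝ (E := Bundle.Trivial N ℝ) (b m)
      (g.inner (b m) (v m) (w m))) s :=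
    (g.contMDiff.continuous.comp_continuousOn hb).clm_bundle_apply₂
      (F₁ := EuclideanSpace ℝ (Fin n)) (F₂ := EuclideanSpace ℝ (Fin n)) hv hw
  intro x hx
  have h := this x hx
  simp only [FiberBundle.continuousWithinAt_totalSpace] at h
  exact h.2

lemma continuous_inner_self (g : Metric I N) :
    Continuous fun p : TangentBundle I N => g.inner p.proj p.snd p.snd := by
  rw [← continuousOn_univ]
  exact continuousOn_inner g continuousOn_id continuousOn_id

lemma continuousOn_gram_frame (g : Metric I N) (q : N) (i j : Fin n) :
    ContinuousOn (fun x => gram g x (frame I q x) i j) (chartAt H q).source := by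
  have h : ∀ i, ContinuousOn (fun x => (⟨x, frame I q x i⟩ : TangentBundle I N))
      (chartAt H q).source := fun i =>
    (continuousOn_mk_vecAt q).comp (f := fun x => (x, EuclideanSpace.single i (1 : ℝ)))
      (by fun_prop) fun x hx => ⟨hx, mem_univ _⟩
  exact continuousOn_inner g (h i) (h j)

/-- Vectors at different points are separated by their base points, vectors at the same point in a
trivialisation. The Hausdorff property makes compact sets of vectors closed, hence Borel. -/
instance t2Space_tangentBundle [T2Space N] : T2Space (TangentBundle I N) := by
  refine ⟨fun p p' hne => ?_⟩
  by_cases h : p.proj = p'.proj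
  · set e := trivializationAt (EuclideanSpace ℝ (Fin n)) (TangentSpace I : N → Type _) p.proj
    have hp : p ∈ e.source := e.mem_source.2 (mem_chart_source H _)
    have hp' : p' ∈ e.source := e.mem_source.2 (by rw [← h]; exact mem_chart_source H _)
    obtain ⟨U, V, hU, hV, hpU, hpV, hUV⟩ := t2_separation fun hh => hne (e.injOn hp hp' hh)
    refine ⟨e.source ∩ e ⁻¹' U, e.source ∩ e ⁻¹' V,
      e.continuousOn.isOpen_inter_preimage e.open_source hU,
      e.continuousOn.isOpen_inter_preimage e.open_source hV, ⟨hp, hpU⟩, ⟨hp', hpV⟩, ?_⟩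
    exact (hUV.preimage e).mono inter_subset_right inter_subset_right
  · obtain ⟨U, V, hU, hV, hpU, hpV, hUV⟩ := t2_separation h
    have hc := FiberBundle.continuous_proj (EuclideanSpace ℝ (Fin n))
      (TangentSpace I : N → Type _)
    exact ⟨_, _, hU.preimage hc, hV.preimage hc, hpU, hpV, hUV.preimage _⟩

section Family

variable {d : ℕ} {S : Type*} [TopologicalSpace S] [ChartedSpace (EuclideanSpace ℝ (Fin d)) S]
  [IsManifold (𝓡 d) ∞ S] {g : Metric I N} {M : Set N} {ι : S → N}
  {ℋ : Set (TangentBundle I N)} {lm lp : TangentBundle I N → ℝ}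
  {γ : TangentBundle I N → ℝ → TangentBundle I N}

/-- An embedded hypersurface need not be closed, so neither need the set of its tangent vectors. It
is still σ-compact, as a countable union of continuous images of open sets of coordinates; this
gives the measurability of the transversal vectors. -/
lemma isSigmaCompact_range_tangentMap [SecondCountableTopology N]
    (hι : IsInteriorEmbedding (d := d) I ι) : IsSigmaCompact (range (tangentMap (𝓡 d) I ι)) := by
  have : SecondCountableTopology S := hι.isEmbedding.secondCountableTopology
  have hc : Continuous (tangentMap (𝓡 d) I ι) :=
    hι.contMDiff.continuous_tangentMap (by norm_cast)
  obtain ⟨s, hs, hcov⟩ := TopologicalSpace.countable_cover_nhds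
    fun z : S => chart_source_mem_nhds (EuclideanSpace ℝ (Fin d)) z
  have h1 : ∀ z : S, IsSigmaCompact ((tangentMap (𝓡 d) I ι ∘ coordsSymm (𝓡 d) z) ''
      (coordTarget (𝓡 d) z ×ˢ univ)) := fun z =>
    (isSigmaCompact_of_isOpen (isOpen_coordTarget_prod z)).image_of_continuousOn
      (hc.comp_continuousOn (continuousOn_coordsSymm z))
  have h2 : range (tangentMap (𝓡 d) I ι) = ⋃ z ∈ s, (tangentMap (𝓡 d) I ι ∘ coordsSymm (𝓡 d) z) ''
      (coordTarget (𝓡 d) z ×ˢ univ) := by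
    refine Subset.antisymm ?_ (iUnion₂_subset fun z _ => ?_)
    · rintro _ ⟨p, rfl⟩
      have hp : p.proj ∈ ⋃ z ∈ s, (chartAt (EuclideanSpace ℝ (Fin d)) z).source := by
        rw [hcov]; trivial
      obtain ⟨z, hz, hpz⟩ := mem_iUnion₂.1 hp
      have hd : p ∈ coordDomain (𝓡 d) z :=
        ⟨hpz, by rw [ModelWithCorners.interior_eq_univ]; trivial⟩
      refine mem_iUnion₂.2 ⟨z, hz, coords (𝓡 d) z p, coords_mem hd, ?_⟩
      rw [Function.comp_apply, coordsSymm_coords hd]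
    · rintro _ ⟨a, _, rfl⟩
      exact mem_range_self _
  rw [h2]
  exact isSigmaCompact_biUnion hs fun z _ => h1 z

lemma measurableSet_transversalVectors [T2Space N] [SecondCountableTopology N]
    (hι : IsInteriorEmbedding (d := d) I ι) :
    MeasurableSet (transversalVectors (d := d) g ι) := by
  borelize N
  have : SecondCountableTopology S := hι.isEmbedding.secondCountableTopology
  have : LocallyCompactSpace S := ChartedSpace.locallyCompactSpace (EuclideanSpace ℝ (Fin d)) S
  have h1 : MeasurableSet (range ι) :=
    measurableSet_of_isSigmaCompact (isSigmaCompact_range hι.contMDiff.continuous)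
  have h2 := measurableSet_of_isSigmaCompact (isSigmaCompact_range_tangentMap hι)
  have hc : Continuous fun p : TangentBundle I N => p.proj :=
    FiberBundle.continuous_proj (EuclideanSpace ℝ (Fin n)) (TangentSpace I : N → Type _)
  have h3 : MeasurableSet {p : TangentBundle I N | g.inner p.proj p.snd p.snd = 1} :=
    (isClosed_eq (continuous_inner_self g) continuous_const).measurableSet
  convert ((hc.measurable h1).inter h3).diff h2 using 1
  ext p
  constructor
  · rintro ⟨z, θ, rfl, hθ, hn⟩
    refine ⟨⟨mem_range_self z, hθ⟩, ?_⟩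
    rintro ⟨⟨z', w⟩, hw⟩
    have hz : z' = z := hι.isEmbedding.injective (congrArg Bundle.TotalSpace.proj hw)
    subst hz
    refine hn ⟨w, ?_⟩
    exact eq_of_heq (Bundle.TotalSpace.mk.inj hw).2
  · rintro ⟨⟨⟨z, hz⟩, h1⟩, hn⟩
    obtain ⟨x, θ⟩ := p
    simp only at hz
    subst hz
    exact ⟨z, θ, rfl, h1, fun ⟨w, hw⟩ => hn ⟨⟨z, w⟩, by rw [← hw]; rfl⟩⟩

variable [T2Space N] [SecondCountableTopology N]

lemma IsGeodesicFamily.measurableSet (hF : IsGeodesicFamily (d := d) g M ι ℋ lm lp γ)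
    (hι : IsInteriorEmbedding (d := d) I ι) : MeasurableSet ℋ := by
  obtain ⟨U, hU, rfl⟩ := hF.isOpen
  exact hU.measurableSet.inter (measurableSet_transversalVectors hι)

lemma IsGeodesicFamily.measurableSet_halfDomain
    (hF : IsGeodesicFamily (d := d) g M ι ℋ lm lp γ)
    (hι : IsInteriorEmbedding (d := d) I ι) (ε : ℝ) :
    MeasurableSet (halfDomain ℋ lm lp ε) := by
  classical
  have hℋ := hF.measurableSet hι
  have h1 : Measurable (ℋ.piecewise lm fun _ => 0) :=
    hF.continuousOn_lm.measurable_piecewise continuousOn_const hℋ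
  have h2 : Measurable (ℋ.piecewise lp fun _ => 0) :=
    hF.continuousOn_lp.measurable_piecewise continuousOn_const hℋ
  have h3 : MeasurableSet {x : TangentBundle I N × ℝ | x.1 ∈ ℋ ∧ 0 ≤ x.2 ∧
      (ℋ.piecewise lm fun _ => 0) x.1 ≤ ε * x.2 ∧ ε * x.2 ≤ (ℋ.piecewise lp fun _ => 0) x.1} := by
    refine (measurable_fst hℋ).inter ((measurableSet_le measurable_const measurable_snd).inter
      ((measurableSet_le (h1.comp measurable_fst) (measurable_snd.const_mul ε)).inter
      (measurableSet_le (measurable_snd.const_mul ε) (h2.comp measurable_fst))))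
  convert h3 using 1
  ext x
  refine and_congr_right fun hx => and_congr_right fun _ => ?_
  rw [piecewise_eq_of_mem _ _ _ hx, piecewise_eq_of_mem _ _ _ hx]
  rfl

/-- Integrands along a half of the geodesics of a family are jointly measurable. -/
lemma IsGeodesicFamily.measurable_indicator {Y : Type*} [MeasurableSpace Y] [Zero Y]
    (hF : IsGeodesicFamily (d := d) g M ι ℋ lm lp γ)
    (hι : IsInteriorEmbedding (d := d) I ι) {ε : ℝ} (hε : ε ≠ 0) {Φ : TangentBundle I N → Y}
    (hΦ : Measurable Φ) {A : Set (TangentBundle I N × ℝ)} (hA : MeasurableSet A) :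
    Measurable ((A ∩ halfDomain ℋ lm lp ε).indicator fun x => Φ (γ x.1 (ε * x.2))) := by
  rw [← indicator_indicator]
  exact (measurable_indicator_comp_of_continuousOn (hF.continuousOn_halfDomain hι hε)
    (hF.measurableSet_halfDomain hι ε) hΦ).indicator hA

end Family

end Bundle

/-- For a kernel that is not almost everywhere measurable, `Measure.bind` is zero by convention and
the inequality is trivial. Hence the dependence of the sphere measures on the base point never has
to be shown measurable. -/
lemma lintegral_bind_le {X Y : Type*} [MeasurableSpace X] [MeasurableSpace Y] (μ : Measure X)
    (κ : X → Measure Y) {f : Y → ENNReal} (hf : Measurable f) :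
    ∫⁻ y, f y ∂(μ.bind κ) ≤ ∫⁻ x, ∫⁻ y, f y ∂(κ x) ∂μ := by
  by_cases h : AEMeasurable κ μ
  · exact (Measure.lintegral_bind h hf.aemeasurable).le
  · rw [Measure.bind, Measure.map_of_not_aemeasurable h, Measure.join_zero, lintegral_zero_measure]
    exact zero_le

/-! ### Flux measure and time in homogeneous coordinates -/

section Shell

variable {n : ℕ} {H : Type*} [TopologicalSpace H]
  {I : ModelWithCorners ℝ (EuclideanSpace ℝ (Fin n)) H}
  {N : Type*} [TopologicalSpace N] [ChartedSpace H N] [IsManifold I ∞ N]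
  {d : ℕ} {S : Type*} [TopologicalSpace S] [ChartedSpace (EuclideanSpace ℝ (Fin d)) S]
  [IsManifold (𝓡 d) ∞ S] {g : Metric I N} {M : Set N} {ι : S → N}

/-- The domain on which `ι`, in the chart centred at `z₀`, takes values in the chart centred
at `q`. -/
def paramDomain (H : Type*) [TopologicalSpace H] {N : Type*} [TopologicalSpace N]
    [ChartedSpace H N] {d : ℕ} {S : Type*} [TopologicalSpace S]
    [ChartedSpace (EuclideanSpace ℝ (Fin d)) S] (ι : S → N) (z₀ : S) (q : N) :
    Set (EuclideanSpace ℝ (Fin d)) :=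
  (extChartAt (𝓡 d) z₀).target ∩
    (fun u => ι ((extChartAt (𝓡 d) z₀).symm u)) ⁻¹' (chartAt H q).source

/-- The squared length of a vector at a point of a hypersurface, in coordinates. -/
def paramLengthSq (g : Metric I N) (ι : S → N) (z₀ : S) (q : N)
    (a : EuclideanSpace ℝ (Fin d) × EuclideanSpace ℝ (Fin n) × ℝ) : ℝ :=
  lengthSq g q (ι ((extChartAt (𝓡 d) z₀).symm a.1)) a.2.1

/-- The unit vector over a point of a hypersurface and the time with given (homogeneous)
coordinates. -/
def paramShell (g : Metric I N) (ι : S → N) (z₀ : S) (q : N)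
    (a : EuclideanSpace ℝ (Fin d) × EuclideanSpace ℝ (Fin n) × ℝ) : TangentBundle I N × ℝ :=
  (unitVecAt g q (ι ((extChartAt (𝓡 d) z₀).symm a.1)) a.2.1, √ (paramLengthSq g ι z₀ q a) * a.2.2)

/-- The vectors with squared length in `(1, s⁻²]`. -/
def shellDomain (g : Metric I N) (ι : S → N) (z₀ : S) (q : N) (s : ℝ) :
    Set (EuclideanSpace ℝ (Fin d) × EuclideanSpace ℝ (Fin n) × ℝ) :=
  {a | a.1 ∈ paramDomain H ι z₀ q} ∩ paramLengthSq g ι z₀ q ⁻¹' Ioc 1 (s ^ 2)⁻¹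

lemma continuousOn_param (hι : ContMDiff (𝓡 d) I ∞ ι) (z₀ : S) :
    ContinuousOn (fun u => ι ((extChartAt (𝓡 d) z₀).symm u)) (extChartAt (𝓡 d) z₀).target :=
  hι.continuous.comp_continuousOn (continuousOn_extChartAt_symm z₀)

lemma isOpen_paramDomain (hι : ContMDiff (𝓡 d) I ∞ ι) (z₀ : S) (q : N) :
    IsOpen (paramDomain (d := d) H ι z₀ q) :=
  (continuousOn_param hι z₀).isOpen_inter_preimage (isOpen_extChartAt_target z₀)
    (chartAt H q).open_source

lemma continuousOn_paramLengthSq (g : Metric I N) (hι : ContMDiff (𝓡 d) I ∞ ι) (z₀ : S) (q : N) :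
    ContinuousOn (paramLengthSq (d := d) g ι z₀ q) {a | a.1 ∈ paramDomain (d := d) H ι z₀ q} := by
  have h : ContinuousOn (fun a : EuclideanSpace ℝ (Fin d) × EuclideanSpace ℝ (Fin n) × ℝ =>
      (⟨ι ((extChartAt (𝓡 d) z₀).symm a.1),
        vecAt I q (ι ((extChartAt (𝓡 d) z₀).symm a.1)) a.2.1⟩ : TangentBundle I N))
      {a | a.1 ∈ paramDomain (d := d) H ι z₀ q} :=
    (continuousOn_mk_vecAt q).comp
      (f := fun a : EuclideanSpace ℝ (Fin d) × EuclideanSpace ℝ (Fin n) × ℝ =>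
        (ι ((extChartAt (𝓡 d) z₀).symm a.1), a.2.1))
      (((continuousOn_param hι z₀).comp continuousOn_fst fun a ha => ha.1).prodMk (by fun_prop))
      fun a ha => ⟨ha.2, mem_univ _⟩
  exact continuousOn_inner g h h

lemma continuousOn_paramShell (g : Metric I N) (hι : ContMDiff (𝓡 d) I ∞ ι) (z₀ : S) (q : N)
    (s : ℝ) : ContinuousOn (paramShell (d := d) g ι z₀ q) (shellDomain (d := d) g ι z₀ q s) := by
  have hL : ContinuousOn (fun a => √ (paramLengthSq (d := d) g ι z₀ q a)) (shellDomain (d := d) g ι z₀ q s) :=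
    ((continuousOn_paramLengthSq g hι z₀ q).mono inter_subset_left).sqrt
  have hL0 : ∀ a ∈ shellDomain (d := d) g ι z₀ q s, √ (paramLengthSq (d := d) g ι z₀ q a) ≠ 0 := fun a ha =>
    (Real.sqrt_pos.2 (one_pos.trans ha.2.1)).ne'
  refine ContinuousOn.prodMk ?_ (hL.mul (by fun_prop))
  exact (continuousOn_mk_vecAt q).comp
    (f := fun a : EuclideanSpace ℝ (Fin d) × EuclideanSpace ℝ (Fin n) × ℝ =>
      (ι ((extChartAt (𝓡 d) z₀).symm a.1), (√ (paramLengthSq (d := d) g ι z₀ q a))⁻¹ • a.2.1))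
    (((continuousOn_param hι z₀).comp continuousOn_fst fun a ha => ha.1.1).prodMk
      ((hL.inv₀ hL0).smul (by fun_prop))) fun a ha => ⟨ha.1.2, mem_univ _⟩

lemma measurableSet_shellDomain (g : Metric I N) (hι : ContMDiff (𝓡 d) I ∞ ι) (z₀ : S) (q : N)
    (s : ℝ) : MeasurableSet (shellDomain (d := d) g ι z₀ q s) :=
  measurableSet_inter_preimage_of_continuousOn (continuousOn_paramLengthSq g hι z₀ q)
    (measurable_fst (isOpen_paramDomain hι z₀ q).measurableSet) measurableSet_Ioc

/-- Integrals with respect to the flux measure and time are controlled by integrals over a shell of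
(homogeneous) coordinates. -/
theorem exists_lintegral_fluxMeasure_le [MeasurableSpace S] [BorelSpace S] (hn : 1 ≤ n)
    (hι : IsInteriorEmbedding (d := d) I ι) {ν : ∀ z : S, TangentSpace I (ι z)}
    (hν : IsUnitNormal (d := d) g ι ν) (z₀ : S) {s : ℝ} (hs : 0 < s) (hs1 : s < 1) :
    ∃ V ∈ 𝓝 (ι z₀), ∃ C : ENNReal, C ≠ ⊤ ∧ ∀ Φ : TangentBundle I N × ℝ → ENNReal,
      Measurable Φ → (∀ x, Φ x ≠ 0 → x.1.proj ∈ V) →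
      ∫⁻ p, (∫⁻ t, Φ (p, t)) ∂(fluxMeasure (d := d) g ι ν) ≤
        C * ∫⁻ a, (shellDomain (d := d) g ι z₀ (ι z₀) s).indicator
          (fun a => Φ (paramShell (d := d) g ι z₀ (ι z₀) a)) a := by
  obtain ⟨r, hr, C₁, hC₁, hvol⟩ := exists_lintegral_volumeOf_le g hι z₀
  have hA : {z | z ∈ (chartAt (EuclideanSpace ℝ (Fin d)) z₀).source ∧
      dist (extChartAt (𝓡 d) z₀ z) (extChartAt (𝓡 d) z₀ z₀) < r} ∈ 𝓝 z₀ :=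
    inter_mem (chart_source_mem_nhds _ _) ((continuousAt_extChartAt z₀) (Metric.ball_mem_nhds _ hr))
  rw [hι.isEmbedding.nhds_eq_comap, mem_comap] at hA
  obtain ⟨B, hB, hBA⟩ := hA
  set q := ι z₀ with hq
  have hdet : ContinuousAt (fun x => √ (gram g x (frame I q x)).det) q := by
    refine ContinuousAt.sqrt (continuous_id.matrix_det.continuousAt.comp ?_)
    exact continuousAt_pi.2 fun i => continuousAt_pi.2 fun j =>
      (continuousOn_gram_frame g q i j).continuousAt (chart_source_mem_nhds H q)
  obtain ⟨D, hD⟩ : ∃ D, ∀ᶠ x in 𝓝 q, √ (gram g x (frame I q x)).det < D :=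
    ⟨_, hdet.eventually (gt_mem_nhds (lt_add_one _))⟩
  refine ⟨B ∩ ((chartAt H q).source ∩ {x | √ (gram g x (frame I q x)).det < D}),
    inter_mem hB (inter_mem (chart_source_mem_nhds H q) hD),
    C₁ * (n * (ENNReal.ofReal D * ((1 - ENNReal.ofReal s)⁻¹ * ENNReal.ofReal s⁻¹))), ?_,
    fun Φ hΦ hΦV => ?_⟩
  · have h1 : (1 - ENNReal.ofReal s)⁻¹ ≠ ⊤ := by
      rw [ENNReal.inv_ne_top, ← ENNReal.ofReal_one, ← ENNReal.ofReal_sub _ hs.le]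
      simpa using hs1
    exact ENNReal.mul_ne_top hC₁ (ENNReal.mul_ne_top (ENNReal.natCast_ne_top n)
      (ENNReal.mul_ne_top ENNReal.ofReal_ne_top (ENNReal.mul_ne_top h1 ENNReal.ofReal_ne_top)))
  set C₂ : ENNReal := n * (ENNReal.ofReal D * ((1 - ENNReal.ofReal s)⁻¹ * ENNReal.ofReal s⁻¹))
  set G : TangentBundle I N → ENNReal := fun p => ∫⁻ t, Φ (p, t)
  have hG : Measurable G := hΦ.lintegral_prod_right'
  have hGV : ∀ p, G p ≠ 0 → p.proj ∈ B ∩ ((chartAt H q).source ∩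
      {x | √ (gram g x (frame I q x)).det < D}) := fun p hp => by
    by_contra h
    refine hp ?_
    have : ∀ t, Φ (p, t) = 0 := fun t => by
      by_contra h'
      exact h (hΦV _ h')
    simp [G, this]
  set F : S → ENNReal := fun z => ∫⁻ p, G p ∂(((sphereMeasure g (ι z)).withDensity fun v =>
      ENNReal.ofReal |g.inner (ι z) (ν z) (vecAt I (ι z) (ι z) v)|).map
      fun v => (⟨ι z, vecAt I (ι z) (ι z) v⟩ : TangentBundle I N))
  have hFV : ∀ z, F z ≠ 0 → ι z ∈ B ∩ ((chartAt H q).source ∩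
      {x | √ (gram g x (frame I q x)).det < D}) := fun z hz => by
    by_contra h
    refine hz (le_antisymm ((lintegral_map_le _ _).trans (le_of_eq ?_)) zero_le)
    have : ∀ v, G (⟨ι z, vecAt I (ι z) (ι z) v⟩ : TangentBundle I N) = 0 := fun v => by
      by_contra h'
      exact h (hGV _ h')
    simp [this]
  set Ψ := (shellDomain (d := d) g ι z₀ q s).indicator fun a => Φ (paramShell (d := d) g ι z₀ q a)
  have hΨ : Measurable Ψ := measurable_indicator_comp_of_continuousOn
    (continuousOn_paramShell g hι.contMDiff z₀ q s)
    (measurableSet_shellDomain g hι.contMDiff z₀ q s) hΦ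
  have hFu : ∀ u ∈ (extChartAt (𝓡 d) z₀).target, F ((extChartAt (𝓡 d) z₀).symm u) ≤
      C₂ * ∫⁻ w, ∫⁻ t, Ψ (u, w, t) := fun u hu => by
    by_cases h0 : F ((extChartAt (𝓡 d) z₀).symm u) = 0
    · rw [h0]; exact zero_le
    obtain ⟨-, hxq, hxD⟩ := hFV _ h0
    set x := ι ((extChartAt (𝓡 d) z₀).symm u)
    refine (lintegral_sphereMeasure_le hn g hxq (hν _).1 hs hs1 hG).trans ?_
    have hshell : MeasurableSet {w | 1 < lengthSq g q x w ∧ lengthSq g q x w ≤ (s ^ 2)⁻¹} :=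
      (measurableSet_lt measurable_const (continuous_lengthSq g q x).measurable).inter
        (measurableSet_le (continuous_lengthSq g q x).measurable measurable_const)
    have h1 : ∫⁻ w in {w | 1 < lengthSq g q x w ∧ lengthSq g q x w ≤ (s ^ 2)⁻¹},
        G (unitVecAt g q x w) ≤ ENNReal.ofReal s⁻¹ * ∫⁻ w, ∫⁻ t, Ψ (u, w, t) := by
      rw [← lintegral_const_mul' _ _ ENNReal.ofReal_ne_top, ← lintegral_indicator hshell]
      refine lintegral_mono fun w => ?_
      by_cases hw : w ∈ {w | 1 < lengthSq g q x w ∧ lengthSq g q x w ≤ (s ^ 2)⁻¹}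
      · rw [indicator_of_mem hw]
        have hpos : 0 < √ (lengthSq g q x w) := Real.sqrt_pos.2 (one_pos.trans hw.1)
        have hle : √ (lengthSq g q x w) ≤ s⁻¹ :=
          Real.sqrt_le_iff.2 ⟨(inv_pos.2 hs).le, by rw [inv_pow]; exact hw.2⟩
        -- Substitution `t = |w| τ`: along the geodesic with initial velocity `w` the time is `τ`.
        -- The Jacobian `|w|` is at most `s⁻¹` on the shell.
        have h2 := lintegral_eq_mul_lintegral_comp_smul (volume : Measure ℝ) hpos
          (F := fun t => Φ (unitVecAt g q x w, t)) (hΦ.comp measurable_prodMk_left)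
        rw [Module.finrank_self, pow_one] at h2
        refine h2.le.trans (mul_le_mul' (ENNReal.ofReal_le_ofReal hle) (lintegral_mono fun t => ?_))
        have hmem : (u, w, t) ∈ shellDomain (d := d) g ι z₀ q s := ⟨⟨hu, hxq⟩, hw⟩
        simp only [Ψ]
        rw [indicator_of_mem hmem]
        exact le_rfl
      · rw [indicator_of_notMem hw]; exact zero_le
    calc _ ≤ (n : ENNReal) * (ENNReal.ofReal D * ((1 - ENNReal.ofReal s)⁻¹ *
          (ENNReal.ofReal s⁻¹ * ∫⁻ w, ∫⁻ t, Ψ (u, w, t)))) := by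
          gcongr
          exact le_of_lt hxD
      _ = _ := by simp only [C₂]; ring
  calc ∫⁻ p, G p ∂(fluxMeasure (d := d) g ι ν) ≤ ∫⁻ z, F z ∂(volumeOf g (𝓡 d) ι) :=
        lintegral_bind_le _ _ hG
    _ ≤ C₁ * ∫⁻ u in (extChartAt (𝓡 d) z₀).target, F ((extChartAt (𝓡 d) z₀).symm u) :=
        hvol F fun z hz => hBA (hFV z hz).1
    _ ≤ C₁ * ∫⁻ u, C₂ * ∫⁻ w, ∫⁻ t, Ψ (u, w, t) := by
        refine mul_le_mul_right ?_ _
        exact (setLIntegral_mono' (measurableSet_extChartAt_target (𝓡 d) z₀) hFu).trans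
          (setLIntegral_le_lintegral _ _)
    _ = C₁ * C₂ * ∫⁻ a, Ψ a := by
        have h1 : ∀ u, ∫⁻ w, ∫⁻ t, Ψ (u, w, t) = ∫⁻ b, Ψ (u, b) := fun u => by
          exact (lintegral_prod _ (hΨ.comp (measurable_prodMk_left (x := u))).aemeasurable).symm
        simp only [h1]
        rw [lintegral_const_mul _ hΨ.lintegral_prod_right', ← mul_assoc]
        congr 1
        exact (lintegral_prod _ hΨ.aemeasurable).symm

end Shell

/-! ### The local `L¹` estimate -/

section Local

variable {n : ℕ} {H : Type*} [TopologicalSpace H]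
  {I : ModelWithCorners ℝ (EuclideanSpace ℝ (Fin n)) H}
  {N : Type*} [TopologicalSpace N] [ChartedSpace H N] [IsManifold I ∞ N]
  {d : ℕ} {S : Type*} [TopologicalSpace S] [ChartedSpace (EuclideanSpace ℝ (Fin d)) S]
  [IsManifold (𝓡 d) ∞ S] {g : Metric I N} {M : Set N} {ι : S → N}
  {ℋ : Set (TangentBundle I N)} {lm lp : TangentBundle I N → ℝ}
  {γ : TangentBundle I N → ℝ → TangentBundle I N}

/-- Functions of position, integrated over a bounded set of vectors. -/
lemma exists_lintegral_comp_fst_le [MeasurableSpace N] [BorelSpace N] (g : Metric I N) (q : N)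
    {b : EuclideanSpace ℝ (Fin n) × EuclideanSpace ℝ (Fin n)} (hb : b.1 ∈ coordTarget I q) :
    ∃ r > 0, ∃ C : ENNReal, C ≠ ⊤ ∧ ∀ φ : N → ENNReal, Measurable φ →
      ∃ ψ : EuclideanSpace ℝ (Fin n) × EuclideanSpace ℝ (Fin n) → ENNReal, Measurable ψ ∧
      (∀ a, dist a b < r → ψ a = φ ((extChartAt I q).symm a.1)) ∧
      ∫⁻ a, ψ a ≤ C * ∫⁻ x, φ x ∂(vol g) := by
  obtain ⟨r₁, hr₁, C, hC, hφ⟩ := exists_setLIntegral_le_vol g q hb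
  obtain ⟨r₂, hr₂, hsub⟩ := Metric.isOpen_iff.1 (isOpen_coordTarget (I := I) q) _ hb
  set r := min r₁ r₂
  have hB : ∀ y : EuclideanSpace ℝ (Fin n), MeasurableSet (Metric.ball y r) := fun y =>
    Metric.isOpen_ball.measurableSet
  refine ⟨r, lt_min hr₁ hr₂, C * volume (Metric.ball b.2 r),
    ENNReal.mul_ne_top hC measure_ball_lt_top.ne, fun φ hm => ?_⟩
  set ψ₁ := (Metric.ball b.1 r).indicator fun y => φ ((extChartAt I q).symm y)
  set ψ₂ := (Metric.ball b.2 r).indicator fun _ => (1 : ENNReal)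
  have h₁ : Measurable ψ₁ := measurable_indicator_comp_of_continuousOn
    ((continuousOn_extChartAt_symm q).mono fun y hy =>
      interior_subset (hsub (Metric.ball_subset_ball (min_le_right _ _) hy))) (hB _) hm
  have h₂ : Measurable ψ₂ := measurable_const.indicator (hB _)
  -- Cutting off to a ball in the velocities costs only its finite volume as a factor.
  refine ⟨fun a => ψ₁ a.1 * ψ₂ a.2, (h₁.comp measurable_fst).mul (h₂.comp measurable_snd),
    fun a ha => ?_, ?_⟩
  · have h := max_lt_iff.1 ha
    simp only [ψ₁, ψ₂]
    rw [indicator_of_mem (by exact h.1), indicator_of_mem (by exact h.2), mul_one]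
  · rw [Measure.volume_eq_prod, lintegral_prod_mul h₁.aemeasurable h₂.aemeasurable,
      lintegral_indicator (hB _), lintegral_indicator (hB _), setLIntegral_one, mul_right_comm]
    refine mul_le_mul_left ?_ _
    exact (lintegral_mono_set (Metric.ball_subset_ball (min_le_left _ _))).trans (hφ φ hm)

variable [T2Space N] [SecondCountableTopology N] [MeasurableSpace N] [BorelSpace N]
  [MeasurableSpace S] [BorelSpace S]

/-- The local form of the boundedness of the X-ray transform on nonnegative functions. -/
theorem IsGeodesicFamily.exists_local_lintegral_le
    (hF : IsGeodesicFamily (d := d) g M ι ℋ lm lp γ) (hι : IsInteriorEmbedding (d := d) I ι)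
    {ν : ∀ z : S, TangentSpace I (ι z)} (hν : IsUnitNormal (d := d) g ι ν) (hn : n = d + 1)
    {ε : ℝ} (hε : ε ≠ 0) {x₀ : TangentBundle I N × ℝ} (hx₀ : x₀ ∈ halfDomain ℋ lm lp ε) :
    ∃ A : Set (TangentBundle I N × ℝ), IsOpen A ∧ x₀ ∈ A ∧ ∃ C : ENNReal, C ≠ ⊤ ∧
      ∀ φ : N → ENNReal, Measurable φ →
        ∫⁻ p, (∫⁻ t, (A ∩ halfDomain ℋ lm lp ε).indicator
          (fun x => φ (γ x.1 (ε * x.2)).proj) (p, t)) ∂(fluxMeasure (d := d) g ι ν) ≤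
        C * ∫⁻ x, φ x ∂(vol g) := by
  obtain ⟨p₀, t₀⟩ := x₀
  obtain ⟨hp₀, ht₀, hεt₀⟩ := hx₀
  simp only at hp₀ ht₀ hεt₀
  obtain ⟨z₀, θ, hpz, -, -⟩ := hF.exists_transversal hp₀
  have hz₀ : p₀.proj = ι z₀ := by rw [hpz]
  have hi := (hF.geodesic p₀ hp₀).mem_interior _ hεt₀
  set q₁ := (scaledCurve γ ε p₀ t₀).proj
  have hq₁ : scaledCurve γ ε p₀ t₀ ∈ coordDomain I q₁ := mem_baseDomain_self hi
  obtain ⟨r₁, hr₁, C₁, hC₁, hφ⟩ := exists_lintegral_comp_fst_le g q₁ (coords_mem hq₁).1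
  set W : Set (TangentBundle I N) := {p | p ∈ coordDomain I q₁ ∧
    dist (coords I q₁ p) (coords I q₁ (scaledCurve γ ε p₀ t₀)) < r₁}
  have hW : W ∈ 𝓝 (scaledCurve γ ε p₀ t₀) :=
    inter_mem ((isOpen_coordDomain q₁).mem_nhds hq₁)
      ((continuousAt_coords hq₁) (Metric.ball_mem_nhds _ hr₁))
  obtain ⟨r, hr, K, hK⟩ := hF.exists_dist_le hι hp₀ hz₀ hε ht₀ hεt₀ hq₁ hW
  set q := ι z₀
  set v₀ := (coords I q p₀).2
  have hd : p₀ ∈ coordDomain I q := by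
    show p₀.proj ∈ baseDomain I (ι z₀)
    rw [hz₀]; exact mem_baseDomain_self (hι.mem_interior z₀)
  -- Stretching a velocity of norm at most `‖v₀‖ + 1`, or contracting a time below `t₀ + 1`, by a
  -- factor `ρ ≤ 1 + η` moves it by at most `η c = r / 2`. So the shell is thin enough to stay
  -- within `r` of the reference data.
  set c := ‖v₀‖ + t₀ + 2
  have hc : 0 < c := by positivity
  set η := r / (2 * c)
  have hη : 0 < η := by positivity
  have hηc : η * c = r / 2 := by simp only [η]; field_simp
  set s := (1 + η)⁻¹
  have hs : 0 < s := by positivity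
  have hs1 : s < 1 := inv_lt_one_of_one_lt₀ (by linarith)
  obtain ⟨V, hV, C₂, hC₂, hflux⟩ :=
    exists_lintegral_fluxMeasure_le (g := g) (by omega) hι hν z₀ hs hs1
  have : ((volume : Measure (EuclideanSpace ℝ (Fin d))).prod
      ((volume : Measure (EuclideanSpace ℝ (Fin n))).prod
        (volume : Measure ℝ))).IsAddHaarMeasure :=
    Measure.prod.instIsAddHaarMeasure _ _
  -- The dimensions agree: `d + (n + 1) = n + n`, because the hypersurface has codimension one.
  obtain ⟨C₃, hC₃, hanti⟩ := exists_setLIntegral_comp_le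
    ((volume : Measure (EuclideanSpace ℝ (Fin d))).prod
      ((volume : Measure (EuclideanSpace ℝ (Fin n))).prod (volume : Measure ℝ)))
    ((volume : Measure (EuclideanSpace ℝ (Fin n))).prod
      (volume : Measure (EuclideanSpace ℝ (Fin n))))
    (by simp [hn]; ring) K
  have hev : ∀ᶠ x in 𝓝 (p₀, t₀), x.1.proj ∈ V ∧ x.1.proj ∈ (chartAt H q).source ∧
      (∀ z, x.1.proj = ι z → z ∈ {z | z ∈ (chartAt (EuclideanSpace ℝ (Fin d)) z₀).source ∧
        dist (extChartAt (𝓡 d) z₀ z) (extChartAt (𝓡 d) z₀ z₀) < r}) ∧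
      dist (coords I q x.1).2 v₀ < min (r / 2) 1 ∧ dist x.2 t₀ < min (r / 2) 1 := by
    have hc : ContinuousAt (fun p : TangentBundle I N => p.proj) p₀ :=
      (FiberBundle.continuous_proj _ _).continuousAt
    have hr' : 0 < min (r / 2) 1 := by positivity
    have e1 : ∀ᶠ p in 𝓝 p₀, p.proj ∈ V := hc (show V ∈ 𝓝 p₀.proj by rwa [hz₀])
    have e2 : ∀ᶠ p in 𝓝 p₀, p.proj ∈ (chartAt H q).source :=
      hc ((chartAt H q).open_source.mem_nhds hd.1)
    have e3 := eventually_of_mem_nhds hι hz₀ (A := {z |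
      z ∈ (chartAt (EuclideanSpace ℝ (Fin d)) z₀).source ∧
      dist (extChartAt (𝓡 d) z₀ z) (extChartAt (𝓡 d) z₀ z₀) < r})
      (inter_mem (chart_source_mem_nhds _ _)
        ((continuousAt_extChartAt z₀) (Metric.ball_mem_nhds _ hr)))
    have e4 : ∀ᶠ p in 𝓝 p₀, dist (coords I q p).2 v₀ < min (r / 2) 1 :=
      (continuousAt_coords hd).snd (Metric.ball_mem_nhds _ hr')
    have e5 : ∀ᶠ t in 𝓝 t₀, dist t t₀ < min (r / 2) 1 := Metric.ball_mem_nhds t₀ hr'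
    rw [nhds_prod_eq]
    exact (e1.prod_inl _).and ((e2.prod_inl _).and ((e3.prod_inl _).and
      ((e4.prod_inl _).and (e5.prod_inr _))))
  obtain ⟨A, hAsub, hA, hxA⟩ := mem_nhds_iff.1 hev
  refine ⟨A, hA, hxA, C₂ * (C₃ * C₁), ENNReal.mul_ne_top hC₂ (ENNReal.mul_ne_top hC₃ hC₁),
    fun φ hm => ?_⟩
  have hproj : Measurable fun p : TangentBundle I N => p.proj :=
    (FiberBundle.continuous_proj (EuclideanSpace ℝ (Fin n))
      (TangentSpace I : N → Type _)).measurable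
  set Φ := (A ∩ halfDomain ℋ lm lp ε).indicator fun x => φ (γ x.1 (ε * x.2)).proj
  have hΦ : Measurable Φ := hF.measurable_indicator hι hε (hm.comp hproj) hA.measurableSet
  refine (hflux Φ hΦ fun x hx => (hAsub (mem_of_indicator_ne_zero hx).1).1).trans ?_
  rw [mul_assoc]
  refine mul_le_mul_right ?_ _
  obtain ⟨ψ, hψ, hψφ, hψC⟩ := hφ φ hm
  set D := shellDomain (d := d) g ι z₀ q s
  -- With `a = (u, w, τ)`, this is the end, at time `τ`, of the geodesic issued from the point with
  -- parameter `u` with initial velocity `ε w`.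
  set f : EuclideanSpace ℝ (Fin d) × EuclideanSpace ℝ (Fin n) × ℝ →
      EuclideanSpace ℝ (Fin n) × EuclideanSpace ℝ (Fin n) := fun a =>
    coords I q₁ (scaledCurve γ (ε * √ (paramLengthSq g ι z₀ q a)) (paramShell g ι z₀ q a).1 a.2.2)
  set D' := D ∩ paramShell g ι z₀ q ⁻¹' (A ∩ halfDomain ℋ lm lp ε)
  have hcs := continuousOn_paramShell g hι.contMDiff z₀ q s
  have hD' : MeasurableSet D' := measurableSet_inter_preimage_of_continuousOn hcs
    (measurableSet_shellDomain g hι.contMDiff z₀ q s)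
    (hA.measurableSet.inter (hF.measurableSet_halfDomain hι ε))
  -- the data of a point of `D'`
  have hdata : ∀ a ∈ D', (paramShell g ι z₀ q a).1 ∈ ℋ ∧
      (extChartAt (𝓡 d) z₀).symm a.1 ∈ (chartAt (EuclideanSpace ℝ (Fin d)) z₀).source ∧
      ι ((extChartAt (𝓡 d) z₀).symm a.1) ∈ (chartAt H q).source ∧
      extChartAt (𝓡 d) z₀ ((extChartAt (𝓡 d) z₀).symm a.1) = a.1 ∧
      dist (extChartAt (𝓡 d) z₀ ((extChartAt (𝓡 d) z₀).symm a.1))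
        (extChartAt (𝓡 d) z₀ z₀) < r ∧
      √ (paramLengthSq g ι z₀ q a) • (coords I q (paramShell g ι z₀ q a).1).2 = a.2.1 ∧
      dist (√ (paramLengthSq g ι z₀ q a) • (coords I q (paramShell g ι z₀ q a).1).2) v₀ < r ∧
      0 ≤ a.2.2 ∧ dist a.2.2 t₀ < r ∧
      ε * √ (paramLengthSq g ι z₀ q a) * a.2.2 ∈ Icc (lm (paramShell g ι z₀ q a).1)
        (lp (paramShell g ι z₀ q a).1) := by
    rintro a ⟨⟨hau, haL⟩, haA, haℋ, hat, haε⟩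
    obtain ⟨-, -, hz, hv, ht⟩ := hAsub haA
    obtain ⟨hz1, hz2⟩ := hz _ rfl
    set ρ := √ (paramLengthSq g ι z₀ q a) with hρ
    have hρ1 : 1 < ρ := by
      rw [hρ, Real.lt_sqrt (by norm_num)]; simpa using haL.1
    have hρ2 : ρ ≤ 1 + η := by
      have : (s ^ 2)⁻¹ = (1 + η) ^ 2 := by simp [s]
      refine Real.sqrt_le_iff.2 ⟨by positivity, this ▸ haL.2⟩
    have hρ0 : 0 < ρ := by linarith
    have hco : (coords I q (paramShell g ι z₀ q a).1).2 = ρ⁻¹ • a.2.1 := by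
      have := coords_mk_vecAt (I := I) (q := q) hau.2 (ρ⁻¹ • a.2.1)
      exact congrArg Prod.snd this
    have hw : ρ • (coords I q (paramShell g ι z₀ q a).1).2 = a.2.1 := by
      rw [hco, smul_smul, mul_inv_cancel₀ hρ0.ne', one_smul]
    have ht' : (paramShell g ι z₀ q a).2 = ρ * a.2.2 := rfl
    rw [ht'] at hat haε ht
    have hτ : 0 ≤ a.2.2 := nonneg_of_mul_nonneg_right hat hρ0
    refine ⟨haℋ, hz1, hau.2, (extChartAt (𝓡 d) z₀).right_inv hau.1, hz2, hw, ?_, hτ, ?_, ?_⟩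
    · set v := (coords I q (paramShell g ι z₀ q a).1).2
      rw [lt_min_iff, dist_eq_norm] at hv
      have hvn : ‖v‖ ≤ ‖v₀‖ + 1 := by
        have := norm_sub_norm_le v v₀
        linarith
      have h1 : ρ • v - v₀ = (ρ - 1) • v + (v - v₀) := by rw [sub_smul, one_smul]; abel
      rw [dist_eq_norm, h1]
      have h2 : ‖(ρ - 1) • v‖ ≤ η * c := by
        rw [norm_smul, Real.norm_of_nonneg (by linarith)]
        exact mul_le_mul (by linarith) (by simp only [c]; linarith) (norm_nonneg _) hη.le
      have := norm_add_le ((ρ - 1) • v) (v - v₀)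
      linarith
    · rw [lt_min_iff, Real.dist_eq, abs_lt, abs_lt] at ht
      have h1 : a.2.2 ≤ ρ * a.2.2 := le_mul_of_one_le_left hτ hρ1.le
      have h2 : ρ * a.2.2 - a.2.2 ≤ η * c := by
        have : ρ * a.2.2 - a.2.2 = (ρ - 1) * a.2.2 := by ring
        rw [this]
        have := norm_nonneg v₀
        exact mul_le_mul (by linarith) (by simp only [c]; linarith) hτ hη.le
      rw [Real.dist_eq, abs_lt]
      constructor <;> linarith
    · rw [mul_assoc]; exact haε
  have hfW : ∀ a ∈ D', scaledCurve γ (ε * √ (paramLengthSq g ι z₀ q a))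
      (paramShell g ι z₀ q a).1 a.2.2 ∈ W := fun a ha => by
    obtain ⟨h1, h2, h3, h4, h5, h6, h7, h8, h9, h10⟩ := hdata a ha
    exact (hK _ h1 _ h1 _ _ rfl rfl h2 h2 h3 h3 _ _ _ _ h5 h5 h7 h7 h8 h8 h9 h9 h10 h10).1
  have hfanti : ∀ a ∈ D', ∀ a' ∈ D', dist a a' ≤ K * dist (f a) (f a') := fun a ha a' ha' => by
    obtain ⟨h1, h2, h3, h4, h5, h6, h7, h8, h9, h10⟩ := hdata a ha
    obtain ⟨h1', h2', h3', h4', h5', h6', h7', h8', h9', h10'⟩ := hdata a' ha'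
    have := (hK _ h1 _ h1' _ _ rfl rfl h2 h2' h3 h3' _ _ _ _ h5 h5' h7 h7' h8 h8' h9 h9'
      h10 h10').2
    rw [h4, h4', h6, h6'] at this
    exact this
  have hfcont : ContinuousOn f D' := by
    have hP : ContinuousOn (fun a => γ (paramShell g ι z₀ q a).1 (ε * (paramShell g ι z₀ q a).2))
        D' := (hF.continuousOn_halfDomain hι hε).comp (hcs.mono inter_subset_left)
      fun a ha => ha.2.2
    have hPq : MapsTo (fun a => γ (paramShell g ι z₀ q a).1 (ε * (paramShell g ι z₀ q a).2))
        D' (coordDomain I q₁) := fun a ha => by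
      have := (hfW a ha).1
      have he : ε * (paramShell g ι z₀ q a).2 = ε * √ (paramLengthSq g ι z₀ q a) * a.2.2 :=
        (mul_assoc _ _ _).symm
      simp only
      rw [he]
      exact this
    have hc := (continuousOn_coords q₁).comp hP hPq
    have hL : ContinuousOn (fun a => ε * √ (paramLengthSq g ι z₀ q a)) D' :=
      continuousOn_const.mul ((continuousOn_paramLengthSq g hι.contMDiff z₀ q).mono
        fun a ha => ha.1.1).sqrt
    refine (hc.fst.prodMk (hL.smul hc.snd)).congr fun a ha => ?_
    have he : ε * (paramShell g ι z₀ q a).2 = ε * √ (paramLengthSq g ι z₀ q a) * a.2.2 :=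
      (mul_assoc _ _ _).symm
    simp only [f, scaledCurve, Function.comp_apply, Pi.smul_apply', he]
    exact coords_scaleVec (p := γ _ _) _ (hfW a ha).1.1
  -- The rescaled geodesic passes through the same points, and `φ` sees only the position.
  have heq : ∀ a, D.indicator (fun a => Φ (paramShell g ι z₀ q a)) a =
      D'.indicator (fun a => ψ (f a)) a := fun a => by
    by_cases ha : a ∈ D'
    · rw [indicator_of_mem ha, indicator_of_mem ha.1]
      simp only [Φ]
      rw [indicator_of_mem (by exact ha.2), hψφ _ (hfW a ha).2]
      have h1 : (f a).1 = extChartAt I q₁ (scaledCurve γ (ε * √ (paramLengthSq g ι z₀ q a))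
        (paramShell g ι z₀ q a).1 a.2.2).proj := rfl
      have he : ε * (paramShell g ι z₀ q a).2 = ε * √ (paramLengthSq g ι z₀ q a) * a.2.2 :=
        (mul_assoc _ _ _).symm
      rw [h1, (extChartAt I q₁).left_inv (by rw [extChartAt_source]; exact (hfW a ha).1.1), he]
      rfl
    · rw [indicator_of_notMem ha]
      by_cases haD : a ∈ D
      · rw [indicator_of_mem haD]
        exact indicator_of_notMem (s := A ∩ halfDomain ℋ lm lp ε) (fun h => ha ⟨haD, h⟩)
          (fun x : TangentBundle I N × ℝ => φ (γ x.1 (ε * x.2)).proj)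
      · rw [indicator_of_notMem haD]
  calc _ = ∫⁻ a in D', ψ (f a) := by rw [lintegral_congr heq, lintegral_indicator hD']
    _ ≤ C₃ * ∫⁻ b, ψ b := hanti D' f hD' hfcont hfanti ψ hψ
    _ ≤ C₃ * C₁ * ∫⁻ x, φ x ∂(vol g) := by rw [mul_assoc]; gcongr

end Local

/-! ### The `L¹` estimate for a compact set of initial vectors -/

section Global

variable {n : ℕ} {H : Type*} [TopologicalSpace H]
  {I : ModelWithCorners ℝ (EuclideanSpace ℝ (Fin n)) H}
  {N : Type*} [TopologicalSpace N] [ChartedSpace H N] [IsManifold I ∞ N]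
  {d : ℕ} {S : Type*} [TopologicalSpace S] [ChartedSpace (EuclideanSpace ℝ (Fin d)) S]
  [IsManifold (𝓡 d) ∞ S] {g : Metric I N} {M : Set N} {ι : S → N}
  {ℋ : Set (TangentBundle I N)} {lm lp : TangentBundle I N → ℝ}
  {γ : TangentBundle I N → ℝ → TangentBundle I N} {K : Set (TangentBundle I N)}

lemma IsGeodesicFamily.exists_length_le (hF : IsGeodesicFamily (d := d) g M ι ℋ lm lp γ)
    (hK : IsCompact K) (hKℋ : K ⊆ ℋ) : ∃ R : ℝ, ∀ p ∈ K, -R ≤ lm p ∧ lp p ≤ R := by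
  obtain ⟨R₁, h₁⟩ := hK.exists_bound_of_continuousOn (hF.continuousOn_lm.mono hKℋ)
  obtain ⟨R₂, h₂⟩ := hK.exists_bound_of_continuousOn (hF.continuousOn_lp.mono hKℋ)
  refine ⟨max R₁ R₂, fun p hp => ⟨?_, ?_⟩⟩
  · exact (neg_le_neg ((h₁ p hp).trans (le_max_left _ _))).trans (neg_abs_le (lm p))
  · exact (le_abs_self (lp p)).trans ((h₂ p hp).trans (le_max_right _ _))

variable [T2Space N]

/-- By continuity of `lm` and `lp` this is a closed part of `K × [0, R]`, where `R` bounds both of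
them on `K`; `|ε| = 1` turns the bound on `ε t` into one on `t`. -/
lemma IsGeodesicFamily.isCompact_halfDomain (hF : IsGeodesicFamily (d := d) g M ι ℋ lm lp γ)
    (hK : IsCompact K) (hKℋ : K ⊆ ℋ) {ε : ℝ} (hε : |ε| = 1) :
    IsCompact (halfDomain K lm lp ε) := by
  obtain ⟨R, hR⟩ := hF.exists_length_le hK hKℋ
  have hc : IsCompact (K ×ˢ Icc (0 : ℝ) R) := hK.prod isCompact_Icc
  have hlm : ContinuousOn (fun x : TangentBundle I N × ℝ => lm x.1) (K ×ˢ Icc (0 : ℝ) R) :=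
    (hF.continuousOn_lm.mono hKℋ).comp continuousOn_fst fun x hx => hx.1
  have hlp : ContinuousOn (fun x : TangentBundle I N × ℝ => lp x.1) (K ×ˢ Icc (0 : ℝ) R) :=
    (hF.continuousOn_lp.mono hKℋ).comp continuousOn_fst fun x hx => hx.1
  have hcl : IsClosed ((K ×ˢ Icc (0 : ℝ) R) ∩
      (fun x : TangentBundle I N × ℝ => (ε * x.2 - lm x.1, lp x.1 - ε * x.2)) ⁻¹'
        Ici ((0 : ℝ), (0 : ℝ))) :=
    (((by fun_prop : ContinuousOn (fun x : TangentBundle I N × ℝ => ε * x.2) _).sub hlm).prodMk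
      (hlp.sub (by fun_prop))).preimage_isClosed_of_isClosed hc.isClosed isClosed_Ici
  convert hc.of_isClosed_subset hcl inter_subset_left using 1
  ext x
  constructor
  · rintro ⟨h1, h2, h3, h4⟩
    have h5 := hR x.1 h1
    refine ⟨⟨h1, h2, ?_⟩, sub_nonneg.2 h3, sub_nonneg.2 h4⟩
    rw [← abs_of_nonneg h2, ← one_mul |x.2|, ← hε, ← abs_mul]
    exact abs_le.2 ⟨h5.1.trans h3, h4.trans h5.2⟩
  · rintro ⟨⟨h1, h2, -⟩, h3, h4⟩
    exact ⟨h1, h2, sub_nonneg.1 h3, sub_nonneg.1 h4⟩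

/-- The speed of the geodesics issued from a compact set is bounded. -/
lemma IsGeodesicFamily.exists_speed_le (hF : IsGeodesicFamily (d := d) g M ι ℋ lm lp γ)
    (hι : IsInteriorEmbedding (d := d) I ι) (hK : IsCompact K) (hKℋ : K ⊆ ℋ) :
    ∃ B : ℝ, ∀ p ∈ K, ∀ t ∈ Icc (lm p) (lp p),
      |g.inner (γ p t).proj (γ p t).snd (γ p t).snd| ≤ B := by
  have h : ∀ ε : ℝ, |ε| = 1 → ∃ B : ℝ, ∀ x ∈ halfDomain K lm lp ε,
      |g.inner (γ x.1 (ε * x.2)).proj (γ x.1 (ε * x.2)).snd (γ x.1 (ε * x.2)).snd| ≤ B :=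
    fun ε hε => (hF.isCompact_halfDomain hK hKℋ hε).exists_bound_of_continuousOn
      ((continuous_inner_self g).comp_continuousOn ((hF.continuousOn_halfDomain hι
        (fun h => by simp [h] at hε)).mono fun x hx => ⟨hKℋ hx.1, hx.2⟩))
  obtain ⟨B₁, h₁⟩ := h 1 (by simp)
  obtain ⟨B₂, h₂⟩ := h (-1) (by simp)
  refine ⟨max B₁ B₂, fun p hp t ht => ?_⟩
  rcases le_total 0 t with h0 | h0
  · have := h₁ (p, t) ⟨hp, h0, by simpa using ht⟩
    rw [one_mul] at this
    exact this.trans (le_max_left _ _)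
  · have := h₂ (p, -t) ⟨hp, neg_nonneg.2 h0, by simpa using ht⟩
    rw [neg_mul_neg, one_mul] at this
    exact this.trans (le_max_right _ _)

variable [SecondCountableTopology N] [MeasurableSpace N] [BorelSpace N]
  [MeasurableSpace S] [BorelSpace S]

lemma measurable_tangentBundle_proj : Measurable fun p : TangentBundle I N => p.proj :=
  (FiberBundle.continuous_proj (EuclideanSpace ℝ (Fin n))
    (TangentSpace I : N → Type _)).measurable

/-- Finitely many of the local sets cover the compact set of half-trajectories. The indicator of a
union is at most the sum of the indicators, so the constants add up. -/
lemma IsGeodesicFamily.exists_halfDomain_lintegral_le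
    (hF : IsGeodesicFamily (d := d) g M ι ℋ lm lp γ) (hι : IsInteriorEmbedding (d := d) I ι)
    {ν : ∀ z : S, TangentSpace I (ι z)} (hν : IsUnitNormal (d := d) g ι ν) (hn : n = d + 1)
    (hK : IsCompact K) (hKℋ : K ⊆ ℋ) {ε : ℝ} (hε : |ε| = 1) :
    ∃ A : Set (TangentBundle I N × ℝ), MeasurableSet A ∧ halfDomain K lm lp ε ⊆ A ∧
      ∃ C : ENNReal, C ≠ ⊤ ∧ ∀ φ : N → ENNReal, Measurable φ →
        ∫⁻ p, (∫⁻ t, (A ∩ halfDomain ℋ lm lp ε).indicator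
          (fun x => φ (γ x.1 (ε * x.2)).proj) (p, t)) ∂(fluxMeasure (d := d) g ι ν) ≤
        C * ∫⁻ x, φ x ∂(vol g) := by
  have hε0 : ε ≠ 0 := fun h => by simp [h] at hε
  refine (hF.isCompact_halfDomain hK hKℋ hε).induction_on (p := fun T =>
    ∃ A : Set (TangentBundle I N × ℝ), MeasurableSet A ∧ T ⊆ A ∧
      ∃ C : ENNReal, C ≠ ⊤ ∧ ∀ φ : N → ENNReal, Measurable φ →
        ∫⁻ p, (∫⁻ t, (A ∩ halfDomain ℋ lm lp ε).indicator
          (fun x => φ (γ x.1 (ε * x.2)).proj) (p, t)) ∂(fluxMeasure (d := d) g ι ν) ≤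
        C * ∫⁻ x, φ x ∂(vol g)) ?_ ?_ ?_ ?_
  · exact ⟨∅, MeasurableSet.empty, le_rfl, 0, ENNReal.zero_ne_top, fun φ _ => by simp⟩
  · rintro T T' hTT' ⟨A, hA, hTA, hC⟩
    exact ⟨A, hA, hTT'.trans hTA, hC⟩
  · rintro T T' ⟨A, hA, hTA, C, hC, h⟩ ⟨A', hA', hTA', C', hC', h'⟩
    refine ⟨A ∪ A', hA.union hA', union_subset_union hTA hTA', C + C',
      ENNReal.add_ne_top.2 ⟨hC, hC'⟩, fun φ hφ => ?_⟩
    have hm : Measurable ((A ∩ halfDomain ℋ lm lp ε).indicator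
        fun x => φ (γ x.1 (ε * x.2)).proj) :=
      hF.measurable_indicator hι hε0 (hφ.comp measurable_tangentBundle_proj) hA
    rw [add_mul]
    refine le_trans ?_ (add_le_add (h φ hφ) (h' φ hφ))
    rw [← lintegral_add_left hm.lintegral_prod_right']
    refine lintegral_mono fun p => ?_
    have hm' : Measurable fun t => (A ∩ halfDomain ℋ lm lp ε).indicator
        (fun x => φ (γ x.1 (ε * x.2)).proj) (p, t) := hm.comp measurable_prodMk_left
    rw [← lintegral_add_left hm']
    refine lintegral_mono fun t => ?_
    rw [union_inter_distrib_right]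
    rw [← indicator_union_add_inter_apply]
    exact le_self_add
  · rintro x hx
    obtain ⟨A, hA, hxA, hC⟩ := hF.exists_local_lintegral_le hι hν hn hε0 (x₀ := x)
      ⟨hKℋ hx.1, hx.2⟩
    exact ⟨A, mem_nhdsWithin_of_mem_nhds (hA.mem_nhds hxA), A, hA.measurableSet, le_rfl, hC⟩

/-- The X-ray transform of nonnegative functions is bounded in `L¹`, for geodesics issued from a
compact set. -/
theorem IsGeodesicFamily.exists_lintegral_le
    (hF : IsGeodesicFamily (d := d) g M ι ℋ lm lp γ) (hι : IsInteriorEmbedding (d := d) I ι)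
    {ν : ∀ z : S, TangentSpace I (ι z)} (hν : IsUnitNormal (d := d) g ι ν) (hn : n = d + 1)
    (hK : IsCompact K) (hKℋ : K ⊆ ℋ) :
    ∃ C : ENNReal, C ≠ ⊤ ∧ ∀ φ : N → ENNReal, Measurable φ →
      ∃ G : TangentBundle I N → ENNReal, Measurable G ∧
        (∀ p ∈ K, ∫⁻ t in Icc (lm p) (lp p), φ (γ p t).proj ≤ G p) ∧
        ∫⁻ p, G p ∂(fluxMeasure (d := d) g ι ν) ≤ C * ∫⁻ x, φ x ∂(vol g) := by
  obtain ⟨A₁, hA₁, hs₁, C₁, hC₁, h₁⟩ := hF.exists_halfDomain_lintegral_le hι hν hn hK hKℋ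
    (ε := 1) (by simp)
  obtain ⟨A₂, hA₂, hs₂, C₂, hC₂, h₂⟩ := hF.exists_halfDomain_lintegral_le hι hν hn hK hKℋ
    (ε := -1) (by simp)
  refine ⟨C₁ + C₂, ENNReal.add_ne_top.2 ⟨hC₁, hC₂⟩, fun φ hφ => ?_⟩
  have hm : Measurable ((A₁ ∩ halfDomain ℋ lm lp 1).indicator
      fun x => φ (γ x.1 (1 * x.2)).proj) :=
    hF.measurable_indicator hι one_ne_zero (hφ.comp measurable_tangentBundle_proj) hA₁
  have hm' : Measurable ((A₂ ∩ halfDomain ℋ lm lp (-1)).indicator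
      fun x => φ (γ x.1 (-1 * x.2)).proj) :=
    hF.measurable_indicator hι (by simp) (hφ.comp measurable_tangentBundle_proj) hA₂
  refine ⟨_, (hm.lintegral_prod_right' (ν := volume)).add
    (hm'.lintegral_prod_right' (ν := volume)), fun p hp => ?_, ?_⟩
  swap
  · simp only [Pi.add_apply]
    rw [add_mul, lintegral_add_left hm.lintegral_prod_right']
    exact add_le_add (h₁ φ hφ) (h₂ φ hφ)
  -- The negative times are reflected below, which turns them into the half-trajectory with `ε =
  -- -1`.
  have hsub : Icc (lm p) (lp p) ⊆ Icc 0 (lp p) ∪ Icc (lm p) 0 := fun t ht =>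
    (le_total 0 t).imp (fun h => ⟨h, ht.2⟩) fun h => ⟨ht.1, h⟩
  refine (lintegral_mono_set hsub).trans ((lintegral_union_le _ _ _).trans (add_le_add ?_ ?_))
  · rw [← lintegral_indicator measurableSet_Icc]
    refine lintegral_mono fun t => ?_
    by_cases ht : t ∈ Icc 0 (lp p)
    · have hx : (p, t) ∈ halfDomain K lm lp 1 :=
        ⟨hp, ht.1, by simpa using (hF.lm_nonpos p (hKℋ hp)).trans ht.1, by simpa using ht.2⟩
      have hx' : (p, t) ∈ A₁ ∩ halfDomain ℋ lm lp 1 := ⟨hs₁ hx, hKℋ hx.1, hx.2⟩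
      rw [indicator_of_mem ht, indicator_of_mem hx', one_mul]
    · rw [indicator_of_notMem ht]; exact zero_le
  · rw [← lintegral_indicator measurableSet_Icc,
      ← (Measure.measurePreserving_neg (volume : Measure ℝ)).lintegral_comp_emb
        (MeasurableEquiv.neg ℝ).measurableEmbedding]
    refine lintegral_mono fun t => ?_
    by_cases ht : -t ∈ Icc (lm p) 0
    · have hx : (p, t) ∈ halfDomain K lm lp (-1) :=
        ⟨hp, by simpa using ht.2, by simpa using ht.1,
          by simpa using ht.2.trans (hF.lp_nonneg p (hKℋ hp))⟩
      have hx' : (p, t) ∈ A₂ ∩ halfDomain ℋ lm lp (-1) := ⟨hs₂ hx, hKℋ hx.1, hx.2⟩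
      rw [indicator_of_mem ht, indicator_of_mem hx', neg_one_mul]
    · rw [indicator_of_notMem ht]; exact zero_le

end Global

/-! ### Pointwise norms of tensors and measurability -/

lemma measurable_of_countable_cover {X Y κ : Type*} [MeasurableSpace X] [MeasurableSpace Y]
    {f : X → Y} {s : Set κ} (hs : s.Countable) {U : κ → Set X} (hU : ∀ i, MeasurableSet (U i))
    (hcov : ⋃ i ∈ s, U i = univ) (hf : ∀ i, Measurable fun x : U i => f x) : Measurable f := by
  intro A hA
  have : f ⁻¹' A = ⋃ i ∈ s, Subtype.val '' ((fun x : U i => f x) ⁻¹' A) := by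
    ext x
    have hx : x ∈ ⋃ i ∈ s, U i := hcov ▸ mem_univ x
    constructor
    · intro h
      obtain ⟨i, hi, hxi⟩ := mem_iUnion₂.1 hx
      exact mem_iUnion₂.2 ⟨i, hi, ⟨x, hxi⟩, h, rfl⟩
    · intro h
      obtain ⟨i, -, y, hy, rfl⟩ := mem_iUnion₂.1 h
      exact hy
  rw [this]
  exact MeasurableSet.biUnion hs fun i _ => (hU i).subtype_image (hf i hA)

open scoped MatrixOrder in
lemma exists_eq_conjTranspose_mul_self {k : ℕ} {A : Matrix (Fin k) (Fin k) ℝ}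
    (hA : A.PosSemidef) : ∃ B : Matrix (Fin k) (Fin k) ℝ, A = B.conjTranspose * B := by
  refine ⟨CFC.sqrt A, ?_⟩
  have h : (CFC.sqrt A).PosSemidef := Matrix.nonneg_iff_posSemidef.1 (CFC.sqrt_nonneg A)
  rw [h.isHermitian.eq, CFC.sqrt_mul_sqrt_self A hA.nonneg]

section Tensor

variable {n : ℕ} {H : Type*} [TopologicalSpace H]
  {I : ModelWithCorners ℝ (EuclideanSpace ℝ (Fin n)) H}
  {N : Type*} [TopologicalSpace N] [ChartedSpace H N] [IsManifold I ∞ N]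
  {𝕜 : Type*} [RCLike 𝕜] {g : Metric I N}

/-- The product of `2`-tensors at `x`, computed in the basis `e`. -/
def frameInner (g : Metric I N) (x : N) (e : Fin n → TangentSpace I x)
    (f h : TangentSpace I x → TangentSpace I x → 𝕜) : 𝕜 :=
  ∑ i, ∑ j, ∑ k, ∑ l, ((((gram g x e)⁻¹ i k * (gram g x e)⁻¹ j l : ℝ)) : 𝕜) *
    f (e i) (e j) * star (h (e k) (e l))

/-- The components of a `2`-tensor. -/
def tensorMatrix {x : N} (e : Fin n → TangentSpace I x)
    (f : TangentSpace I x → TangentSpace I x → 𝕜) : Matrix (Fin n) (Fin n) 𝕜 :=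
  Matrix.of fun i j => f (e i) (e j)

/-- In this form independence of the basis becomes matrix algebra: the components change by
congruence with `P`, the inverse Gram matrix by congruence with `P⁻¹`, and the trace is cyclic. -/
lemma frameInner_eq_trace (x : N) (e : Fin n → TangentSpace I x)
    (f h : TangentSpace I x → TangentSpace I x → 𝕜) :
    frameInner g x e f h = ((tensorMatrix e f).transpose *
      ((gram g x e)⁻¹).map (algebraMap ℝ 𝕜) * (tensorMatrix e h).map star *
      (((gram g x e)⁻¹).map (algebraMap ℝ 𝕜)).transpose).trace := by
  simp only [Matrix.trace, Matrix.diag, Matrix.mul_apply, Finset.sum_mul, frameInner,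
    Matrix.transpose_apply, Matrix.map_apply, tensorMatrix, Matrix.of_apply]
  rw [Finset.sum_comm]
  refine Finset.sum_congr rfl fun j _ => ?_
  have h1 : ∀ i, ∑ k, ∑ l, ((((gram g x e)⁻¹ i k * (gram g x e)⁻¹ j l : ℝ)) : 𝕜) *
      f (e i) (e j) * star (h (e k) (e l)) = ∑ l, ∑ k,
      ((((gram g x e)⁻¹ i k * (gram g x e)⁻¹ j l : ℝ)) : 𝕜) *
      f (e i) (e j) * star (h (e k) (e l)) := fun i => Finset.sum_comm
  simp only [h1]
  rw [Finset.sum_comm]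
  refine Finset.sum_congr rfl fun l _ => ?_
  rw [Finset.sum_comm]
  refine Finset.sum_congr rfl fun k _ => Finset.sum_congr rfl fun i _ => ?_
  simp only [RCLike.algebraMap_eq_ofReal, RCLike.ofReal_mul]
  ring

lemma gram_change (x : N) {e e' : Fin n → TangentSpace I x} {P : Matrix (Fin n) (Fin n) ℝ}
    (he : ∀ i, e' i = ∑ a, P a i • e a) : gram g x e' = P.transpose * gram g x e * P := by
  ext i j
  simp only [gram, Matrix.of_apply, he, map_sum, map_smul, sum_apply, smul_apply,
    Matrix.mul_apply, Matrix.transpose_apply, smul_eq_mul, Finset.sum_mul]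
  refine Finset.sum_congr rfl fun a _ => ?_
  rw [Finset.mul_sum]
  refine Finset.sum_congr rfl fun c _ => ?_
  ring

/-- The product of `2`-tensors does not depend on the basis. -/
lemma frameInner_change (x : N) {e e' : Fin n → TangentSpace I x} {P : Matrix (Fin n) (Fin n) ℝ}
    (hP : IsUnit P.det) (he : ∀ i, e' i = ∑ a, P a i • e a)
    (f h : TangentSpace I x →ₗ[ℝ] TangentSpace I x →ₗ[ℝ] 𝕜) :
    frameInner g x e' (fun u w => f u w) (fun u w => h u w) =
      frameInner g x e (fun u w => f u w) (fun u w => h u w) := by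
  have hG := gram_change (g := g) x he
  have hT : ∀ f : TangentSpace I x →ₗ[ℝ] TangentSpace I x →ₗ[ℝ] 𝕜,
      tensorMatrix e' (fun u w => f u w) = (P.map (algebraMap ℝ 𝕜)).transpose *
        tensorMatrix e (fun u w => f u w) * P.map (algebraMap ℝ 𝕜) := fun f => by
    ext i j
    simp only [tensorMatrix, Matrix.of_apply, he, map_sum, map_smul, LinearMap.sum_apply,
      LinearMap.smul_apply, Matrix.mul_apply, Matrix.transpose_apply, Finset.sum_mul,
      Matrix.map_apply, RCLike.algebraMap_eq_ofReal, RCLike.real_smul_eq_coe_mul]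
    refine Finset.sum_congr rfl fun a _ => ?_
    rw [Finset.mul_sum]
    refine Finset.sum_congr rfl fun c _ => ?_
    ring
  set p := P.map (algebraMap ℝ 𝕜)
  set p' := (P⁻¹).map (algebraMap ℝ 𝕜)
  have hpp : p * p' = 1 := by
    rw [← Matrix.map_mul, Matrix.mul_nonsing_inv P hP]
    simp
  have hstar : (tensorMatrix e' (fun u w => h u w)).map star = p.transpose *
      (tensorMatrix e (fun u w => h u w)).map star * p := by
    rw [hT h]
    ext i j
    simp [Matrix.mul_apply, p]
  have hGi : ((gram g x e')⁻¹).map (algebraMap ℝ 𝕜) =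
      p' * ((gram g x e)⁻¹).map (algebraMap ℝ 𝕜) * p'.transpose := by
    rw [hG, Matrix.mul_inv_rev, Matrix.mul_inv_rev, ← Matrix.transpose_nonsing_inv,
      Matrix.map_mul, Matrix.map_mul, Matrix.transpose_map, Matrix.mul_assoc]
  rw [frameInner_eq_trace, frameInner_eq_trace, hT f, hstar, hGi]
  set A := tensorMatrix e (fun u w => f u w)
  set B := ((gram g x e)⁻¹).map (algebraMap ℝ 𝕜)
  set D := (tensorMatrix e (fun u w => h u w)).map star
  have hpt : p'.transpose * p.transpose = 1 := by
    rw [← Matrix.transpose_mul, hpp, Matrix.transpose_one]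
  have : (p.transpose * A * p).transpose * (p' * B * p'.transpose) * (p.transpose * D * p) *
      (p' * B * p'.transpose).transpose =
      p.transpose * (A.transpose * B * D * B.transpose * p'.transpose) := by
    simp only [Matrix.transpose_mul, Matrix.transpose_transpose]
    calc _ = p.transpose * A.transpose * (p * p') * B * (p'.transpose * p.transpose) * D *
          (p * p') * B.transpose * p'.transpose := by simp only [Matrix.mul_assoc]
      _ = _ := by rw [hpp, hpt]; simp only [Matrix.mul_assoc, Matrix.one_mul]
  rw [this, Matrix.trace_mul_comm, Matrix.mul_assoc, hpt, Matrix.mul_one]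

lemma tensorInner_eq_frameInner {q x : N} (hx : x ∈ (chartAt H q).source)
    (f h : TangentSpace I x →ₗ[ℝ] TangentSpace I x →ₗ[ℝ] 𝕜) :
    tensorInner g x (fun u w => f u w) (fun u w => h u w) =
      frameInner g x (frame I q x) (fun u w => f u w) (fun u w => h u w) := by
  set P : Matrix (Fin n) (Fin n) ℝ :=
    Matrix.of fun a i => frameChange I x q x (EuclideanSpace.single i 1) a
  have he : ∀ i, frame I x x i = ∑ a, P a i • frame I q x a := fun i => by
    rw [frame, ← vecAt_frameChange x hx, vecAt_eq_sum]
    rfl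
  have hP : P.det ≠ 0 := fun h0 => by
    have h1 := (posDef_gram_frame g (mem_chart_source H x)).det_pos
    rw [gram_change x he, Matrix.det_mul, h0, mul_zero] at h1
    exact h1.false
  exact frameInner_change x hP.isUnit he f h

/-- Factoring the inverse Gram matrix as `P Pᵀ` gives `Pᵀ G P = 1`, so the columns of `P` are the
components of an orthonormal basis. -/
lemma exists_orthonormal_frame (g : Metric I N) (x : N) : ∃ e : Fin n → TangentSpace I x,
    gram g x e = 1 ∧ (∀ w, ∃ c : Fin n → ℝ, w = ∑ i, c i • e i) ∧
    ∀ f h : TangentSpace I x →ₗ[ℝ] TangentSpace I x →ₗ[ℝ] 𝕜,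
      tensorInner g x (fun u w => f u w) (fun u w => h u w) =
        ∑ i, ∑ j, f (e i) (e j) * star (h (e i) (e j)) := by
  have hx := mem_chart_source H x
  have hpos := posDef_gram_frame g hx
  obtain ⟨B, hB⟩ := exists_eq_conjTranspose_mul_self hpos.inv.posSemidef
  set G := gram g x (frame I x x) with hG
  set P : Matrix (Fin n) (Fin n) ℝ := B.transpose with hPdef
  have hPP : P * (P.transpose * G) = 1 := by
    have : B.conjTranspose = P := Matrix.conjTranspose_eq_transpose_of_trivial B
    rw [this] at hB
    rw [hPdef, Matrix.transpose_transpose, ← Matrix.mul_assoc, ← hPdef, ← hB,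
      Matrix.nonsing_inv_mul G (hpos.det_pos.ne'.isUnit)]
  have hP : IsUnit P.det := Matrix.isUnit_det_of_right_inverse hPP
  set e : Fin n → TangentSpace I x := fun i => ∑ a, P a i • frame I x x a
  have he : gram g x e = 1 := by
    rw [gram_change x (e := frame I x x) (P := P) fun i => rfl]
    exact mul_eq_one_comm.1 hPP
  refine ⟨e, he, fun w => ?_, fun f h => ?_⟩
  · obtain ⟨v, rfl⟩ : ∃ v, vecAt I x x v = w := ⟨_, vecAt_coords hx w⟩
    refine ⟨P⁻¹.mulVec v, ?_⟩
    have hv : ∀ a, v a = ∑ i, P a i * (P⁻¹.mulVec v) i := fun a => by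
      have : P.mulVec (P⁻¹.mulVec v) = v := by
        rw [Matrix.mulVec_mulVec, Matrix.mul_nonsing_inv P hP, Matrix.one_mulVec]
      exact (congrFun this a).symm
    rw [vecAt_eq_sum]
    simp only [e, Finset.smul_sum, smul_smul]
    rw [Finset.sum_comm]
    refine Finset.sum_congr rfl fun a _ => ?_
    rw [← Finset.sum_smul]
    conv_lhs => rw [hv a]
    simp only [mul_comm]
  · rw [tensorInner_eq_frameInner hx, ← frameInner_change x hP (fun i => rfl) f h]
    change frameInner g x e _ _ = _
    rw [frameInner, he]
    have h1 : ∀ i j, (((1 : Matrix (Fin n) (Fin n) ℝ)⁻¹ i j : ℝ) : 𝕜) = if i = j then 1 else 0 :=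
      fun i j => by rw [inv_one, Matrix.one_apply]; split_ifs <;> simp
    simp only [RCLike.ofReal_mul, h1, ite_mul, mul_ite, one_mul, mul_one, zero_mul, mul_zero,
      Finset.sum_ite_eq, Finset.mem_univ, if_true]

/-- In an orthonormal basis `f(w, w) = ∑ cᵢ cⱼ fᵢⱼ`, and `∑ (cᵢ cⱼ)² = |w|⁴`; the rest is
Cauchy–Schwarz. -/
lemma tensorNormSq_nonneg_and_le (x : N) (f : TangentSpace I x →ₗ[ℝ] TangentSpace I x →ₗ[ℝ] 𝕜) :
    0 ≤ tensorNormSq g x (fun u w => f u w) ∧ ∀ w, ‖f w w‖ ^ 2 ≤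
      tensorNormSq g x (fun u w => f u w) * (g.inner x w w) ^ 2 := by
  obtain ⟨e, he, hspan, hf⟩ := exists_orthonormal_frame (𝕜 := 𝕜) g x
  have hn : tensorNormSq g x (fun u w => f u w) =
      ∑ a : Fin n × Fin n, ‖f (e a.1) (e a.2)‖ ^ 2 := by
    rw [tensorNormSq, hf, Fintype.sum_prod_type]
    simp only [map_sum, RCLike.star_def, RCLike.mul_conj]
    norm_cast
  refine ⟨hn ▸ Finset.sum_nonneg fun a _ => sq_nonneg _, fun w => ?_⟩
  obtain ⟨c, rfl⟩ := hspan w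
  have hg : g.inner x (∑ i, c i • e i) (∑ i, c i • e i) = ∑ i, c i ^ 2 := by
    have : ∀ i j, g.inner x (e i) (e j) = (1 : Matrix (Fin n) (Fin n) ℝ) i j := fun i j => by
      rw [← he]; rfl
    simp only [map_sum, map_smul, sum_apply, smul_apply, this, smul_eq_mul, Matrix.one_apply]
    simp [sq]
  have hw : f (∑ i, c i • e i) (∑ i, c i • e i) =
      ∑ a : Fin n × Fin n, (c a.1 * c a.2) • f (e a.1) (e a.2) := by
    rw [Fintype.sum_prod_type]
    simp only [map_sum, map_smul, LinearMap.sum_apply, LinearMap.smul_apply, Finset.smul_sum,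
      smul_smul]
    rw [Finset.sum_comm]
    refine Finset.sum_congr rfl fun i _ => Finset.sum_congr rfl fun j _ => ?_
    rw [mul_comm]
  have hc : ∑ a : Fin n × Fin n, (|c a.1| * |c a.2|) ^ 2 = (∑ i, c i ^ 2) ^ 2 := by
    rw [Fintype.sum_prod_type, sq (∑ i, c i ^ 2), Finset.sum_mul_sum]
    simp only [mul_pow, sq_abs]
  rw [hn, hg, hw, ← hc, mul_comm]
  calc _ ≤ (∑ a : Fin n × Fin n, |c a.1| * |c a.2| * ‖f (e a.1) (e a.2)‖) ^ 2 := by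
        gcongr
        refine (norm_sum_le _ _).trans (le_of_eq (Finset.sum_congr rfl fun a _ => ?_))
        rw [norm_smul, Real.norm_eq_abs, abs_mul]
    _ ≤ _ := Finset.sum_mul_sq_le_sq_mul_sq _ _ _

section Measurability

variable [MeasurableSpace N] [BorelSpace N]

lemma measurable_inv_gram_frame (g : Metric I N) (q : N) (i j : Fin n) :
    Measurable fun x : (chartAt H q).source => (gram g (x : N) (frame I q x))⁻¹ i j := by
  have hc : Continuous fun x : (chartAt H q).source => gram g (x : N) (frame I q x) :=
    continuous_matrix fun i j =>
      continuousOn_iff_continuous_domRestrict.1 (continuousOn_gram_frame g q i j)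
  have hd : ∀ x : (chartAt H q).source, (gram g (x : N) (frame I q x)).det ≠ 0 := fun x =>
    (posDef_gram_frame g x.2).det_pos.ne'
  simp only [Matrix.inv_def, Ring.inverse_eq_inv', Matrix.smul_apply, smul_eq_mul]
  exact ((hc.matrix_det.inv₀ hd).mul (hc.matrix_adjugate.matrix_elem i j)).measurable

variable [SecondCountableTopology N]

lemma measurable_tensorNormSq (g : Metric I N) {f : TensorField I N 𝕜} (hf : TensorMeasurable f) :
    Measurable fun x => tensorNormSq g x fun u w => f x u w := by
  obtain ⟨s, hs, hcov⟩ := TopologicalSpace.countable_cover_nhds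
    fun x : N => chart_source_mem_nhds H x
  refine measurable_of_countable_cover hs
    (fun q => (chartAt H q).open_source.measurableSet) hcov fun q => ?_
  have h : ∀ x : (chartAt H q).source, tensorNormSq g (x : N) (fun u w => f x u w) =
      RCLike.re (frameInner g (x : N) (frame I q x) (fun u w => f x u w) fun u w => f x u w) :=
    fun x => by rw [tensorNormSq, tensorInner_eq_frameInner x.2]
  simp only [h]
  refine RCLike.measurable_re.comp ?_
  unfold frameInner
  refine Finset.measurable_fun_sum _ fun i _ => Finset.measurable_fun_sum _ fun j _ =>
    Finset.measurable_fun_sum _ fun k _ => Finset.measurable_fun_sum _ fun l _ => ?_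
  refine ((RCLike.measurable_ofReal.comp ((measurable_inv_gram_frame g q i k).mul
    (measurable_inv_gram_frame g q j l))).mul (hf q i j)).mul ?_
  exact continuous_star.measurable.comp (hf q k l)

lemma bilinear_sum_smul {V : Type*} [AddCommGroup V] [Module ℝ V] (f : V →ₗ[ℝ] V →ₗ[ℝ] 𝕜)
    {k : ℕ} (c : Fin k → ℝ) (e : Fin k → V) :
    f (∑ i, c i • e i) (∑ i, c i • e i) =
      ∑ i, ∑ j, ((c j * c i : ℝ) : 𝕜) * f (e i) (e j) := by
  simp only [map_sum, map_smul, LinearMap.sum_apply, LinearMap.smul_apply, Finset.smul_sum,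
    RCLike.real_smul_eq_coe_mul]
  rw [Finset.sum_comm]
  refine Finset.sum_congr rfl fun i _ => Finset.sum_congr rfl fun j _ => ?_
  rw [RCLike.ofReal_mul, mul_assoc]

lemma measurable_quadratic {f : TensorField I N 𝕜} (hf : TensorMeasurable f) :
    Measurable fun p : TangentBundle I N => f p.proj p.snd p.snd := by
  obtain ⟨s, hs, hcov⟩ := TopologicalSpace.countable_cover_nhds
    fun x : N => chart_source_mem_nhds H x
  have hpr : Measurable fun p : TangentBundle I N => p.proj :=
    (FiberBundle.continuous_proj (EuclideanSpace ℝ (Fin n))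
      (TangentSpace I : N → Type _)).measurable
  refine measurable_of_countable_cover hs (U := fun q => {p | p.proj ∈ (chartAt H q).source})
    (fun q => hpr (chartAt H q).open_source.measurableSet) ?_ fun q => ?_
  · ext p
    have : p.proj ∈ ⋃ q ∈ s, (chartAt H q).source := hcov ▸ mem_univ _
    simpa using this
  set e := trivializationAt (EuclideanSpace ℝ (Fin n)) (TangentSpace I : N → Type _) q
  have hv : Continuous fun p : {p : TangentBundle I N | p.proj ∈ (chartAt H q).source} =>
      (e p).2 := by
    have h1 : ContinuousOn e {p : TangentBundle I N | p.proj ∈ (chartAt H q).source} :=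
      e.continuousOn.mono fun p hp => e.mem_source.2 hp
    exact (continuousOn_iff_continuous_domRestrict.1 h1).snd
  have hc : ∀ i, Measurable fun p : {p : TangentBundle I N | p.proj ∈ (chartAt H q).source} =>
      (e p).2 i := fun i =>
    ((EuclideanSpace.proj i : EuclideanSpace ℝ (Fin n) →L[ℝ] ℝ).continuous.comp hv).measurable
  have hf' : ∀ i j, Measurable fun p : {p : TangentBundle I N | p.proj ∈ (chartAt H q).source} =>
      f p.1.proj (frame I q p.1.proj i) (frame I q p.1.proj j) := fun i j =>
    (hf q i j).comp (g := fun x : (chartAt H q).source => f x (frame I q x i) (frame I q x j))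
      (f := fun p : {p : TangentBundle I N | p.proj ∈ (chartAt H q).source} => ⟨p.1.proj, p.2⟩)
      ((hpr.comp measurable_subtype_coe).subtype_mk)
  have h : ∀ p : {p : TangentBundle I N | p.proj ∈ (chartAt H q).source},
      f p.1.proj p.1.snd p.1.snd = ∑ i, ∑ j, ((((e p).2 j * (e p).2 i : ℝ)) : 𝕜) *
        f p.1.proj (frame I q p.1.proj i) (frame I q p.1.proj j) := fun p => by
    have h1 : p.1.snd = ∑ i, (e p).2 i • frame I q p.1.proj i := by
      rw [← vecAt_eq_sum]
      exact (vecAt_coords p.2 p.1.snd).symm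
    conv_lhs => rw [h1]
    exact bilinear_sum_smul _ _ _
  simp only [h]
  exact Finset.measurable_fun_sum _ fun i _ => Finset.measurable_fun_sum _ fun j _ =>
    (RCLike.measurable_ofReal.comp ((hc j).mul (hc i))).mul (hf' i j)

end Measurability

end Tensor

/-! ### Boundedness of the weighted X-ray transform -/

lemma lintegral_sq_le {X : Type*} [MeasurableSpace X] {μ : Measure X} {u : X → ENNReal}
    (hu : AEMeasurable u μ) : (∫⁻ x, u x ∂μ) ^ 2 ≤ μ univ * ∫⁻ x, u x ^ 2 ∂μ := by
  have h := ENNReal.lintegral_mul_le_Lp_mul_Lq μ Real.HolderConjugate.two_two hu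
    (aemeasurable_const (b := (1 : ENNReal)))
  simp only [Pi.mul_apply, mul_one, ENNReal.one_rpow, lintegral_const, one_mul] at h
  calc (∫⁻ x, u x ∂μ) ^ 2
      ≤ ((∫⁻ x, u x ^ (2 : ℝ) ∂μ) ^ (1 / 2 : ℝ) * μ univ ^ (1 / 2 : ℝ)) ^ 2 := by gcongr
    _ = _ := by
        rw [mul_pow, ← ENNReal.rpow_natCast, ← ENNReal.rpow_natCast, ← ENNReal.rpow_mul,
          ← ENNReal.rpow_mul, mul_comm]
        norm_num

lemma eLpNorm_two_sq {X E : Type*} [MeasurableSpace X] {μ : Measure X} [NormedAddCommGroup E]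
    (u : X → E) : eLpNorm u 2 μ ^ 2 = ∫⁻ x, ‖u x‖ₑ ^ 2 ∂μ := by
  have h := eLpNorm_nnreal_pow_eq_lintegral (f := u) (μ := μ) (p := 2) two_ne_zero
  have h2 : (((2 : ℝ≥0) : ENNReal)) = 2 := rfl
  rw [h2, NNReal.coe_ofNat] at h
  simp only [ENNReal.rpow_two] at h
  exact h

section Bounded

variable {n : ℕ} {H : Type*} [TopologicalSpace H]
  {I : ModelWithCorners ℝ (EuclideanSpace ℝ (Fin n)) H}
  {N : Type*} [TopologicalSpace N] [ChartedSpace H N] [IsManifold I ∞ N]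
  {𝕜 : Type*} [RCLike 𝕜] {g : Metric I N} {M : Set N} {d : ℕ}

namespace WeightedFamily

lemma isCompact_support (F : WeightedFamily g M d 𝕜) : IsCompact F.support :=
  IsCompact.image F.hasCompactSupport_α continuous_subtype_val

lemma support_subset (F : WeightedFamily g M d 𝕜) : F.support ⊆ F.ℋ := by
  rintro _ ⟨p, -, rfl⟩
  exact p.2

lemma α_eq_zero (F : WeightedFamily g M d 𝕜) {p : TangentBundle I N} (hp : p ∈ F.ℋ)
    (h : p ∉ F.support) : F.α p = 0 :=
  image_eq_zero_of_notMem_tsupport (f := fun p : F.ℋ => F.α p) (x := ⟨p, hp⟩)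
    fun h' => h ⟨_, h', rfl⟩

lemma continuousOn_α (F : WeightedFamily g M d 𝕜) : ContinuousOn F.α F.ℋ :=
  F.contMDiffOn_α.continuousOn

variable [MeasurableSpace N] [BorelSpace N] [SecondCountableTopology N]

lemma aemeasurable_integrand (F : WeightedFamily g M d 𝕜) {f : TensorField I N 𝕜}
    (hf : TensorMeasurable f) {p : TangentBundle I N} (hp : p ∈ F.ℋ) :
    AEMeasurable (integrand f (F.γ p)) (volume.restrict (Icc (F.lm p) (F.lp p))) :=
  (measurable_quadratic hf).comp_aemeasurable
    ((F.isGeodesicFamily.geodesic p hp).continuousOn.aemeasurable measurableSet_Icc)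

variable [T2Space N]

/-- Extended by zero from the two half-trajectories, the integrand is jointly measurable in the
vector and the time, so its integral over all times is measurable in the vector. -/
lemma aestronglyMeasurable_xray (F : WeightedFamily g M d 𝕜) {f : TensorField I N 𝕜}
    (hf : TensorMeasurable f) : AEStronglyMeasurable (F.xray f) F.μ := by
  set Φ : TangentBundle I N → 𝕜 := fun q => f q.proj q.snd q.snd with hΦ
  have hD : ∀ ε : ℝ, ε ≠ 0 → Measurable ((univ ∩ halfDomain F.ℋ F.lm F.lp ε).indicator
      fun x => Φ (F.γ x.1 (ε * x.2))) := fun ε hε =>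
    F.isGeodesicFamily.measurable_indicator F.isInteriorEmbedding hε (measurable_quadratic hf)
      MeasurableSet.univ
  set D := fun ε : ℝ => (univ ∩ halfDomain F.ℋ F.lm F.lp ε).indicator
    fun x => Φ (F.γ x.1 (ε * x.2)) with hDdef
  have hQ : Measurable fun x : TangentBundle I N × ℝ => D 1 x + D (-1) (x.1, -x.2) :=
    (hD 1 one_ne_zero).add ((hD (-1) (by norm_num)).comp
      (measurable_fst.prodMk measurable_snd.neg))
  have hS : StronglyMeasurable fun p => ∫ t, (D 1 (p, t) + D (-1) (p, -t)) :=
    hQ.stronglyMeasurable.integral_prod_right (ν := (volume : Measure ℝ))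
  refine ⟨_, hS, ?_⟩
  filter_upwards [ae_restrict_mem (F.isGeodesicFamily.measurableSet F.isInteriorEmbedding)]
    with p hp
  have hm := F.isGeodesicFamily.lm_nonpos p hp
  have hl := F.isGeodesicFamily.lp_nonneg p hp
  rw [xray, intervalIntegral.integral_of_le (hm.trans hl), ← integral_indicator measurableSet_Ioc]
  refine integral_congr_ae ?_
  -- Both halves contain `t = 0`, and they contain `t = lm p`, which the half-open interval of
  -- integration omits. These times are negligible.
  have h0 : ∀ᵐ t : ℝ, t ≠ 0 := by simp [ae_iff]
  have h1 : ∀ᵐ t : ℝ, t ≠ F.lm p := by simp [ae_iff]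
  filter_upwards [h0, h1] with t ht0 ht1
  have hDapp : ∀ ε s : ℝ, D ε (p, s) =
      if 0 ≤ s ∧ F.lm p ≤ ε * s ∧ ε * s ≤ F.lp p then Φ (F.γ p (ε * s)) else 0 := fun ε s => by
    have : (p, s) ∈ univ ∩ halfDomain F.ℋ F.lm F.lp ε ↔
        0 ≤ s ∧ F.lm p ≤ ε * s ∧ ε * s ≤ F.lp p :=
      ⟨fun h => ⟨h.2.2.1, h.2.2.2⟩, fun h => ⟨trivial, hp, h.1, h.2⟩⟩
    by_cases h : 0 ≤ s ∧ F.lm p ≤ ε * s ∧ ε * s ≤ F.lp p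
    · rw [if_pos h]
      exact indicator_of_mem (this.2 h) _
    · rw [if_neg h]
      exact indicator_of_notMem (mt this.1 h) _
  rw [hDapp, hDapp]
  simp only [indicator_apply, mem_Ioc, one_mul, neg_mul, neg_neg, mul_neg]
  rcases lt_or_gt_of_ne ht0 with h | h
  · have a1 : ¬ (0 ≤ t) := not_le.2 h
    have a2 : 0 ≤ -t := by linarith
    have a3 : t ≤ F.lp p := by linarith
    have a4 : F.lm p < t ↔ F.lm p ≤ t := ⟨le_of_lt, fun h' => lt_of_le_of_ne h' (Ne.symm ht1)⟩
    simp only [a1, a2, a3, a4, false_and, true_and, if_false, zero_add, and_true]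
    rfl
  · have a1 : 0 ≤ t := h.le
    have a2 : ¬ (0 ≤ -t) := by linarith
    have a3 : F.lm p ≤ t := by linarith
    have a4 : F.lm p < t := by linarith
    simp only [a1, a2, a3, a4, false_and, true_and, if_false, add_zero]
    rfl

lemma aestronglyMeasurable_weightedXray (F : WeightedFamily g M d 𝕜) {f : TensorField I N 𝕜}
    (hf : TensorMeasurable f) : AEStronglyMeasurable (F.weightedXray f) F.μ :=
  (F.continuousOn_α.aemeasurable
    (F.isGeodesicFamily.measurableSet F.isInteriorEmbedding)).aestronglyMeasurable.mul
    (F.aestronglyMeasurable_xray hf)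

lemma exists_integrand_bound (F : WeightedFamily g M d 𝕜) (hn : n = d + 1) :
    ∃ C : ENNReal, C ≠ ⊤ ∧ ∀ f : TensorField I N 𝕜, TensorMeasurable f →
      ∃ G : TangentBundle I N → ENNReal, Measurable G ∧
        (∀ p ∈ F.support, (∫⁻ t in Icc (F.lm p) (F.lp p), ‖integrand f (F.γ p) t‖ₑ) ^ 2 ≤ G p) ∧
        ∫⁻ p, G p ∂F.μ ≤
          C * ∫⁻ x, ENNReal.ofReal (tensorNormSq g x fun u w => f x u w) ∂(vol g) := by
  have hF := F.isGeodesicFamily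
  obtain ⟨R, hR⟩ := hF.exists_length_le F.isCompact_support F.support_subset
  obtain ⟨B, hB⟩ := hF.exists_speed_le F.isInteriorEmbedding F.isCompact_support F.support_subset
  obtain ⟨C, hC, hG⟩ := hF.exists_lintegral_le F.isInteriorEmbedding F.isUnitNormal hn
    F.isCompact_support F.support_subset
  -- `2 R` bounds the length of the time interval in Cauchy–Schwarz, and `B ^ 2` bounds `|γ̇|⁴`. As
  -- `B` comes from compactness, conservation of speed along geodesics is not needed.
  set D : ENNReal := ENNReal.ofReal (2 * R) * ENNReal.ofReal (B ^ 2)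
  have hD : D ≠ ⊤ := ENNReal.mul_ne_top ENNReal.ofReal_ne_top ENNReal.ofReal_ne_top
  refine ⟨D * C, ENNReal.mul_ne_top hD hC, fun f hf => ?_⟩
  obtain ⟨G, hGm, hG1, hG2⟩ := hG _ (measurable_tensorNormSq g hf).ennreal_ofReal
  refine ⟨fun p => D * G p, hGm.const_mul _, fun p hp => ?_, ?_⟩
  · refine (lintegral_sq_le (F.aemeasurable_integrand hf (F.support_subset hp)).enorm).trans ?_
    rw [Measure.restrict_apply_univ, Real.volume_Icc]
    change _ ≤ ENNReal.ofReal (2 * R) * ENNReal.ofReal (B ^ 2) * G p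
    rw [mul_assoc]
    refine mul_le_mul' (ENNReal.ofReal_le_ofReal (by linarith [(hR p hp).1, (hR p hp).2])) ?_
    refine le_trans ?_ (mul_le_mul_right (hG1 p hp) _)
    rw [← lintegral_const_mul' _ _ ENNReal.ofReal_ne_top]
    refine setLIntegral_mono' measurableSet_Icc fun t ht => ?_
    obtain ⟨h0, h1⟩ := tensorNormSq_nonneg_and_le (g := g) (F.γ p t).proj (f (F.γ p t).proj)
    rw [← ofReal_norm, ← ENNReal.ofReal_pow (norm_nonneg _), ← ENNReal.ofReal_mul (sq_nonneg _)]
    refine ENNReal.ofReal_le_ofReal ((h1 (F.γ p t).snd).trans ?_)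
    rw [mul_comm]
    refine mul_le_mul_of_nonneg_right ?_ h0
    rw [← sq_abs]
    exact pow_le_pow_left₀ (abs_nonneg _) (hB p hp t ht) 2
  · rw [lintegral_const_mul _ hGm, mul_assoc D C]
    exact mul_le_mul_right ((lintegral_mono' Measure.restrict_le_self le_rfl).trans hG2) _

/-- The majorant `G` has a finite integral, so it is finite almost everywhere; this gives absolute
convergence on the support. The norm estimate uses in addition that `α` is bounded on its compact
support and zero elsewhere in `ℋ`. -/
theorem exists_bound (F : WeightedFamily g M d 𝕜) (hn : n = d + 1) :
    ∃ C : ℝ≥0, ∀ f : TensorField I N 𝕜, MemL2 g univ f →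
      (∀ᵐ p ∂F.μ, p ∈ F.support →
        IntervalIntegrable (integrand f (F.γ p)) volume (F.lm p) (F.lp p)) ∧
      MemLp (F.weightedXray f) 2 F.μ ∧
      eLpNorm (F.weightedXray f) 2 F.μ ^ 2 ≤
        C * ∫⁻ x, ENNReal.ofReal (tensorNormSq g x fun u w => f x u w) ∂(vol g) := by
  obtain ⟨C, hC, hG⟩ := F.exists_integrand_bound hn
  obtain ⟨A, hA⟩ := F.isCompact_support.exists_bound_of_continuousOn
    (F.continuousOn_α.mono F.support_subset)
  set D : ENNReal := ENNReal.ofReal A ^ 2 * C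
  have hD : D ≠ ⊤ := ENNReal.mul_ne_top (ENNReal.pow_ne_top ENNReal.ofReal_ne_top) hC
  refine ⟨D.toNNReal, fun f hf => ?_⟩
  rw [ENNReal.coe_toNNReal hD]
  obtain ⟨G, hGm, hG1, hG2⟩ := hG f hf.measurable
  have hℋ := F.isGeodesicFamily.measurableSet F.isInteriorEmbedding
  have hle : ∀ p ∈ F.ℋ, F.lm p ≤ F.lp p := fun p hp =>
    (F.isGeodesicFamily.lm_nonpos p hp).trans (F.isGeodesicFamily.lp_nonneg p hp)
  have hfin : ∫⁻ p, G p ∂F.μ ≠ ⊤ :=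
    (hG2.trans_lt (ENNReal.mul_lt_top hC.lt_top hf.finite)).ne
  have hsq : eLpNorm (F.weightedXray f) 2 F.μ ^ 2 ≤
      D * ∫⁻ x, ENNReal.ofReal (tensorNormSq g x fun u w => f x u w) ∂(vol g) := by
    rw [eLpNorm_two_sq, mul_assoc]
    refine le_trans ?_ (mul_le_mul_right hG2 _)
    rw [← lintegral_const_mul _ hGm]
    refine lintegral_mono_ae ?_
    filter_upwards [ae_restrict_mem hℋ] with p hp
    by_cases hps : p ∈ F.support
    · rw [weightedXray, enorm_mul, mul_pow]
      refine mul_le_mul' (pow_le_pow_left' ?_ 2) ((pow_le_pow_left' ?_ 2).trans (hG1 p hps))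
      · rw [← ofReal_norm]
        exact ENNReal.ofReal_le_ofReal (hA p hps)
      · rw [xray, intervalIntegral.integral_of_le (hle p hp)]
        exact (enorm_integral_le_lintegral_enorm _).trans
          (lintegral_mono_set Ioc_subset_Icc_self)
    · simp [weightedXray, F.α_eq_zero hp hps]
  refine ⟨?_, ⟨F.aestronglyMeasurable_weightedXray hf.measurable, ?_⟩, hsq⟩
  · filter_upwards [ae_restrict_mem hℋ, ae_lt_top hGm hfin] with p hp hGp hps
    rw [intervalIntegrable_iff_integrableOn_Icc_of_le (hle p hp)]
    refine ⟨(F.aemeasurable_integrand hf.measurable hp).aestronglyMeasurable, ?_⟩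
    by_contra h
    have h' : ∫⁻ t in Icc (F.lm p) (F.lp p), ‖integrand f (F.γ p) t‖ₑ = ⊤ := not_lt_top_iff.1 h
    have := (hG1 p hps).trans_lt hGp
    rw [h'] at this
    simp at this
  · have : eLpNorm (F.weightedXray f) 2 F.μ ^ 2 < ⊤ :=
      hsq.trans_lt (ENNReal.mul_lt_top hD.lt_top hf.finite)
    by_contra h
    rw [not_lt_top_iff.1 h] at this
    simp at this

end WeightedFamily

end Bounded

/-! ### Equivalence of the vanishing conditions -/

section Vanishing

variable {n : ℕ} {H : Type*} [TopologicalSpace H]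
  {I : ModelWithCorners ℝ (EuclideanSpace ℝ (Fin n)) H}
  {N : Type*} [TopologicalSpace N] [ChartedSpace H N] [IsManifold I ∞ N]
  {𝕜 : Type*} [RCLike 𝕜] {g : Metric I N} {M : Set N} {d : ℕ}

namespace WeightedFamily

lemma nonzeroSet_subset_supportInterior (F : WeightedFamily g M d 𝕜) :
    F.nonzeroSet ⊆ F.supportInterior := by
  intro p hp
  have hc : Continuous fun p : F.ℋ => F.α p :=
    continuousOn_iff_continuous_domRestrict.1 F.continuousOn_α
  refine ⟨⟨p, hp.1⟩, ?_, rfl⟩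
  exact interior_maximal (subset_tsupport fun p : F.ℋ => F.α p) hc.isOpen_support hp.2

end WeightedFamily

section Transform

variable [MeasurableSpace N] {κ : Type*} [Fintype κ] {F : κ → WeightedFamily g M d 𝕜}
  {f : TensorField I N 𝕜}

lemma MemL2.mono {A B : Set N} (hf : MemL2 g A f) (h : A ⊆ B) : MemL2 g B f :=
  ⟨hf.measurable, hf.symm, fun x hx => hf.eq_zero x fun hA => hx (h hA), hf.finite⟩

lemma memL2_zero (g : Metric I N) (A : Set N) : MemL2 g A (0 : TensorField I N 𝕜) := by
  refine ⟨fun q i j => ?_, fun x u w => rfl, fun x _ => rfl, ?_⟩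
  · exact measurable_const (a := (0 : 𝕜))
  · simp [tensorNormSq, tensorInner]

lemma SInjective.of_imp {P Q : TensorField I N 𝕜 → Prop} (h : SInjective g M P)
    (hQ : ∀ f, MemL2 g M f → Q f → P f) : SInjective g M Q :=
  fun f hf hfQ => h f hf (hQ f hf hfQ)

lemma sInjective_congr {P Q : TensorField I N 𝕜 → Prop} (h : ∀ f, MemL2 g M f → (P f ↔ Q f)) :
    SInjective g M P ↔ SInjective g M Q :=
  ⟨fun hP => hP.of_imp fun f hf => (h f hf).2, fun hQ => hQ.of_imp fun f hf => (h f hf).1⟩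

lemma WeightedXrayVanishes.normalVanishes (hf : WeightedXrayVanishes F f) (A : Set N) :
    NormalVanishes F A f := by
  refine ⟨0, ⟨memL2_zero g A, fun φ _ => ?_⟩, Eventually.of_forall fun x => rfl⟩
  have h1 : l2Inner g (0 : TensorField I N 𝕜) φ = 0 := by simp [l2Inner, tensorInner]
  rw [h1]
  refine (Finset.sum_eq_zero fun m _ => ?_).symm
  refine integral_eq_zero_of_ae ?_
  filter_upwards [hf m] with p hp
  simp [hp]

/-- The field `f` is itself an admissible test field, since `f ∈ L²(A)`. Testing with it writes zero
as a sum of squared norms, each of which must then vanish. -/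
lemma NormalVanishes.weightedXrayVanishes {A : Set N} (h : NormalVanishes F A f)
    (hf : MemL2 g A f) (hmem : ∀ m, MemLp ((F m).weightedXray f) 2 (F m).μ) :
    WeightedXrayVanishes F f := by
  obtain ⟨h, hh, h0⟩ := h
  have h1 : l2Inner g h f = 0 := by
    refine integral_eq_zero_of_ae ?_
    filter_upwards [h0] with x hx
    simp [hx, tensorInner]
  have h2 : ∀ m, Integrable (fun p => ‖(F m).weightedXray f p‖ ^ 2) (F m).μ := fun m =>
    (hmem m).integrable_norm_pow two_ne_zero
  have h3 := hh.2 f hf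
  have h4 : ∑ m, ∫ p, ‖(F m).weightedXray f p‖ ^ 2 ∂(F m).μ = 0 := by
    rw [h1] at h3
    have h5 : ∀ m, ∫ p, (F m).weightedXray f p * star ((F m).weightedXray f p) ∂(F m).μ =
        ((∫ p, ‖(F m).weightedXray f p‖ ^ 2 ∂(F m).μ : ℝ) : 𝕜) := fun m => by
      rw [← integral_ofReal]
      simp only [RCLike.star_def, RCLike.mul_conj, RCLike.ofReal_pow]
    simp only [h5] at h3
    exact_mod_cast h3.symm
  intro m
  have h6 := (Finset.sum_eq_zero_iff_of_nonneg fun m _ =>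
    integral_nonneg fun p => sq_nonneg ‖(F m).weightedXray f p‖).1 h4 m (Finset.mem_univ m)
  filter_upwards [(integral_eq_zero_iff_of_nonneg (fun p => sq_nonneg _) (h2 m)).1 h6] with p hp
  simpa using hp

variable [BorelSpace N] [SecondCountableTopology N] [T2Space N]

lemma weightedXrayVanishes_iff :
    WeightedXrayVanishes F f ↔ XrayVanishesOn F (fun m => (F m).nonzeroSet) f := by
  refine forall_congr' fun m => ⟨fun h => ?_, fun h => ?_⟩
  · filter_upwards [h] with p hp hne
    exact (mul_eq_zero.1 hp).resolve_left hne.2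
  · filter_upwards [h, ae_restrict_mem
      ((F m).isGeodesicFamily.measurableSet (F m).isInteriorEmbedding)] with p hp hpℋ
    by_cases hα : (F m).α p = 0
    · rw [WeightedFamily.weightedXray, hα, zero_mul]
    · rw [WeightedFamily.weightedXray, hp ⟨hpℋ, hα⟩, mul_zero]

lemma normalVanishes_iff (hn : n = d + 1) {A : Set N} (hf : MemL2 g A f) :
    WeightedXrayVanishes F f ↔ NormalVanishes F A f := by
  refine ⟨fun h => h.normalVanishes A, fun h => h.weightedXrayVanishes hf fun m => ?_⟩
  obtain ⟨C, hC⟩ := (F m).exists_bound hn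
  exact (hC f (hf.mono (subset_univ A))).2.1

lemma exists_uniform_bound (hn : n = d + 1) (F : κ → WeightedFamily g M d 𝕜) :
    ∃ C : ℝ≥0, ∀ f : TensorField I N 𝕜, MemL2 g univ f → ∀ m,
      (∀ᵐ p ∂(F m).μ, p ∈ (F m).support →
        IntervalIntegrable (integrand f ((F m).γ p)) volume ((F m).lm p) ((F m).lp p)) ∧
      MemLp ((F m).weightedXray f) 2 (F m).μ ∧
      eLpNorm ((F m).weightedXray f) 2 (F m).μ ^ 2 ≤
        C * ∫⁻ x, ENNReal.ofReal (tensorNormSq g x fun u w => f x u w) ∂(vol g) := by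
  choose C hC using fun m => (F m).exists_bound hn
  refine ⟨∑ m, C m, fun f hf m => ?_⟩
  obtain ⟨h1, h2, h3⟩ := hC m f hf
  refine ⟨h1, h2, h3.trans ?_⟩
  gcongr
  exact Finset.single_le_sum (f := C) (fun _ _ => zero_le) (Finset.mem_univ m)

end Transform

end Vanishing

end GeodesicXRay

end

theorem lemma2p2 {𝕜 : Type*} [RCLike 𝕜] {d : ℕ} (hd : 1 ≤ d)
    {M₁ : Type*} [TopologicalSpace M₁] [T2Space M₁] [CompactSpace M₁]
    [ChartedSpace (EuclideanHalfSpace (d + 1)) M₁] [IsManifold (𝓡∂ (d + 1)) ∞ M₁]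
    [MeasurableSpace M₁] [BorelSpace M₁]
    (g : GeodesicXRay.Metric (𝓡∂ (d + 1)) M₁)
    (M : Set M₁) (hM : GeodesicXRay.IsRegularDomain (𝓡∂ (d + 1)) M)
    {κ : Type*} [Fintype κ] (F : κ → GeodesicXRay.WeightedFamily g M d 𝕜) :
    -- `I_α` is a well-defined bounded operator on `L²(M₁)`
    (∃ C : ℝ≥0, ∀ f : GeodesicXRay.TensorField (𝓡∂ (d + 1)) M₁ 𝕜, GeodesicXRay.MemL2 g univ f →
      ∀ m,
        (∀ᵐ p ∂(F m).μ, p ∈ (F m).support → IntervalIntegrable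
          (GeodesicXRay.integrand f ((F m).γ p)) volume ((F m).lm p) ((F m).lp p)) ∧
        MemLp ((F m).weightedXray f) 2 (F m).μ ∧
        eLpNorm ((F m).weightedXray f) 2 (F m).μ ^ 2 ≤
          C * ∫⁻ x, ENNReal.ofReal (GeodesicXRay.tensorNormSq g x fun u w => f x u w)
            ∂(GeodesicXRay.vol g)) ∧
    -- (a), (b), (c) and (d), if `α ≠ 0` almost everywhere in the interior of its support
    ((∀ m, (F m).μ ((F m).supportInterior \ (F m).nonzeroSet) = 0) →
      [GeodesicXRay.SInjective g M (GeodesicXRay.WeightedXrayVanishes F),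
        GeodesicXRay.SInjective g M (GeodesicXRay.NormalVanishes F M),
        GeodesicXRay.SInjective g M (GeodesicXRay.NormalVanishes F univ),
        GeodesicXRay.SInjective g M
          (GeodesicXRay.XrayVanishesOn F fun m => (F m).supportInterior)].TFAE) ∧
    -- in general, the same with `{α ≠ 0}` in place of the interior of the support in (d)
    [GeodesicXRay.SInjective g M (GeodesicXRay.WeightedXrayVanishes F),
      GeodesicXRay.SInjective g M (GeodesicXRay.NormalVanishes F M),
      GeodesicXRay.SInjective g M (GeodesicXRay.NormalVanishes F univ),
      GeodesicXRay.SInjective g M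
        (GeodesicXRay.XrayVanishesOn F fun m => (F m).nonzeroSet)].TFAE ∧
    -- in general, (a) implies (d)
    (GeodesicXRay.SInjective g M (GeodesicXRay.WeightedXrayVanishes F) →
      GeodesicXRay.SInjective g M
        (GeodesicXRay.XrayVanishesOn F fun m => (F m).supportInterior)) := by
  have : SecondCountableTopology (EuclideanHalfSpace (d + 1)) :=
    inferInstanceAs (SecondCountableTopology {x : EuclideanSpace ℝ (Fin (d + 1)) // 0 ≤ x 0})
  have : SecondCountableTopology M₁ :=
    ChartedSpace.secondCountable_of_sigmaCompact (EuclideanHalfSpace (d + 1)) M₁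
  -- Taking `A = M` and `A = univ` settles both normal operators at once.
  have hN : ∀ A, M ⊆ A → (GeodesicXRay.SInjective g M (GeodesicXRay.WeightedXrayVanishes F) ↔
      GeodesicXRay.SInjective g M (GeodesicXRay.NormalVanishes F A)) := fun A hA =>
    GeodesicXRay.sInjective_congr fun f hf => GeodesicXRay.normalVanishes_iff rfl (hf.mono hA)
  have hX : GeodesicXRay.SInjective g M (GeodesicXRay.WeightedXrayVanishes F) ↔
      GeodesicXRay.SInjective g M
        (GeodesicXRay.XrayVanishesOn F fun m => (F m).nonzeroSet) :=
    GeodesicXRay.sInjective_congr fun f _ => GeodesicXRay.weightedXrayVanishes_iff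
  have hS : GeodesicXRay.SInjective g M
        (GeodesicXRay.XrayVanishesOn F fun m => (F m).nonzeroSet) →
      GeodesicXRay.SInjective g M
        (GeodesicXRay.XrayVanishesOn F fun m => (F m).supportInterior) := fun h =>
    h.of_imp fun f _ hf m => (hf m).mono fun p hp hpn =>
      hp ((F m).nonzeroSet_subset_supportInterior hpn)
  refine ⟨GeodesicXRay.exists_uniform_bound rfl F, fun h0 => ?_, ?_, fun h => hS (hX.1 h)⟩
  · tfae_have 1 ↔ 2 := hN M subset_rfl
    tfae_have 1 ↔ 3 := hN univ (subset_univ M)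
    tfae_have 1 → 4 := fun h => hS (hX.1 h)
    -- Only here is the assumption on `α` used: vanishing on `{α ≠ 0}` extends to the interior of
    -- the support up to a null set.
    tfae_have 4 → 1 := fun h => hX.2 <| h.of_imp fun f _ hf m => by
      filter_upwards [hf m, measure_eq_zero_iff_ae_notMem.1 (h0 m)] with p hp hp0 hps
      exact hp (not_not.1 fun hn => hp0 ⟨hps, hn⟩)
    tfae_finish
  · tfae_have 1 ↔ 2 := hN M subset_rfl
    tfae_have 1 ↔ 3 := hN univ (subset_univ M)
    tfae_have 1 ↔ 4 := hX
    tfae_finish
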